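/- An $h$-hypergraph is a hypergraph $H=(V,E)$ in which every hyperedge has at least $2$ and at most $h$ vertices; $m_i$ denotes the number of its hyperedges with exactly $i$ vertices (of arity $i$). A $k$-independent set of $H$ is a set of exactly $k$ vertices that contains no hyperedge of $H$ as a subset. Running times are counted on a word RAM with words of $\Theta(\log n)$ bits. Let $\omega$ be a real number such that $N\times N$ matrices whose entries are natural numbers bounded by a fixed power of $N$ can be multiplied in time $O(N^{\omega})$ in this model. **Theorem.** Let $h$ and $k$ be fixed non-negative integers with $k$ divisible by $3$. There is an algorithm that, given any $h$-hypergraph $H$ with $n\ge 1$ vertices, as the lists of its hyperedges of arity $2,\dots,h$ together with the numbers $m_2,\dots,m_h$, decides whether $H$ contains a $k$-independent set in time $$O\left(n^{\frac{k\omega}{3}}+\sum_{i=3}^{h}\min\left\{m_i^{\left\lceil\frac{k-i+3}{3}\right\rceil},\ m_i\,n^{k-i}\right\}\right),$$ where the constant hidden in the $O$-notation depends only on $h$, $k$, $\omega$ and on the matrix multiplication algorithm, and not on $n$, on the numbers $m_i$ or on $H$. In particular, the bound holds for $h$-hypergraphs with $m_i=\Theta(n^{\gamma_i})$ hyperedges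 of arity $i$, for any fixed exponents $\gamma_i$. -/

import Mathlib

/-! ## Word RAM

A program is a structured imperative program that works on finitely many arrays of machine words
(the arrays it mentions); a scalar variable is a cell with a fixed index. Every primitive operation
costs one step. The parameter `W` is the number of different machine words: a run is valid only if
every value it computes (including array indices) is smaller than `W`. -/

namespace WordRAM

/-- Memory contents: `s a i` is the word in cell `i` of array `a`. -/
abbrev Store := ℕ → ℕ → ℕ

/-- The operations on words. -/
inductive Op
  | add | sub | mul | div | mod | land | lor | xor | shl | shr | lt | eq

/-- Subtraction is truncated at zero, division by zero gives zero, comparisons give `0` or `1`. -/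
def Op.eval : Op → ℕ → ℕ → ℕ
  | .add, x, y => x + y
  | .sub, x, y => x - y
  | .mul, x, y => x * y
  | .div, x, y => x / y
  | .mod, x, y => x % y
  | .land, x, y => x &&& y
  | .lor, x, y => x ||| y
  | .xor, x, y => x ^^^ y
  | .shl, x, y => x <<< y
  | .shr, x, y => x >>> y
  | .lt, x, y => if x < y then 1 else 0
  | .eq, x, y => if x = y then 1 else 0

/-- Expressions: constants, reading a cell of an array, applying an operation. -/
inductive Expr
  | lit (c : ℕ)
  | get (a : ℕ) (i : Expr)
  | bin (op : Op) (x y : Expr)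

/-- The value of an expression. -/
def Expr.val (s : Store) : Expr → ℕ
  | .lit c => c
  | .get a i => s a (i.val s)
  | .bin op x y => op.eval (x.val s) (y.val s)

/-- All values that occur in the evaluation of an expression are machine words. -/
def Expr.Fits (W : ℕ) (s : Store) : Expr → Prop
  | .lit c => c < W
  | .get a i => i.Fits W s ∧ s a (i.val s) < W
  | .bin op x y => x.Fits W s ∧ y.Fits W s ∧ op.eval (x.val s) (y.val s) < W

/-- The number of steps for evaluating an expression: one for each of its nodes. -/
def Expr.cost : Expr → ℕ
  | .lit _ => 1
  | .get _ i => i.cost + 1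
  | .bin _ x y => x.cost + y.cost + 1

/-- Programs. `set a i x` stores the value of `x` in cell `i` of array `a`; a condition holds if its
value is not zero. -/
inductive Prog
  | skip
  | set (a : ℕ) (i x : Expr)
  | seq (p q : Prog)
  | ite (c : Expr) (p q : Prog)
  | while (c : Expr) (p : Prog)

/-- The store after writing `x` into cell `i` of array `a`. -/
def Store.write (s : Store) (a i x : ℕ) : Store :=
  Function.update s a (Function.update (s a) i x)

/-- `Exec W p s s' t`: with `W` different machine words, the program `p` started on the store `s`
halts after exactly `t` steps with the store `s'`, and all values computed are smaller than `W`. -/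
inductive Exec (W : ℕ) : Prog → Store → Store → ℕ → Prop
  | skip (s : Store) : Exec W .skip s s 1
  | set (s : Store) (a : ℕ) (i x : Expr) (hi : i.Fits W s) (hx : x.Fits W s) :
      Exec W (.set a i x) s (s.write a (i.val s) (x.val s)) (i.cost + x.cost + 1)
  | seq {p q : Prog} {s₁ s₂ s₃ : Store} {t₁ t₂ : ℕ} (hp : Exec W p s₁ s₂ t₁)
      (hq : Exec W q s₂ s₃ t₂) : Exec W (.seq p q) s₁ s₃ (t₁ + t₂)
  | ite_true {c : Expr} {p q : Prog} {s₁ s₂ : Store} {t : ℕ} (hc : c.Fits W s₁)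
      (h : c.val s₁ ≠ 0) (hp : Exec W p s₁ s₂ t) :
      Exec W (.ite c p q) s₁ s₂ (c.cost + 1 + t)
  | ite_false {c : Expr} {p q : Prog} {s₁ s₂ : Store} {t : ℕ} (hc : c.Fits W s₁)
      (h : c.val s₁ = 0) (hq : Exec W q s₁ s₂ t) :
      Exec W (.ite c p q) s₁ s₂ (c.cost + 1 + t)
  | while_true {c : Expr} {p : Prog} {s₁ s₂ s₃ : Store} {t₁ t₂ : ℕ} (hc : c.Fits W s₁)
      (h : c.val s₁ ≠ 0) (hp : Exec W p s₁ s₂ t₁) (hw : Exec W (.while c p) s₂ s₃ t₂) :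
      Exec W (.while c p) s₁ s₃ (c.cost + 1 + t₁ + t₂)
  | while_false {c : Expr} {p : Prog} {s : Store} (hc : c.Fits W s) (h : c.val s = 0) :
      Exec W (.while c p) s s (c.cost + 1)

/-- Array `a` holds the `N × N` matrix `A` in row-major order. -/
def HoldsMatrix (s : Store) (a : ℕ) {N : ℕ} (A : Matrix (Fin N) (Fin N) ℕ) : Prop :=
  ∀ i j : Fin N, s a (i * N + j) = A i j

/-- `N × N` matrices can be multiplied in `O(N ^ ω)` steps on a word RAM with words of `O(log N)`
bits: for every `d` there is one program that multiplies matrices with natural number entries of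
size at most `N ^ d`. The input is `N` in cell `0` of array `0` and the two factors in arrays `1`
and `2`; the product is left in array `3`. The program has to work for every sufficiently large
word size, and all cells outside the input initially hold arbitrary words. -/
def MatMulInTime (ω : ℝ) : Prop :=
  ∀ d : ℕ, ∃ (p : Prog) (C : ℝ) (c : ℕ), ∀ (N : ℕ), 1 ≤ N → ∀ (W : ℕ), (N + 2) ^ c ≤ W →
    ∀ (A B : Matrix (Fin N) (Fin N) ℕ), (∀ i j, A i j ≤ N ^ d) → (∀ i j, B i j ≤ N ^ d) →
    ∀ s : Store, (∀ a i, s a i < W) → s 0 0 = N → HoldsMatrix s 1 A → HoldsMatrix s 2 B →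
      ∃ (s' : Store) (t : ℕ), Exec W p s s' t ∧ (t : ℝ) ≤ C * (N : ℝ) ^ ω ∧
        HoldsMatrix s' 3 (A * B)

end WordRAM

/-! ## Hypergraphs -/

namespace Hypergraph

/-- Every edge has at least two and at most `h` vertices. -/
def IsArityAtMost (H : Hypergraph ℕ) (h : ℕ) : Prop :=
  ∀ e ∈ H.edgeSet, e.Finite ∧ 2 ≤ e.ncard ∧ e.ncard ≤ h

/-- The set of edges with exactly `i` vertices. -/
def edgesOfArity (H : Hypergraph ℕ) (i : ℕ) : Set (Set ℕ) :=
  {e ∈ H.edgeSet | e.ncard = i}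

/-- There is a set of `k` vertices that contains no edge. -/
def HasIndependentSet (H : Hypergraph ℕ) (k : ℕ) : Prop :=
  ∃ S : Finset ℕ, (S : Set ℕ) ⊆ H.vertexSet ∧ S.card = k ∧ ∀ e ∈ H.edgeSet, ¬ e ⊆ (S : Set ℕ)

/-- The store `s` contains the hypergraph `H` with vertices `0, …, n - 1` and arities from `2` to
`h` as input: cell `0` of array `0` is `n`, and for each arity `i`, cell `i` of array `1` is the
number of edges of arity `i`, while array `i` lists these edges, each exactly once and in any order,
the `j`-th one by its vertices, in any order, in the cells `j * i, …, j * i + (i - 1)`. -/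
def IsInput (H : Hypergraph ℕ) (n h : ℕ) (s : WordRAM.Store) : Prop :=
  s 0 0 = n ∧ ∀ i ∈ Finset.Icc 2 h, s 1 i = (H.edgesOfArity i).ncard ∧
    Set.BijOn (fun j => {v | ∃ r < i, v = s i (j * i + r)})
      (Set.Iio (H.edgesOfArity i).ncard) (H.edgesOfArity i)

end Hypergraph

/-! The program counts the `k`-independent sets, modulo `n ^ k + 1`. There are at most `n ^ k` of
them, so the residue tells whether there are any. Edges with more than `k` vertices play no role. An
arity `i ≥ 3` is "small" if `m_i ^ ⌈(k-i)/3⌉ ≤ n ^ (k-i)`, that is, if the first term of the minimum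
is at most the second (for `m_i > 0`); arity `2` always counts as small. The edges are listed with
the small arities first, in order of arity, and the large arities after them.

Large arities: a `k`-set free of the small edges is either independent or has a first large edge `E`
(`card_edgeFree`). For each `E`, the sets above it that contain no earlier edge are found by trying
all ways to add `k - |E|` vertices, in time `m_i n ^ (k-i)` per arity (`Run.countLarge`).

Small arities: fix a list `L` of chosen edges with `u` vertices in total, and consider the `k`-sets
`S` above them such that no edge before the current limit lies in `cover L ∪ {a, b}` with `a, b ∈
S`. This condition speaks of pairs. When the `k - u` remaining vertices, as an increasing list, are
cut into three parts, it becomes a condition on pairs of parts (`good_append`). The sets are thus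
counted like triangles, by one product of 0-1 matrices of size `n ^ ⌈(k-u)/3⌉` (`sum_good`,
`Run.countPairs`). Such an `S` may still contain an edge, but its first edge has at least three
vertices outside `cover L` (`PairsOk.extends`). Hence `pairs(L) = free(L) + Σ_E free(E :: L)`
(`card_pairsOk`), and solving for `free(L)` gives a recursion with alternating signs whose depth is
bounded because each level uses up three vertices (`Run.countFreeSets`).

Cost: put `X = n ^ ω`. The root costs `X ^ (k/3)`. Below a first edge `E` of arity `i`, only edges
before `E` are used. With `Y = X + E + 1`, each level has at most `Y` children and lowers the
exponent by at least one, so the subtree costs `O(Y ^ ⌈(k-i)/3⌉)` (`treeCost_le`), and all edges of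
arity `i` together cost `O(Y ^ ⌈(k-i+3)/3⌉)` for the last such `E`. By the ordering, `E + 1` is at
most the sum of the `m_j` over small arities `j ≤ i`, and for `j ≥ 3` the power of `m_j` in question
is at most the one in the term of `j` (`add_index_pow_le`). Pairs are harmless: `m_2 ≤ n ^ 2 ≤ X`,
since `ω ≥ 2` (`MatMulInTime.two_le`). -/

namespace WordRAM

open Finset

/-! ### Runs with step bounds, and loops -/

/-- All cells hold machine words. -/
def AllLt (W : ℕ) (s : Store) : Prop := ∀ a i, s a i < W

theorem write_apply (s : Store) (a i x b j : ℕ) :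
    s.write a i x b j = if b = a ∧ j = i then x else s b j := by
  unfold Store.write
  by_cases hb : b = a
  · subst hb
    by_cases hj : j = i
    · subst hj; simp
    · simp [hj]
  · simp [hb]

theorem write_same (s : Store) (a i x : ℕ) : s.write a i x a i = x := by simp [write_apply]

theorem AllLt.write {W : ℕ} {s : Store} (hs : AllLt W s) {a i x : ℕ} (hx : x < W) :
    AllLt W (s.write a i x) := by
  intro b j
  rw [write_apply]
  split_ifs
  exacts [hx, hs b j]

theorem Expr.Fits.val_lt {W : ℕ} {s : Store} {e : Expr} (he : e.Fits W s) : e.val s < W := by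
  cases e with
  | lit c => exact he
  | get a i => exact he.2
  | bin op x y => exact he.2.2

theorem Exec.allLt {W : ℕ} {p : Prog} {s s' : Store} {t : ℕ} (he : Exec W p s s' t) :
    AllLt W s → AllLt W s' := by
  induction he with
  | skip s => exact id
  | set s a i x hi hx => exact fun hs => hs.write hx.val_lt
  | seq _ _ ih₁ ih₂ => exact fun hs => ih₂ (ih₁ hs)
  | ite_true _ _ _ ih => exact ih
  | ite_false _ _ _ ih => exact ih
  | while_true _ _ _ _ ih₁ ih₂ => exact fun hs => ih₂ (ih₁ hs)
  | while_false _ _ => exact id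

/-- A run of `t` steps changes at most `t` cells of an array. -/
theorem Exec.exists_changed {W : ℕ} {p : Prog} {s s' : Store} {t : ℕ} (he : Exec W p s s' t)
    (a : ℕ) : ∃ F : Finset ℕ, F.card ≤ t ∧ ∀ i ∉ F, s' a i = s a i := by
  induction he with
  | skip s => exact ⟨∅, by simp, fun _ _ => rfl⟩
  | set s b i x hi hx =>
    refine ⟨{i.val s}, by simp, fun j hj => ?_⟩
    rw [write_apply, if_neg]
    rintro ⟨-, rfl⟩
    simp at hj
  | seq _ _ ih₁ ih₂ =>
    obtain ⟨F, hF, h1⟩ := ih₁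
    obtain ⟨G, hG, h2⟩ := ih₂
    refine ⟨F ∪ G, (card_union_le _ _).trans (by omega), fun i hi => ?_⟩
    rw [mem_union, not_or] at hi
    rw [h2 i hi.2, h1 i hi.1]
  | ite_true _ _ _ ih => obtain ⟨F, hF, h1⟩ := ih; exact ⟨F, by omega, h1⟩
  | ite_false _ _ _ ih => obtain ⟨F, hF, h1⟩ := ih; exact ⟨F, by omega, h1⟩
  | while_true _ _ _ _ ih₁ ih₂ =>
    obtain ⟨F, hF, h1⟩ := ih₁
    obtain ⟨G, hG, h2⟩ := ih₂
    refine ⟨F ∪ G, (card_union_le _ _).trans (by omega), fun i hi => ?_⟩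
    rw [mem_union, not_or] at hi
    rw [h2 i hi.2, h1 i hi.1]
  | while_false _ _ => exact ⟨∅, by simp, fun _ _ => rfl⟩

/-- `p` started on `s` halts within `T` steps in a store of machine words satisfying `Q`. -/
def Run (W : ℕ) (p : Prog) (s : Store) (T : ℝ) (Q : Store → Prop) : Prop :=
  ∃ (s₁ : Store) (t : ℕ), Exec W p s s₁ t ∧ (t : ℝ) ≤ T ∧ AllLt W s₁ ∧ Q s₁

/-- `e` is evaluated to `v` without overflow. -/
def Ev (W : ℕ) (s : Store) (e : Expr) (v : ℕ) : Prop := e.Fits W s ∧ e.val s = v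

section Run

variable {W : ℕ} {s : Store} {T T' : ℝ} {Q Q' : Store → Prop} {p q : Prog}

theorem Run.mono (hr : Run W p s T Q) (hT : T ≤ T') (hQ : ∀ s', AllLt W s' → Q s' → Q' s') :
    Run W p s T' Q' := by
  obtain ⟨s', t, he, ht, hl, hq⟩ := hr
  exact ⟨s', t, he, ht.trans hT, hl, hQ s' hl hq⟩

theorem Run.skip (hs : AllLt W s) (hT : 1 ≤ T) (hQ : Q s) : Run W .skip s T Q :=
  ⟨s, 1, .skip s, by simpa using hT, hs, hQ⟩

theorem Run.set (hs : AllLt W s) {a : ℕ} {i x : Expr} {iv xv : ℕ} (hi : Ev W s i iv)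
    (hx : Ev W s x xv) (hT : ((i.cost + x.cost + 1 : ℕ) : ℝ) ≤ T) (hQ : Q (s.write a iv xv)) :
    Run W (.set a i x) s T Q := by
  obtain ⟨hi, rfl⟩ := hi
  obtain ⟨hx, rfl⟩ := hx
  exact ⟨_, _, .set s a i x hi hx, hT, hs.write hx.val_lt, hQ⟩

theorem Run.seq {T₁ T₂ : ℝ} {Q₁ : Store → Prop} (hp : Run W p s T₁ Q₁)
    (hq : ∀ s', AllLt W s' → Q₁ s' → Run W q s' T₂ Q) : Run W (.seq p q) s (T₁ + T₂) Q := by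
  obtain ⟨s₁, t₁, he₁, ht₁, hl₁, h₁⟩ := hp
  obtain ⟨s₂, t₂, he₂, ht₂, hl₂, h₂⟩ := hq s₁ hl₁ h₁
  exact ⟨s₂, _, .seq he₁ he₂, by push_cast; linarith, hl₂, h₂⟩

theorem Run.ite {c : Expr} {v : ℕ} (hc : Ev W s c v) (hp : v ≠ 0 → Run W p s T Q)
    (hq : v = 0 → Run W q s T Q) : Run W (.ite c p q) s (c.cost + 1 + T) Q := by
  obtain ⟨hc, rfl⟩ := hc
  by_cases h : c.val s = 0
  · obtain ⟨s', t, he, ht, hl, h'⟩ := hq h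
    exact ⟨s', _, .ite_false hc h he, by push_cast; linarith, hl, h'⟩
  · obtain ⟨s', t, he, ht, hl, h'⟩ := hp h
    exact ⟨s', _, .ite_true hc h he, by push_cast; linarith, hl, h'⟩

theorem Ev.lit {c : ℕ} (hc : c < W) : Ev W s (.lit c) c := ⟨hc, rfl⟩

theorem Ev.get (hs : AllLt W s) {a iv : ℕ} {i : Expr} (hi : Ev W s i iv) :
    Ev W s (.get a i) (s a iv) := by
  obtain ⟨hi, rfl⟩ := hi
  exact ⟨⟨hi, hs _ _⟩, rfl⟩

theorem Ev.bin {op : Op} {x y : Expr} {xv yv : ℕ} (hx : Ev W s x xv) (hy : Ev W s y yv)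
    (hv : op.eval xv yv < W) : Ev W s (.bin op x y) (op.eval xv yv) := by
  obtain ⟨hx, rfl⟩ := hx
  obtain ⟨hy, rfl⟩ := hy
  exact ⟨⟨hx, hy, hv⟩, rfl⟩

theorem Ev.lt_word {e : Expr} {v : ℕ} (he : Ev W s e v) : v < W := he.2 ▸ he.1.val_lt

theorem Ev.self {e : Expr} (he : e.Fits W s) : Ev W s e (e.val s) := ⟨he, rfl⟩

theorem Ev.congr {e : Expr} {v v' : ℕ} (he : Ev W s e v) (h : v = v') : Ev W s e v' := h ▸ he

/-- The cell `v` of array `a`. -/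
abbrev cell (a v : ℕ) : Expr := .get a (.lit v)

theorem Ev.cell (hs : AllLt W s) {a v : ℕ} (hv : v < W) : Ev W s (cell a v) (s a v) :=
  Ev.get hs (Ev.lit hv)

/-- `for v := lo to hi - 1 do body`, where the counter is cell `v` of array `a`. -/
def forLoop (a v : ℕ) (lo hi : Expr) (body : Prog) : Prog :=
  .seq (.set a (.lit v) lo)
    (.while (.bin .lt (cell a v) hi)
      (.seq body (.set a (.lit v) (.bin .add (cell a v) (.lit 1)))))

/-- Induction on the number `d` of remaining rounds. The invariant is required after the counter has
been increased, because the counter is itself a cell of the store. The bound `hi` is evaluated anew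
in each round, so the invariant must keep its value. The overhead `hi.cost + 10` is `hi.cost + 4`
for the test and `6` for the increment. -/
theorem Run.while_aux {A v b : ℕ} {hi : Expr} {body : Prog} {T : ℕ → ℝ} (I : ℕ → Store → Prop)
    (hb : b < W) (hv : v < W) {a₀ : ℕ}
    (hhi : ∀ i s, AllLt W s → a₀ ≤ i → i ≤ b → s A v = i → I i s → Ev W s hi b)
    (step : ∀ i s, AllLt W s → a₀ ≤ i → i < b → s A v = i → I i s →
      Run W body s (T i) (fun s' => s' A v = i ∧ I (i + 1) (s'.write A v (i + 1)))) (d : ℕ) :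
    ∀ (a : ℕ) (s : Store), a₀ ≤ a → a + d = b → AllLt W s → s A v = a → I a s →
    Run W (.while (.bin .lt (WordRAM.cell A v) hi)
      (.seq body (.set A (.lit v) (.bin .add (WordRAM.cell A v) (.lit 1))))) s
      ((∑ i ∈ Ico a b, (T i + (hi.cost + 10))) + (hi.cost + 4))
      (fun s' => s' A v = b ∧ I b s') := by
  induction d with
  | zero =>
    intro a s ha hd hs hsv hI
    obtain rfl : a = b := by omega
    obtain ⟨hf, hv'⟩ := hhi a s hs ha le_rfl hsv hI
    refine ⟨s, _, .while_false (c := .bin .lt (WordRAM.cell A v) hi) ⟨⟨hv, hs _ _⟩, hf, ?_⟩ ?_,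
      ?_, hs, hsv, hI⟩
    · simp only [Op.eval]; split_ifs <;> omega
    · simp [Expr.val, Op.eval, hsv, hv']
    · simp [Expr.cost]; linarith
  | succ d ih =>
    intro a s ha hd hs hsv hI
    obtain ⟨hf, hv'⟩ := hhi a s hs ha (by omega) hsv hI
    obtain ⟨s₁, t₁, he₁, ht₁, hl₁, h₁, hI₁⟩ := step a s hs ha (by omega) hsv hI
    obtain ⟨s₂, t₂, he₂, ht₂, hl₂, h₂⟩ := ih (a + 1) (s₁.write A v (a + 1)) (by omega) (by omega)
      (hl₁.write (by omega)) (write_same _ _ _ _) hI₁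
    have hset : Exec W (.set A (.lit v) (.bin .add (WordRAM.cell A v) (.lit 1))) s₁
        (s₁.write A v (a + 1)) (1 + 4 + 1) := by
      have := Exec.set (W := W) s₁ A (.lit v) (.bin .add (WordRAM.cell A v) (.lit 1)) hv
        ⟨⟨hv, hl₁ _ _⟩, (show 1 < W by omega), (by simp [Expr.val, Op.eval, h₁]; omega)⟩
      simpa only [Expr.val, Op.eval, h₁, Expr.cost] using this
    refine ⟨s₂, _, .while_true (c := .bin .lt (WordRAM.cell A v) hi) ⟨⟨hv, hs _ _⟩, hf, ?_⟩ ?_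
      (.seq he₁ hset) he₂, ?_, hl₂, h₂⟩
    · simp only [Op.eval]; split_ifs <;> omega
    · simp only [Expr.val, Op.eval, hsv, hv']; rw [if_pos (by omega)]; simp
    · rw [sum_eq_sum_Ico_succ_bot (show a < b by omega)]
      simp only [Expr.cost]
      push_cast
      linarith

theorem Run.forLoop (hs : AllLt W s) {A v a b : ℕ} {lo hi : Expr} {body : Prog} {T : ℕ → ℝ}
    (I : ℕ → Store → Prop) (hab : a ≤ b) (hb : b < W) (hv : v < W) (hlo : Ev W s lo a)
    (h0 : I a (s.write A v a))
    (hhi : ∀ i s, AllLt W s → a ≤ i → i ≤ b → s A v = i → I i s → Ev W s hi b)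
    (step : ∀ i s, AllLt W s → a ≤ i → i < b → s A v = i → I i s →
      Run W body s (T i) (fun s' => s' A v = i ∧ I (i + 1) (s'.write A v (i + 1)))) :
    Run W (forLoop A v lo hi body) s
      ((∑ i ∈ Ico a b, (T i + (hi.cost + 10))) + (lo.cost + hi.cost + 6))
      (fun s' => s' A v = b ∧ I b s') := by
  refine Run.mono (Run.seq (T₁ := lo.cost + 2)
    (T₂ := (∑ i ∈ Ico a b, (T i + (hi.cost + 10))) + (hi.cost + 4))
    (Q₁ := fun s' => s' = s.write A v a)
    (Run.set hs (Ev.lit hv) hlo (by simp [Expr.cost]; linarith) rfl) ?_) (by linarith)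
    (fun _ _ h => h)
  rintro s' hl rfl
  exact Run.while_aux I hb hv hhi step (b - a) a _ le_rfl (by omega) hl (write_same _ _ _ _) h0

end Run

/-! ### Relocation of arrays -/

/-- The expression that uses array `a + K` in place of array `a`. -/
def Expr.shift (K : ℕ) : Expr → Expr
  | .lit c => .lit c
  | .get a i => .get (a + K) (i.shift K)
  | .bin op x y => .bin op (x.shift K) (y.shift K)

/-- The program that uses array `a + K` in place of array `a`. -/
def Prog.shift (K : ℕ) : Prog → Prog
  | .skip => .skip
  | .set a i x => .set (a + K) (i.shift K) (x.shift K)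
  | .seq p q => .seq (p.shift K) (q.shift K)
  | .ite c p q => .ite (c.shift K) (p.shift K) (q.shift K)
  | .while c p => .while (c.shift K) (p.shift K)

/-- The arrays from `K` on. -/
def Store.drop (K : ℕ) (s : Store) : Store := fun a => s (a + K)

/-- The store with the arrays from `K` on replaced. -/
def Store.glue (K : ℕ) (s u : Store) : Store := fun a => if a < K then s a else u (a - K)

theorem Store.drop_glue (K : ℕ) (s u : Store) : (s.glue K u).drop K = u := by
  funext a; simp [Store.drop, Store.glue]

theorem Store.glue_drop (K : ℕ) (s : Store) : s.glue K (s.drop K) = s := by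
  funext a
  simp only [Store.drop, Store.glue]
  split_ifs with h
  · rfl
  · congr 1; omega

theorem Store.glue_write (K : ℕ) (s u : Store) (a i x : ℕ) :
    (s.glue K u).write (a + K) i x = s.glue K (u.write a i x) := by
  funext b j
  by_cases hb : b < K
  · rw [write_apply, if_neg (by omega)]
    simp [Store.glue, hb]
  · simp only [write_apply, Store.glue, hb, if_false]
    by_cases hj : b = a + K ∧ j = i
    · rw [if_pos hj, if_pos (by omega)]
    · rw [if_neg hj, if_neg (by omega)]

theorem Expr.val_shift (K : ℕ) (s u : Store) (e : Expr) :
    (e.shift K).val (s.glue K u) = e.val u := by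
  induction e with
  | lit c => rfl
  | get a i ih => simp only [Expr.shift, Expr.val, ih, Store.glue]; simp
  | bin op x y ihx ihy => simp [Expr.shift, Expr.val, ihx, ihy]

theorem Expr.fits_shift {W : ℕ} (K : ℕ) (s u : Store) (e : Expr) :
    (e.shift K).Fits W (s.glue K u) ↔ e.Fits W u := by
  induction e with
  | lit c => rfl
  | get a i ih => simp only [Expr.shift, Expr.Fits, ih, Expr.val_shift, Store.glue]; simp
  | bin op x y ihx ihy => simp [Expr.shift, Expr.Fits, ihx, ihy, Expr.val_shift]

theorem Expr.cost_shift (K : ℕ) (e : Expr) : (e.shift K).cost = e.cost := by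
  induction e with
  | lit c => rfl
  | get a i ih => simp [Expr.shift, Expr.cost, ih]
  | bin op x y ihx ihy => simp [Expr.shift, Expr.cost, ihx, ihy]

theorem Exec.shift {W : ℕ} {p : Prog} {u u' : Store} {t : ℕ} (he : Exec W p u u' t) (K : ℕ)
    (s : Store) : Exec W (p.shift K) (s.glue K u) (s.glue K u') t := by
  induction he with
  | skip u => exact .skip _
  | set u a i x hi hx =>
    have := Exec.set (W := W) (s.glue K u) (a + K) (i.shift K) (x.shift K)
      ((Expr.fits_shift K s u i).2 hi) ((Expr.fits_shift K s u x).2 hx)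
    simp only [Expr.val_shift, Expr.cost_shift, Store.glue_write] at this
    exact this
  | seq _ _ ih₁ ih₂ => exact .seq ih₁ ih₂
  | @ite_true c p q u u' t hc h _ ih =>
    rw [← Expr.cost_shift K c]
    exact .ite_true ((Expr.fits_shift K s u c).2 hc) (by rwa [Expr.val_shift]) ih
  | @ite_false c p q u u' t hc h _ ih =>
    rw [← Expr.cost_shift K c]
    exact .ite_false ((Expr.fits_shift K s u c).2 hc) (by rwa [Expr.val_shift]) ih
  | @while_true c p u u' u'' t t' hc h _ _ ih₁ ih₂ =>
    rw [← Expr.cost_shift K c]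
    exact .while_true ((Expr.fits_shift K s u c).2 hc) (by rwa [Expr.val_shift]) ih₁ ih₂
  | @while_false c p u hc h =>
    rw [← Expr.cost_shift K c]
    exact .while_false ((Expr.fits_shift K s u c).2 hc) (by rwa [Expr.val_shift])

/-- The relocated matrix multiplication. -/
theorem Run.shift {W : ℕ} {p : Prog} {u u' s : Store} {t K : ℕ} {T : ℝ} {Q : Store → Prop}
    (hs : AllLt W s) (he : Exec W p u u' t) (hu : s.drop K = u) (ht : (t : ℝ) ≤ T)
    (hQ : ∀ s' : Store, (∀ a < K, s' a = s a) → s'.drop K = u' → Q s') :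
    Run W (p.shift K) s T Q := by
  have h := he.shift K s
  rw [← hu, Store.glue_drop] at h
  refine ⟨_, t, h, ht, h.allLt hs, hQ _ ?_ (Store.drop_glue _ _ _)⟩
  intro a ha
  simp [Store.glue, ha]

/-! ### The exponent of matrix multiplication is at least two -/

/-- Multiply two all-ones matrices with the product array initially zero. All `N ^ 2` entries of the
product are nonzero, so each of these cells has to change, and `t` steps change at most `t` cells.
-/
theorem sq_le_of_matMul {p : Prog} {C ω : ℝ} {c : ℕ}
    (hp : ∀ (N : ℕ), 1 ≤ N → ∀ (W : ℕ), (N + 2) ^ c ≤ W →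
      ∀ (A B : Matrix (Fin N) (Fin N) ℕ), (∀ i j, A i j ≤ N ^ 0) → (∀ i j, B i j ≤ N ^ 0) →
      ∀ s : Store, (∀ a i, s a i < W) → s 0 0 = N → HoldsMatrix s 1 A → HoldsMatrix s 2 B →
        ∃ (s' : Store) (t : ℕ), Exec W p s s' t ∧ (t : ℝ) ≤ C * (N : ℝ) ^ ω ∧
          HoldsMatrix s' 3 (A * B)) (N : ℕ) (hN : 1 ≤ N) :
    (N : ℝ) ^ 2 ≤ C * (N : ℝ) ^ ω := by
  obtain ⟨s', t, he, ht, hm⟩ := hp N hN ((N + 2) ^ c + N + 2) (by omega) (fun _ _ => 1)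
    (fun _ _ => 1) (by simp) (by simp)
    (fun a _ => if a = 0 then N else if a = 3 then 0 else 1)
    (fun a i => by split_ifs <;> omega) rfl (fun i j => rfl) (fun i j => rfl)
  obtain ⟨F, hF, hs⟩ := he.exists_changed 3
  have hsub : Finset.range (N * N) ⊆ F := by
    intro x hx
    by_contra hxF
    rw [Finset.mem_range] at hx
    have h1 := (hm ⟨x / N, Nat.div_lt_of_lt_mul hx⟩ ⟨x % N, Nat.mod_lt _ (by omega)⟩).trans
      Matrix.mul_apply
    simp only [Nat.div_add_mod', hs x hxF] at h1
    simp at h1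
    omega
  have := Finset.card_le_card hsub
  rw [Finset.card_range] at this
  refine le_trans ?_ ht
  rw [sq]
  exact_mod_cast this.trans hF

/-- If `ω < 2`, then `N ^ (2 - ω)` would be unbounded, although `sq_le_of_matMul` bounds it by `C`.
-/
theorem MatMulInTime.two_le {ω : ℝ} (hω : MatMulInTime ω) : 2 ≤ ω := by
  obtain ⟨p, C, c, hp⟩ := hω 0
  have h := sq_le_of_matMul hp
  by_contra! hlt
  have hC : 0 < C := by
    have := h 1 le_rfl
    simp at this
    linarith
  have ht : Filter.Tendsto (fun N : ℕ => (N : ℝ) ^ (2 - ω)) Filter.atTop Filter.atTop :=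
    (tendsto_rpow_atTop (by linarith)).comp tendsto_natCast_atTop_atTop
  obtain ⟨N, hN, hN1⟩ := ((ht.eventually_gt_atTop C).and (Filter.eventually_ge_atTop 1)).exists
  have hpos : (0 : ℝ) < N := by exact_mod_cast hN1
  have h2 := h N hN1
  rw [Real.rpow_sub hpos, lt_div_iff₀ (Real.rpow_pos_of_pos hpos _)] at hN
  rw [Real.rpow_two] at hN
  linarith

/-! ### Truth values, expressions for predicates, and numbers as lists of digits -/

open Classical in
/-- The truth value of a proposition as a number. -/
noncomputable def ind (P : Prop) : ℕ := if P then 1 else 0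

theorem ind_le_one (P : Prop) : ind P ≤ 1 := by unfold ind; split_ifs <;> simp

theorem ind_true {P : Prop} (h : P) : ind P = 1 := if_pos h

theorem ind_false {P : Prop} (h : ¬ P) : ind P = 0 := if_neg h

theorem ind_ne_zero {P : Prop} : ind P ≠ 0 ↔ P := by
  unfold ind; split_ifs with h <;> simp [h]

theorem ind_eq_zero {P : Prop} : ind P = 0 ↔ ¬ P := by
  unfold ind; split_ifs with h <;> simp [h]

theorem ind_and (P Q : Prop) : ind (P ∧ Q) = ind P * ind Q := by
  by_cases hP : P <;> by_cases hQ : Q <;> simp [ind, hP, hQ]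

/-- `e` is evaluated to the truth value of `P` without overflow. -/
def EvP (W : ℕ) (s : Store) (e : Expr) (P : Prop) : Prop := Ev W s e (ind P)

/-- All expressions of a list can be evaluated without overflow. -/
def FitsL (W : ℕ) (s : Store) (es : List Expr) : Prop := ∀ e ∈ es, e.Fits W s

/-- The values of a list of expressions. -/
def vals (s : Store) (es : List Expr) : List ℕ := es.map (Expr.val s)

def andE (x y : Expr) : Expr := .bin .mul x y
def ltE (x y : Expr) : Expr := .bin .lt x y
def eqE (x y : Expr) : Expr := .bin .eq x y
def notE (x : Expr) : Expr := .bin .eq x (.lit 0)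
def addE (x y : Expr) : Expr := .bin .add x y
def mulE (x y : Expr) : Expr := .bin .mul x y
def divE (x y : Expr) : Expr := .bin .div x y
def modE (x y : Expr) : Expr := .bin .mod x y

/-- The conjunction of the expressions `f a` with `a` in a list. -/
def allE {α : Type} : List α → (α → Expr) → Expr
  | [], _ => .lit 1
  | a :: l, f => andE (f a) (allE l f)

def memE (x : Expr) (es : List Expr) : Expr := notE (allE es fun e => notE (eqE x e))

/-- The number of distinct values of a list of expressions. -/
def distinctE : List Expr → Expr
  | [] => .lit 0
  | e :: es => addE (distinctE es) (notE (memE e es))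

/-- The values of a list of expressions increase strictly. -/
def increasingE : List Expr → Expr
  | [] => .lit 1
  | e :: es => andE (allE es fun e' => ltE e e') (increasingE es)

def powE (x : Expr) : ℕ → Expr
  | 0 => .lit 1
  | g + 1 => mulE (powE x g) x

/-- The number with given digits in base `n`. -/
def keyE (n : Expr) : List Expr → Expr
  | [] => .lit 0
  | e :: es => addE e (mulE n (keyE n es))

/-- The last `g` digits of `x` in base `n`. -/
def digitsE (n : Expr) : ℕ → Expr → List Expr
  | 0, _ => []
  | g + 1, x => modE x n :: digitsE n g (divE x n)

/-- The last `g` digits of `x` in base `n`. -/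
def digits (n : ℕ) : ℕ → ℕ → List ℕ
  | 0, _ => []
  | g + 1, x => x % n :: digits n g (x / n)

/-- All lists of `h` elements of a list. -/
def tuples {α : Type} : ℕ → List α → List (List α)
  | 0, _ => [[]]
  | h + 1, A => A.flatMap fun a => (tuples h A).map (a :: ·)

theorem mem_tuples {α : Type} {h : ℕ} {A w : List α} :
    w ∈ tuples h A ↔ w.length = h ∧ ∀ a ∈ w, a ∈ A := by
  induction h generalizing w with
  | zero =>
    simp only [tuples, List.mem_singleton, List.length_eq_zero_iff]
    constructor
    · rintro rfl; simp
    · exact And.left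
  | succ h ih =>
    cases w with
    | nil => simp [tuples]
    | cons b w =>
      simp only [tuples, List.mem_flatMap, List.mem_map, List.cons.injEq, ih, List.length_cons,
        List.mem_cons, forall_eq_or_imp]
      constructor
      · rintro ⟨a, ha, x, ⟨hx, hxA⟩, rfl, rfl⟩
        exact ⟨by omega, ha, hxA⟩
      · rintro ⟨hl, hb, hw⟩
        exact ⟨b, hb, w, ⟨by omega, hw⟩, rfl, rfl⟩

theorem length_digits (n g x : ℕ) : (digits n g x).length = g := by
  induction g generalizing x with
  | zero => rfl
  | succ g ih => simp [digits, ih]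

theorem digits_lt {n : ℕ} (hn : 0 < n) (g x : ℕ) : ∀ v ∈ digits n g x, v < n := by
  induction g generalizing x with
  | zero => simp [digits]
  | succ g ih =>
    simp only [digits, List.mem_cons, forall_eq_or_imp]
    exact ⟨Nat.mod_lt _ hn, ih _⟩

theorem ofDigits_lt {n : ℕ} {l : List ℕ} (hl : ∀ v ∈ l, v < n) : Nat.ofDigits n l < n ^ l.length := by
  induction l with
  | nil => simp
  | cons a l ih =>
    simp only [List.mem_cons, forall_eq_or_imp] at hl
    have := ih hl.2
    rw [Nat.ofDigits_cons, List.length_cons, pow_succ']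
    nlinarith

theorem ofDigits_inj {n : ℕ} {l l' : List ℕ} (hlen : l.length = l'.length) (hl : ∀ v ∈ l, v < n)
    (hl' : ∀ v ∈ l', v < n) (he : Nat.ofDigits n l = Nat.ofDigits n l') : l = l' := by
  induction l generalizing l' with
  | nil => exact (List.length_eq_zero_iff.1 hlen.symm).symm
  | cons a l ih =>
    cases l' with
    | nil => simp at hlen
    | cons b l' =>
      simp only [List.mem_cons, forall_eq_or_imp] at hl hl'
      simp only [Nat.ofDigits_cons] at he
      have h1 := congrArg (· % n) he
      simp only [Nat.add_mul_mod_self_left, Nat.mod_eq_of_lt hl.1, Nat.mod_eq_of_lt hl'.1] at h1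
      subst h1
      have h2 : n * Nat.ofDigits n l = n * Nat.ofDigits n l' := by omega
      rw [ih (by simpa using hlen) hl.2 hl'.2 (Nat.eq_of_mul_eq_mul_left (by omega) h2)]

section Eval

variable {W : ℕ} {s : Store}

theorem EvP.congr {e : Expr} {P P' : Prop} (he : EvP W s e P) (h : P ↔ P') : EvP W s e P' := by
  rwa [← propext h]

theorem EvP.ind_lt {e : Expr} {P : Prop} (he : EvP W s e P) : ind P < W := Ev.lt_word he

theorem EvP.true (hW : 1 < W) {P : Prop} (h : P) : EvP W s (.lit 1) P := by
  rw [EvP, ind_true h]; exact Ev.lit hW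

theorem EvP.and {x y : Expr} {P Q : Prop} (hx : EvP W s x P) (hy : EvP W s y Q) :
    EvP W s (andE x y) (P ∧ Q) := by
  rw [EvP, ind_and]
  refine Ev.bin hx hy ?_
  have := ind_le_one P
  have := hy.ind_lt
  have := ind_le_one Q
  simp only [Op.eval]
  nlinarith

theorem EvP.lt (hW : 1 < W) {x y : Expr} {a b : ℕ} (hx : Ev W s x a) (hy : Ev W s y b) :
    EvP W s (ltE x y) (a < b) := by
  refine (Ev.bin hx hy (op := .lt) ?_).congr ?_ <;> simp only [Op.eval, ind] <;> split_ifs <;> omega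

theorem EvP.eq (hW : 1 < W) {x y : Expr} {a b : ℕ} (hx : Ev W s x a) (hy : Ev W s y b) :
    EvP W s (eqE x y) (a = b) := by
  refine (Ev.bin hx hy (op := .eq) ?_).congr ?_ <;> simp only [Op.eval, ind] <;> split_ifs <;> omega

theorem EvP.not (hW : 1 < W) {x : Expr} {P : Prop} (hx : EvP W s x P) :
    EvP W s (notE x) (¬ P) := by
  have := EvP.eq hW hx (Ev.lit (by omega : 0 < W))
  exact this.congr ind_eq_zero

theorem Ev.add {x y : Expr} {a b : ℕ} (hx : Ev W s x a) (hy : Ev W s y b) (h : a + b < W) :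
    Ev W s (addE x y) (a + b) := Ev.bin hx hy h

theorem Ev.mul {x y : Expr} {a b : ℕ} (hx : Ev W s x a) (hy : Ev W s y b) (h : a * b < W) :
    Ev W s (mulE x y) (a * b) := Ev.bin hx hy h

theorem Ev.div {x y : Expr} {a b : ℕ} (hx : Ev W s x a) (hy : Ev W s y b) :
    Ev W s (divE x y) (a / b) := Ev.bin hx hy ((Nat.div_le_self _ _).trans_lt hx.lt_word)

theorem Ev.mod {x y : Expr} {a b : ℕ} (hx : Ev W s x a) (hy : Ev W s y b) :
    Ev W s (modE x y) (a % b) := Ev.bin hx hy ((Nat.mod_le _ _).trans_lt hx.lt_word)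

theorem EvP.all {α : Type} (hW : 1 < W) {l : List α} {f : α → Expr} {P : α → Prop}
    (hf : ∀ a ∈ l, EvP W s (f a) (P a)) : EvP W s (allE l f) (∀ a ∈ l, P a) := by
  induction l with
  | nil => exact EvP.true hW (by simp)
  | cons a l ih =>
    simp only [List.mem_cons, forall_eq_or_imp] at hf ⊢
    exact hf.1.and (ih hf.2)

theorem EvP.mem (hW : 1 < W) {x : Expr} {a : ℕ} {es : List Expr} (hx : Ev W s x a)
    (hes : FitsL W s es) : EvP W s (memE x es) (a ∈ vals s es) := by
  refine (EvP.not hW (EvP.all hW fun e he => EvP.not hW (EvP.eq hW hx (Ev.self (hes e he))))).congr ?_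
  simp only [vals, List.mem_map, not_forall, not_not]
  constructor
  · rintro ⟨e, he, h⟩; exact ⟨e, he, h.symm⟩
  · rintro ⟨e, he, h⟩; exact ⟨e, he, h.symm⟩

theorem Ev.distinct (hW : 1 < W) {es : List Expr} (hes : FitsL W s es) (hl : es.length < W) :
    Ev W s (distinctE es) (vals s es).toFinset.card := by
  induction es with
  | nil => exact Ev.lit (by omega)
  | cons e es ih =>
    simp only [FitsL, List.mem_cons, forall_eq_or_imp] at hes
    rw [List.length_cons] at hl
    have hv : (vals s (e :: es)).toFinset.card =
        (vals s es).toFinset.card + ind (¬ e.val s ∈ vals s es) := by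
      by_cases hm : e.val s ∈ vals s es
      · simp only [ind, hm, not_true_eq_false, if_false]
        simp only [vals, List.map_cons, List.toFinset_cons] at hm ⊢
        rw [insert_eq_self.2 (List.mem_toFinset.2 hm)]; rfl
      · simp only [ind, hm, not_false_eq_true, if_true]
        simp only [vals, List.map_cons, List.toFinset_cons] at hm ⊢
        rw [card_insert_of_notMem (mt List.mem_toFinset.1 hm)]
    refine (Ev.add (ih hes.2 (by omega)) (EvP.not hW (EvP.mem hW (Ev.self hes.1) hes.2)) ?_).congr
      hv.symm
    rw [← hv]
    refine lt_of_le_of_lt (List.toFinset_card_le _) ?_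
    simp only [vals, List.length_map, List.length_cons]
    omega

theorem EvP.increasing (hW : 1 < W) {es : List Expr} (hes : FitsL W s es) :
    EvP W s (increasingE es) ((vals s es).Pairwise (· < ·)) := by
  induction es with
  | nil => exact EvP.true hW (by simp [vals])
  | cons e es ih =>
    simp only [FitsL, List.mem_cons, forall_eq_or_imp] at hes
    refine ((EvP.all hW fun e' he' => EvP.lt hW (Ev.self hes.1) (Ev.self (hes.2 e' he'))).and
      (ih hes.2)).congr ?_
    simp [vals]

theorem Ev.pow {x : Expr} {a g : ℕ} (hx : Ev W s x a) (h : ∀ g' ≤ g, a ^ g' < W) :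
    Ev W s (powE x g) (a ^ g) := by
  induction g with
  | zero => exact Ev.lit (by simpa using h 0 le_rfl)
  | succ g ih =>
    rw [pow_succ]
    exact Ev.mul (ih fun g' hg' => h g' (by omega)) hx (by rw [← pow_succ]; exact h _ le_rfl)

theorem Ev.key {nE : Expr} {n : ℕ} (hn : Ev W s nE n) {es : List Expr} (hes : FitsL W s es)
    (hlt : ∀ v ∈ vals s es, v < n) (hpos : 0 < n) (h : n ^ es.length < W) :
    Ev W s (keyE nE es) (Nat.ofDigits n (vals s es)) := by
  induction es with
  | nil => exact Ev.lit (by omega)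
  | cons e es ih =>
    have hb := ofDigits_lt hlt
    simp only [FitsL, vals, List.map_cons, List.mem_cons, forall_eq_or_imp] at hes hlt
    simp only [vals, List.map_cons, Nat.ofDigits_cons, List.length_cons,
      List.length_map] at hb h ⊢
    have h2 : n ^ es.length < W := lt_of_le_of_lt (Nat.pow_le_pow_right hpos (by omega)) h
    exact Ev.add (Ev.self hes.1) (Ev.mul hn (ih hes.2 hlt.2 h2) (by omega)) (by omega)

theorem vals_append (es es' : List Expr) : vals s (es ++ es') = vals s es ++ vals s es' :=
  List.map_append

theorem FitsL.append {es es' : List Expr} (h : FitsL W s es) (h' : FitsL W s es') :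
    FitsL W s (es ++ es') := by
  intro e he
  rcases List.mem_append.1 he with he | he
  exacts [h e he, h' e he]

theorem Ev.digits {nE x : Expr} {n v g : ℕ} (hn : Ev W s nE n) (hx : Ev W s x v) :
    FitsL W s (digitsE nE g x) ∧ vals s (digitsE nE g x) = digits n g v := by
  induction g generalizing x v with
  | zero => simp [digitsE, FitsL, vals, WordRAM.digits]
  | succ g ih =>
    have h1 := ih (Ev.div hx hn)
    have h2 := Ev.mod hx hn
    simp only [digitsE, FitsL, List.mem_cons, forall_eq_or_imp, vals, List.map_cons,
      WordRAM.digits, h2.2]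
    exact ⟨⟨h2.1, h1.1⟩, congrArg _ h1.2⟩

end Eval

/-! ### Pair conditions and counting by the first edge -/

/-- The `J`-th edge; its vertices are listed, possibly with repetitions, as `rc J r` for `r < h`. -/
def edge (h : ℕ) (rc : ℕ → ℕ → ℕ) (J : ℕ) : Finset ℕ := (range h).image (rc J)

/-- The list of the vertices of the `J`-th edge. -/
def edgeList (h : ℕ) (rc : ℕ → ℕ → ℕ) (J : ℕ) : List ℕ := (List.range h).map (rc J)

/-- The list of the vertices of some edges. -/
def coverList (h : ℕ) (rc : ℕ → ℕ → ℕ) : List ℕ → List ℕ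
  | [] => []
  | E :: L => edgeList h rc E ++ coverList h rc L

/-- The set of the vertices of some edges. -/
def cover (h : ℕ) (rc : ℕ → ℕ → ℕ) (L : List ℕ) : Finset ℕ := (coverList h rc L).toFinset

/-- The first element of a list, and `mc` for the empty list. -/
def limit (mc : ℕ) : List ℕ → ℕ
  | [] => mc
  | E :: _ => E

/-- No edge before `limit mc L` is contained in the edges of `L` and the vertices `a` and `b`. -/
def PairOkAt (h mc : ℕ) (rc : ℕ → ℕ → ℕ) (L : List ℕ) (a b : ℕ) : Prop :=
  ∀ J < limit mc L, ¬ edge h rc J ⊆ cover h rc L ∪ {a, b}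

/-- `PairOkAt` for all tails of `L`. -/
def PairOk (h mc : ℕ) (rc : ℕ → ℕ → ℕ) : List ℕ → ℕ → ℕ → Prop
  | [], a, b => PairOkAt h mc rc [] a b
  | E :: L, a, b => PairOkAt h mc rc (E :: L) a b ∧ PairOk h mc rc L a b

/-- All pairs of vertices of `S` satisfy `PairOk`. -/
def PairsOk (h mc : ℕ) (rc : ℕ → ℕ → ℕ) (L : List ℕ) (S : Finset ℕ) : Prop :=
  ∀ a ∈ S, ∀ b ∈ S, PairOk h mc rc L a b

/-- The set `S` contains none of the first `l` edges. -/
def EdgeFree (h : ℕ) (rc : ℕ → ℕ → ℕ) (l : ℕ) (S : Finset ℕ) : Prop :=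
  ∀ J < l, ¬ edge h rc J ⊆ S

open Classical in
/-- The `k`-sets of vertices that contain `U` and satisfy `P`. -/
noncomputable def above (n k : ℕ) (U : Finset ℕ) (P : Finset ℕ → Prop) : Finset (Finset ℕ) :=
  {S ∈ powersetCard k (range n) | U ⊆ S ∧ P S}

theorem mem_above {n k : ℕ} {U S : Finset ℕ} {P : Finset ℕ → Prop} :
    S ∈ above n k U P ↔ S ⊆ range n ∧ S.card = k ∧ U ⊆ S ∧ P S := by
  simp [above, mem_powersetCard, and_assoc]

section Expansion

variable {n k h mc : ℕ} {rc : ℕ → ℕ → ℕ}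

theorem edgeList_toFinset (J : ℕ) : (edgeList h rc J).toFinset = edge h rc J := by
  ext v; simp [edgeList, edge]

theorem cover_cons (E : ℕ) (L : List ℕ) :
    cover h rc (E :: L) = edge h rc E ∪ cover h rc L := by
  rw [cover, coverList, List.toFinset_append, edgeList_toFinset, cover]

/-- The edge `E` extends the edges in `L` by at least three vertices, to at most `k` vertices. -/
def Extends (h k : ℕ) (rc : ℕ → ℕ → ℕ) (L : List ℕ) (E : ℕ) : Prop :=
  (cover h rc L).card + 3 ≤ (cover h rc (E :: L)).card ∧ (cover h rc (E :: L)).card ≤ k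

theorem PairOk.at {L : List ℕ} {a b : ℕ} (hp : PairOk h mc rc L a b) :
    PairOkAt h mc rc L a b := by
  cases L with
  | nil => exact hp
  | cons E L => exact hp.1

/-- If `E` had at most two vertices outside the cover, these could be named `a, b ∈ S`, and then `E
⊆ cover ∪ {a, b}` contradicts the pair condition at `L`. -/
theorem PairsOk.extends {L : List ℕ} {S : Finset ℕ} (hS : PairsOk h mc rc L S)
    (hk : S.card = k) (hU : cover h rc L ⊆ S) {E : ℕ} (hE : E < limit mc L)
    (hES : edge h rc E ⊆ S) (hne : (edge h rc E).Nonempty) : Extends h k rc L E := by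
  have hUS : cover h rc (E :: L) ⊆ S := by rw [cover_cons]; exact union_subset hES hU
  refine ⟨?_, hk ▸ card_le_card hUS⟩
  by_contra! hlt
  rw [cover_cons, ← card_sdiff_add_card] at hlt
  obtain ⟨c, hc⟩ := hne
  obtain ⟨a, ha, b, hb, hab⟩ : ∃ a ∈ S, ∃ b ∈ S, edge h rc E \ cover h rc L ⊆ {a, b} := by
    have h2 : (edge h rc E \ cover h rc L).card ≤ 2 := by omega
    have hsub : edge h rc E \ cover h rc L ⊆ S := sdiff_subset.trans hES
    generalize edge h rc E \ cover h rc L = X at h2 hsub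
    obtain h0 | h1 | h2 : X.card = 0 ∨ X.card = 1 ∨ X.card = 2 := by omega
    -- The pair condition still needs some vertex of `S` here; a vertex of `E` serves.
    · rw [card_eq_zero] at h0
      exact ⟨c, hES hc, c, hES hc, by simp [h0]⟩
    · obtain ⟨a, rfl⟩ := card_eq_one.1 h1
      exact ⟨a, hsub (by simp), a, hsub (by simp), by simp⟩
    · obtain ⟨a, b, -, rfl⟩ := card_eq_two.1 h2
      exact ⟨a, hsub (by simp), b, hsub (by simp), by simp⟩
  exact (hS a ha b hb).at E hE (sdiff_le_iff.1 hab)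

/-- The `k`-sets that contain the edges in `L`, satisfy the pair conditions and contain no edge before
the limit. -/
noncomputable def freeSets (n k h mc : ℕ) (rc : ℕ → ℕ → ℕ) (L : List ℕ) : Finset (Finset ℕ) :=
  above n k (cover h rc L) fun S => EdgeFree h rc (limit mc L) S ∧ PairsOk h mc rc L S

open Classical in
/-- Every set that satisfies the pair conditions either contains no edge before the limit, or is
counted at its first edge. -/
theorem card_pairsOk {L : List ℕ} (hne : ∀ J < limit mc L, (edge h rc J).Nonempty) :
    (above n k (cover h rc L) (PairsOk h mc rc L)).card =
      (freeSets n k h mc rc L).card +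
      ∑ E ∈ range (limit mc L) with Extends h k rc L E, (freeSets n k h mc rc (E :: L)).card := by
  rw [← card_biUnion]
  · rw [← card_union_of_disjoint]
    · congr 1
      ext S
      simp only [mem_union, mem_biUnion, mem_filter, mem_range, freeSets, mem_above]
      constructor
      · rintro ⟨hn, hk, hU, hS⟩
        by_cases hf : EdgeFree h rc (limit mc L) S
        · exact Or.inl ⟨hn, hk, hU, hf, hS⟩
        · right
          -- The set is counted at the first edge it contains. As no earlier edge lies in `S`, the
          -- new pair condition for `E :: L`, whose limit is `E`, holds trivially; the old
          -- conditions for the tails of `L` are inherited.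
          have hex : ∃ J, J < limit mc L ∧ edge h rc J ⊆ S := by
            simpa only [EdgeFree, not_forall, not_not, exists_prop] using hf
          have h1 := Nat.find_spec hex
          have h2 : ∀ J < Nat.find hex, ¬ edge h rc J ⊆ S := fun J hJ hJS =>
            Nat.find_min hex hJ ⟨hJ.trans h1.1, hJS⟩
          have hUS : cover h rc (Nat.find hex :: L) ⊆ S := by
            rw [cover_cons]; exact union_subset h1.2 hU
          refine ⟨Nat.find hex, ⟨h1.1, hS.extends hk hU h1.1 h1.2 (hne _ h1.1)⟩, hn, hk, hUS, h2,
            fun a ha b hb => ⟨fun J hJ hJS => h2 J hJ (hJS.trans (union_subset hUS ?_)),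
              hS a ha b hb⟩⟩
          simp [insert_subset_iff, ha, hb]
      · rintro (⟨hn, hk, hU, -, hS⟩ | ⟨E, -, hn, hk, hU, -, hS⟩)
        · exact ⟨hn, hk, hU, hS⟩
        · rw [cover_cons, union_subset_iff] at hU
          exact ⟨hn, hk, hU.2, fun a ha b hb => (hS a ha b hb).2⟩
    · rw [disjoint_biUnion_right]
      intro E hE
      rw [mem_filter, mem_range] at hE
      rw [disjoint_left]
      intro S hS hS'
      simp only [freeSets, mem_above] at hS hS'
      rw [cover_cons, union_subset_iff] at hS'
      exact hS.2.2.2.1 E hE.1 hS'.2.2.1.1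
  -- A set counted at `E'` contains no edge before `E'`, so it does not contain `E`.
  · have key : ∀ E E' : ℕ, E < E' →
        Disjoint (freeSets n k h mc rc (E :: L)) (freeSets n k h mc rc (E' :: L)) := by
      intro E E' hlt
      rw [disjoint_left]
      intro S hS hS'
      simp only [freeSets, mem_above] at hS hS'
      rw [cover_cons, union_subset_iff] at hS
      exact hS'.2.2.2.1 E hlt hS.2.2.1.1
    intro E _ E' _ hEE'
    rcases lt_or_gt_of_ne hEE' with hlt | hlt
    exacts [key _ _ hlt, (key _ _ hlt).symm]

open Classical in
/-- Sets without edges among the first `m`, compared with sets without edges among the first `mc`. -/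
theorem card_edgeFree {m : ℕ} (hmc : mc ≤ m) :
    (above n k ∅ (EdgeFree h rc mc)).card = (above n k ∅ (EdgeFree h rc m)).card +
      ∑ E ∈ Ico mc m with (edge h rc E).card ≤ k,
        (above n k (edge h rc E) (EdgeFree h rc E)).card := by
  induction m, hmc using Nat.le_induction with
  | base => simp
  | succ m hm ih =>
    have hstep : (above n k ∅ (EdgeFree h rc m)).card =
        (above n k ∅ (EdgeFree h rc (m + 1))).card +
          (above n k (edge h rc m) (EdgeFree h rc m)).card := by
      rw [← card_union_of_disjoint]
      · congr 1
        ext S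
        simp only [mem_union, mem_above, EdgeFree, Nat.lt_succ_iff_lt_or_eq, or_imp, forall_and,
          forall_eq, empty_subset, true_and]
        tauto
      · rw [disjoint_left]
        intro S hS hS'
        rw [mem_above] at hS hS'
        exact hS.2.2.2 m (Nat.lt_succ_self m) hS'.2.2.1
    -- An edge with more than `k` vertices lies in no `k`-set, so the filter in the sum loses
    -- nothing.
    have hzero : ¬ (edge h rc m).card ≤ k →
        (above n k (edge h rc m) (EdgeFree h rc m)).card = 0 := by
      intro hk
      rw [card_eq_zero, eq_empty_iff_forall_notMem]
      intro S hS
      rw [mem_above] at hS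
      exact hk (hS.2.1 ▸ card_le_card hS.2.2.1)
    rw [ih, hstep, ← Ico_union_Ico_eq_Ico hm (Nat.le_succ m), filter_union, sum_union]
    · rw [Nat.succ_eq_add_one, Nat.Ico_succ_singleton, filter_singleton]
      split_ifs with hk
      · rw [sum_singleton]; ring
      · rw [sum_empty, hzero hk]; ring
    · exact disjoint_filter_filter (Ico_disjoint_Ico_consecutive _ _ _)

end Expansion

/-! ### Sets as numbers -/

section Digits

variable {n : ℕ}

theorem digits_ofDigits {l : List ℕ} (hl : ∀ v ∈ l, v < n) :
    digits n l.length (Nat.ofDigits n l) = l := by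
  induction l with
  | nil => rfl
  | cons a l ih =>
    simp only [List.mem_cons, forall_eq_or_imp] at hl
    rw [List.length_cons, digits, Nat.ofDigits_cons, Nat.add_mul_mod_self_left,
      Nat.add_mul_div_left _ _ (by omega : 0 < n), Nat.div_eq_of_lt hl.1]
    simp only [Nat.zero_add, ih hl.2, Nat.mod_eq_of_lt hl.1]

theorem ofDigits_digits {g x : ℕ} (hx : x < n ^ g) : Nat.ofDigits n (digits n g x) = x := by
  induction g generalizing x with
  | zero => simp at hx; simp [digits, hx]
  | succ g ih =>
    rw [digits, Nat.ofDigits_cons, ih]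
    · exact Nat.mod_add_div x n
    · rw [pow_succ'] at hx
      exact Nat.div_lt_of_lt_mul hx

theorem digits_add (a b x : ℕ) : digits n (a + b) x = digits n a x ++ digits n b (x / n ^ a) := by
  induction a generalizing x with
  | zero => simp [digits]
  | succ a ih =>
    rw [Nat.add_right_comm, digits, digits, ih, Nat.div_div_eq_div_mul, pow_succ']
    rfl

theorem digits_mod (a x : ℕ) : digits n a (x % n ^ a) = digits n a x := by
  induction a generalizing x with
  | zero => rfl
  | succ a ih =>
    rw [digits, digits, pow_succ', Nat.mod_mul_right_mod, Nat.mod_mul_right_div_self, ih]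

/-- The lowest digit comes first, so `x ↦ (x % n ^ a, x / n ^ a)` cuts the list of digits after `a`
places. -/
theorem sum_digits_add {M : Type*} [AddCommMonoid M] (hn : 0 < n) (a b : ℕ) (F : List ℕ → M) :
    ∑ x ∈ range (n ^ (a + b)), F (digits n (a + b) x) =
      ∑ x ∈ range (n ^ a), ∑ y ∈ range (n ^ b), F (digits n a x ++ digits n b y) := by
  have hpos : 0 < n ^ a := pow_pos hn a
  rw [← sum_product']
  refine sum_nbij' (fun x => (x % n ^ a, x / n ^ a)) (fun p => p.1 + n ^ a * p.2) ?_ ?_ ?_ ?_ ?_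
  · intro x hx
    rw [mem_range, pow_add] at hx
    simp only [mem_product, mem_range]
    exact ⟨Nat.mod_lt _ hpos, Nat.div_lt_of_lt_mul hx⟩
  · rintro ⟨x, y⟩ hp
    simp only [mem_product, mem_range] at hp ⊢
    rw [pow_add]
    nlinarith
  · intro x _
    exact Nat.mod_add_div x _
  · rintro ⟨x, y⟩ hp
    simp only [mem_product, mem_range] at hp
    simp only [Nat.add_mul_mod_self_left, Nat.mod_eq_of_lt hp.1, Nat.add_mul_div_left _ _ hpos,
      Nat.div_eq_of_lt hp.1, Nat.zero_add]
  · intro x _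
    dsimp only
    rw [digits_mod, digits_add]

open Classical in
theorem sum_ind {α : Type*} (s : Finset α) (P : α → Prop) :
    ∃ F : Finset α, (∀ x, x ∈ F ↔ x ∈ s ∧ P x) ∧ ∑ x ∈ s, ind (P x) = F.card := by
  refine ⟨{x ∈ s | P x}, fun x => mem_filter, ?_⟩
  rw [card_filter]
  exact sum_congr rfl fun x _ => by rw [ind]

/-- The sets above `U` correspond to the increasing lists of vertices outside `U`. -/
theorem card_above {k : ℕ} {U : Finset ℕ} {P : Finset ℕ → Prop} (hU : U ⊆ range n)
    (hk : U.card ≤ k) :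
    (above n k U P).card = ∑ x ∈ range (n ^ (k - U.card)),
      ind ((digits n (k - U.card) x).Pairwise (· < ·) ∧ (∀ a ∈ digits n (k - U.card) x, a ∉ U) ∧
        P (U ∪ (digits n (k - U.card) x).toFinset)) := by
  obtain ⟨F, hF, hsum⟩ := sum_ind (range (n ^ (k - U.card))) fun x =>
    (digits n (k - U.card) x).Pairwise (· < ·) ∧ (∀ a ∈ digits n (k - U.card) x, a ∉ U) ∧
        P (U ∪ (digits n (k - U.card) x).toFinset)
  rw [hsum]
  set r := k - U.card with hr
  have hlt : ∀ {S : Finset ℕ}, S ⊆ range n → ∀ v ∈ (S \ U).sort (· ≤ ·), v < n := by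
    intro S hS v hv
    rw [mem_sort, mem_sdiff] at hv
    exact mem_range.1 (hS hv.1)
  have hlen : ∀ {S : Finset ℕ}, S.card = k → U ⊆ S → ((S \ U).sort (· ≤ ·)).length = r := by
    intro S hS hUS
    rw [length_sort, card_sdiff_of_subset hUS, hS]
  refine card_nbij' (fun S => Nat.ofDigits n ((S \ U).sort (· ≤ ·)))
    (fun x => U ∪ (digits n r x).toFinset) ?_ ?_ ?_ ?_
  · intro S hS
    rw [mem_coe, mem_above] at hS
    obtain ⟨h1, h2, h3, h4⟩ := hS
    have hd := digits_ofDigits (hlt h1)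
    rw [hlen h2 h3] at hd
    refine mem_coe.2 ((hF _).2 ?_)
    rw [mem_range, hd]
    refine ⟨hlen h2 h3 ▸ ofDigits_lt (hlt h1), ?_, ?_, ?_⟩
    · exact (sortedLT_sort _).pairwise
    · intro a ha
      rw [mem_sort, mem_sdiff] at ha
      exact ha.2
    · rwa [sort_toFinset, union_sdiff_of_subset h3]
  · intro x hx
    obtain ⟨h1, h2, h3, h4⟩ := (hF x).1 (mem_coe.1 hx)
    rw [mem_range] at h1
    rw [mem_coe, mem_above]
    -- For `n = 0` there is an `x < n ^ r` only if `r = 0`, and then there are no digits to bound.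
    have hn : 0 < n ∨ r = 0 := by
      by_contra! hh
      rw [show n = 0 by omega, zero_pow hh.2] at h1
      omega
    refine ⟨union_subset hU ?_, ?_, subset_union_left, h4⟩
    · intro v hv
      rw [List.mem_toFinset] at hv
      rcases hn with hn | hn
      · exact mem_range.2 (digits_lt hn _ _ v hv)
      · rw [hn] at hv; simp [digits] at hv
    · rw [card_union_of_disjoint, List.toFinset_card_of_nodup, length_digits]
      · omega
      · exact h2.imp fun hab => hab.ne
      · rw [disjoint_left]
        intro a haU ha
        exact h3 a (List.mem_toFinset.1 ha) haU
  · intro S hS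
    rw [mem_coe, mem_above] at hS
    obtain ⟨h1, h2, h3, h4⟩ := hS
    have hd := digits_ofDigits (hlt h1)
    rw [hlen h2 h3] at hd
    simp only [hd, sort_toFinset, union_sdiff_of_subset h3]
  · intro x hx
    obtain ⟨h1, h2, h3, h4⟩ := (hF x).1 (mem_coe.1 hx)
    rw [mem_range] at h1
    have hsd : (U ∪ (digits n r x).toFinset) \ U = (digits n r x).toFinset := by
      rw [union_sdiff_left, sdiff_eq_self_of_disjoint]
      rw [disjoint_right]
      intro a haU ha
      exact h3 a (List.mem_toFinset.1 ha) haU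
    simp only [hsd]
    rw [(List.toFinset_sort _ (h2.imp fun hab => hab.ne)).2 (h2.imp fun hab => hab.le),
      ofDigits_digits h1]

end Digits

/-! ### Three parts -/

section Parts

variable {n h mc : ℕ} {rc : ℕ → ℕ → ℕ} {L : List ℕ}

/-- The list `l` increases, is disjoint from the edges of `L`, and satisfies the pair conditions. -/
def Good (h mc : ℕ) (rc : ℕ → ℕ → ℕ) (L l : List ℕ) : Prop :=
  l.Pairwise (· < ·) ∧ (∀ a ∈ l, a ∉ cover h rc L) ∧
    PairsOk h mc rc L (cover h rc L ∪ l.toFinset)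

/-- Every clause of `Good` involves at most two elements of the list, and two elements always lie in
two of the three parts. This is what reduces the count to triangles. -/
theorem good_append (l₁ l₂ l₃ : List ℕ) : Good h mc rc L (l₁ ++ l₂ ++ l₃) ↔
    Good h mc rc L (l₁ ++ l₂) ∧ Good h mc rc L (l₂ ++ l₃) ∧ Good h mc rc L (l₁ ++ l₃) := by
  simp only [Good, PairsOk, List.pairwise_append, List.mem_append, mem_union, List.mem_toFinset]
  constructor
  · rintro ⟨⟨⟨h1, h2, h3⟩, h4, h5⟩, h6, h7⟩
    exact ⟨⟨⟨h1, h2, h3⟩, fun a ha => h6 a (Or.inl ha), fun a ha b hb => h7 a (by tauto) b (by tauto)⟩,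
      ⟨⟨h2, h4, fun a ha b hb => h5 a (Or.inr ha) b hb⟩, fun a ha => h6 a (by tauto),
        fun a ha b hb => h7 a (by tauto) b (by tauto)⟩,
      ⟨h1, h4, fun a ha b hb => h5 a (Or.inl ha) b hb⟩, fun a ha => h6 a (by tauto),
        fun a ha b hb => h7 a (by tauto) b (by tauto)⟩
  · rintro ⟨⟨⟨a1, a2, a3⟩, a4, a5⟩, ⟨⟨b1, b2, b3⟩, b4, b5⟩, ⟨c1, c2, c3⟩, c4, c5⟩
    refine ⟨⟨⟨a1, a2, a3⟩, b2, fun a ha b hb => ha.elim (c3 a · b hb) (b3 a · b hb)⟩,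
      fun a ha => ?_, fun a ha b hb => ?_⟩
    · rcases ha with (ha | ha) | ha
      exacts [a4 a (.inl ha), a4 a (.inr ha), b4 a (.inr ha)]
    · rcases ha with ha | (ha | ha) | ha <;> rcases hb with hb | (hb | hb) | hb <;>
      first
      | exact a5 a (by tauto) b (by tauto)
      | exact b5 a (by tauto) b (by tauto)
      | exact c5 a (by tauto) b (by tauto)

/-- The entries of the matrices: the numbers `x` and `y` encode lists of length `g` and `g'` that
together are good. -/
noncomputable def entry (n h mc : ℕ) (rc : ℕ → ℕ → ℕ) (L : List ℕ) (g g' x y : ℕ) : ℕ :=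
  ind ((x < n ^ g ∧ y < n ^ g') ∧ Good h mc rc L (digits n g x ++ digits n g' y))

/-- Each good list is a triple of parts for which three entries are all `1`; summing over the middle
part first gives a matrix product. The parts may have different lengths, so the matrices are padded
to the common size `N`: `entry` vanishes at numbers that are too large to encode a part. -/
theorem sum_good (hn : 0 < n) {N a b c : ℕ} (ha : n ^ a ≤ N) (hb : n ^ b ≤ N) (hc : n ^ c ≤ N) :
    ∑ x ∈ range (n ^ (a + b + c)), ind (Good h mc rc L (digits n (a + b + c) x)) =
      ∑ x ∈ range N, ∑ z ∈ range N, entry n h mc rc L a c x z *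
        ∑ y ∈ range N, entry n h mc rc L a b x y * entry n h mc rc L b c y z := by
  rw [sum_digits_add hn (a + b) c (fun l => ind (Good h mc rc L l))]
  rw [sum_digits_add hn a b (fun l => ∑ z ∈ range (n ^ c), ind (Good h mc rc L (l ++ digits n c z)))]
  have hsub : ∀ {M : ℕ} (F : ℕ → ℕ), M ≤ N → (∀ x, ¬ x < M → F x = 0) →
      ∑ x ∈ range N, F x = ∑ x ∈ range M, F x := by
    intro M F hM hF
    refine (sum_subset (range_mono hM) fun x _ hx => hF x ?_).symm
    simpa using hx
  rw [hsub _ ha fun x hx => sum_eq_zero fun z _ => by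
    rw [entry, ind_false fun hh => hx hh.1.1, zero_mul]]
  refine sum_congr rfl fun x hx => ?_
  rw [sum_comm, hsub _ hc fun z hz => by
    rw [entry, ind_false fun hh => hz hh.1.2, zero_mul]]
  refine sum_congr rfl fun z hz => ?_
  rw [hsub _ hb fun y hy => by
    rw [entry, ind_false fun hh => hy hh.1.2, zero_mul], mul_sum]
  refine sum_congr rfl fun y hy => ?_
  rw [mem_range] at hx hy hz
  simp only [entry, hx, hy, hz, true_and, ← ind_and, good_append]
  congr 1
  rw [eq_iff_iff]
  tauto

end Parts

/-! ### Edges in memory, and evaluation of the predicates -/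

/-- The vertices of the `m` edges are smaller than `n`, and the edges are listed differently. -/
structure EdgeData (n m h : ℕ) (rc : ℕ → ℕ → ℕ) : Prop where
  pos : 0 < n
  lt : ∀ J < m, ∀ v ∈ edgeList h rc J, v < n
  inj : ∀ I < m, ∀ J < m, edgeList h rc I = edgeList h rc J → I = J

/-- The store holds the edges, and a table from which an edge can be found by its vertices. -/
structure HoldsEdges (h n m mc : ℕ) (rc : ℕ → ℕ → ℕ) (s : Store) : Prop where
  n_eq : s (h + 1) 0 = n
  m_eq : s (h + 1) 1 = m
  mc_eq : s (h + 1) 2 = mc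
  edges : ∀ J < m, ∀ r < h, s (h + 2) (J * h + r) = rc J r
  table : ∀ J < m, s (h + 3) (Nat.ofDigits n (edgeList h rc J)) = J

/-- The numbers that occur are machine words. -/
structure Words (W n m h k : ℕ) : Prop where
  const : (k + 2) * (h + 2) + 20 < W
  key : n ^ h < W
  size : (m + 1) * (h + 1) < W
  pow : ∀ a ≤ 2 * k, n ^ a < W
  modulus : 3 * (n ^ k + 1) < W

/-- The cells `11, 12, …` hold the chosen edges, the last chosen edge being the head of the list. -/
def HoldsChosen (h : ℕ) (s : Store) : List ℕ → Prop
  | [] => True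
  | E :: L => s (h + 1) (10 + (L.length + 1)) = E ∧ HoldsChosen h s L

def nE (h : ℕ) : Expr := cell (h + 1) 0

/-- The vertices of the edge with index `x`. -/
def edgeE (h : ℕ) (x : Expr) : List Expr :=
  (List.range h).map fun r => .get (h + 2) (addE (mulE x (.lit h)) (.lit r))

/-- The vertices of the first `t` chosen edges. -/
def coverE (h : ℕ) : ℕ → List Expr
  | 0 => []
  | t + 1 => edgeE h (cell (h + 1) (10 + (t + 1))) ++ coverE h t

/-- Cell `2` holds `mc`, the limit when no edge is chosen. -/
def limitE (h : ℕ) : ℕ → Expr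
  | 0 => cell (h + 1) 2
  | t + 1 => cell (h + 1) (10 + (t + 1))

/-- Equality of two lists of values. -/
def eqsE : List Expr → List Expr → Expr
  | [], [] => .lit 1
  | a :: l, b :: l' => andE (eqE a b) (eqsE l l')
  | _, _ => .lit 0

/-- The index found in the table for a list of vertices. -/
def indexE (h : ℕ) (w : List Expr) : Expr :=
  modE (.get (h + 3) (keyE (nE h) w)) (addE (cell (h + 1) 1) (.lit 1))

/-- The list of vertices is the list of vertices of an edge before `lim`. -/
def hitE (h : ℕ) (lim : Expr) (w : List Expr) : Expr :=
  andE (ltE (indexE h w) lim) (eqsE (edgeE h (indexE h w)) w)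

/-- No edge before `lim` is contained in a set of vertices. -/
def edgeFreeE (h : ℕ) (lim : Expr) (A : List Expr) : Expr :=
  allE (tuples h A) fun w => notE (hitE h lim w)

def pairOkAtE (h t : ℕ) (a b : Expr) : Expr := edgeFreeE h (limitE h t) (coverE h t ++ [a, b])

def pairOkE (h : ℕ) : ℕ → Expr → Expr → Expr
  | 0, a, b => pairOkAtE h 0 a b
  | t + 1, a, b => andE (pairOkAtE h (t + 1) a b) (pairOkE h t a b)

def pairsOkE (h t : ℕ) (A : List Expr) : Expr := allE A fun a => allE A fun b => pairOkE h t a b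

def avoidsE (h t : ℕ) (G : List Expr) : Expr :=
  allE G fun g => notE (memE g (coverE h t))

def goodE (h t : ℕ) (G : List Expr) : Expr :=
  andE (increasingE G) (andE (avoidsE h t G) (pairsOkE h t (coverE h t ++ G)))

/-- In contrast to `goodE`, the whole set is tested for edges at once, which only exhaustive search
can afford. -/
def freeE (h t : ℕ) (G : List Expr) : Expr :=
  andE (increasingE G) (andE (avoidsE h t G) (edgeFreeE h (limitE h t) (coverE h t ++ G)))

def entryE (h t : ℕ) (x y : Expr) (g g' : ℕ) : Expr :=
  andE (andE (ltE x (powE (nE h) g)) (ltE y (powE (nE h) g')))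
    (goodE h t (digitsE (nE h) g x ++ digitsE (nE h) g' y))

section

variable {W n m mc h k : ℕ} {rc : ℕ → ℕ → ℕ} {s : Store} {L : List ℕ}

theorem Words.one_lt (hW : Words W n m h k) : 1 < W := by have := hW.const; omega

theorem Words.cell_lt (hW : Words W n m h k) {t : ℕ} (ht : t ≤ k + 1) : 10 + t < W := by
  have := hW.const
  have : k + 2 ≤ (k + 2) * (h + 2) := Nat.le_mul_of_pos_right _ (by omega)
  omega

theorem Words.k_lt (hW : Words W n m h k) : k + 20 < W := by
  have := hW.const
  have : k + 2 ≤ (k + 2) * (h + 2) := Nat.le_mul_of_pos_right _ (by omega)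
  omega

theorem Words.m_lt (hW : Words W n m h k) : m + 1 < W := by
  have := hW.size
  have : m + 1 ≤ (m + 1) * (h + 1) := Nat.le_mul_of_pos_right _ (by omega)
  rcases Nat.eq_zero_or_pos m with hm | hm
  · have := hW.one_lt
    have := hW.k_lt
    omega
  · rcases Nat.eq_zero_or_pos h with hh | hh
    · subst hh; simp at this; omega
    · nlinarith

theorem Words.index_lt (hW : Words W n m h k) {J r : ℕ} (hJ : J ≤ m) (hr : r < h) :
    J * h + r < W := by
  have := hW.size
  nlinarith [Nat.mul_le_mul_right h hJ]

variable (hW : Words W n m h k) (hs : AllLt W s) (hI : HoldsEdges h n m mc rc s)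
include hW hs

theorem Ev.edge {x : Expr} {J : ℕ} (hx : Ev W s x J) (hJ : J ≤ m) : FitsL W s (edgeE h x) ∧
    vals s (edgeE h x) = (List.range h).map fun r => s (h + 2) (J * h + r) := by
  have key : ∀ r < h, Ev W s (.get (h + 2) (addE (mulE x (.lit h)) (.lit r)))
      (s (h + 2) (J * h + r)) := by
    intro r hr
    have h1 := hW.index_lt hJ hr
    have h2 := hW.const
    have h3 : h + 2 ≤ (k + 2) * (h + 2) := Nat.le_mul_of_pos_left _ (by omega)
    exact Ev.get hs (Ev.add (Ev.mul hx (Ev.lit (by omega)) (by omega)) (Ev.lit (by omega)) h1)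
  constructor
  · intro e he
    simp only [edgeE, List.mem_map, List.mem_range] at he
    obtain ⟨r, hr, rfl⟩ := he
    exact (key r hr).1
  · simp only [vals, edgeE, List.map_map]
    refine List.map_congr_left fun r hr => ?_
    exact (key r (List.mem_range.1 hr)).2

omit hs in
theorem EvP.eqs {l l' : List Expr} (hl : FitsL W s l) (hl' : FitsL W s l') :
    EvP W s (eqsE l l') (vals s l = vals s l') := by
  have h1 := hW.one_lt
  induction l generalizing l' with
  | nil =>
    cases l' with
    | nil => exact EvP.true h1 rfl
    | cons b l' =>
      rw [EvP, ind_false (by simp [vals])]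
      exact Ev.lit (by omega)
  | cons a l ih =>
    cases l' with
    | nil =>
      rw [EvP, ind_false (by simp [vals])]
      exact Ev.lit (by omega)
    | cons b l' =>
      simp only [FitsL, List.mem_cons, forall_eq_or_imp] at hl hl'
      refine ((EvP.eq h1 (Ev.self hl.1) (Ev.self hl'.1)).and (ih hl.2 hl'.2)).congr ?_
      simp [vals]

include hI

theorem Ev.nE : Ev W s (WordRAM.nE h) n := by
  have := hW.k_lt
  exact (Ev.cell hs (by omega)).congr hI.n_eq

theorem vals_edge {x : Expr} {J : ℕ} (hx : Ev W s x J) (hJ : J < m) :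
    vals s (edgeE h x) = edgeList h rc J := by
  rw [(Ev.edge hW hs hx hJ.le).2, edgeList]
  exact List.map_congr_left fun r hr => hI.edges J hJ r (List.mem_range.1 hr)

/-- The table is never initialised, so a key that belongs to no edge yields an arbitrary word. The
word is reduced modulo `m + 1` to keep address arithmetic in range, and the edge it points to is
then compared with the list: false hits are rejected, and true ones return their own index. -/
theorem EvP.hit (hE : EdgeData n m h rc) {lim : Expr} {l : ℕ} (hlim : Ev W s lim l) (hl : l ≤ m)
    {w : List Expr} (hw : FitsL W s w) (hlen : w.length = h) (hlt : ∀ v ∈ vals s w, v < n) :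
    EvP W s (hitE h lim w) (∃ J < l, edgeList h rc J = vals s w) := by
  have h1 := hW.one_lt
  have hk := hW.k_lt
  have hkey : Ev W s (keyE (nE h) w) (Nat.ofDigits n (vals s w)) :=
    Ev.key (Ev.nE hW hs hI) hw hlt hE.pos (by rw [hlen]; exact hW.key)
  have hidx : Ev W s (indexE h w) (s (h + 3) (Nat.ofDigits n (vals s w)) % (m + 1)) :=
    Ev.mod (Ev.get hs hkey) (Ev.add ((Ev.cell hs (by omega)).congr hI.m_eq) (Ev.lit h1) hW.m_lt)
  have hle : s (h + 3) (Nat.ofDigits n (vals s w)) % (m + 1) ≤ m :=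
    Nat.lt_succ_iff.1 (Nat.mod_lt _ (by omega))
  refine ((EvP.lt h1 hidx hlim).and (EvP.eqs hW (Ev.edge hW hs hidx hle).1 hw)).congr ?_
  constructor
  · rintro ⟨h2, h3⟩
    exact ⟨_, h2, by rw [← vals_edge hW hs hI hidx (h2.trans_le hl), h3]⟩
  · rintro ⟨J, hJ, hJw⟩
    have hJm : J < m := hJ.trans_le hl
    have : s (h + 3) (Nat.ofDigits n (vals s w)) % (m + 1) = J := by
      rw [← hJw, hI.table J hJm, Nat.mod_eq_of_lt (by omega)]
    rw [this] at hidx ⊢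
    exact ⟨hJ, by rw [vals_edge hW hs hI hidx hJm, hJw]⟩

/-- Every edge is stored as a list of exactly `h` vertices, so it lies in the set iff its list is
one of the `h`-tuples over `A`. The number of lookups is thus independent of the number of edges.
Tuples in all orders and with repetitions are tried, which suits the arbitrary order and the padding
of the stored lists. -/
theorem EvP.edgeFree (hE : EdgeData n m h rc) {lim : Expr} {l : ℕ} (hlim : Ev W s lim l)
    (hl : l ≤ m) {A : List Expr} (hA : FitsL W s A) (hlt : ∀ v ∈ vals s A, v < n) :
    EvP W s (edgeFreeE h lim A) (EdgeFree h rc l (vals s A).toFinset) := by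
  have h1 := hW.one_lt
  refine (EvP.all h1 fun w hw => EvP.not h1 (EvP.hit hW hs hI hE hlim hl ?_ ?_ ?_)).congr ?_
  · exact fun e he => hA e ((mem_tuples.1 hw).2 e he)
  · exact (mem_tuples.1 hw).1
  · intro v hv
    simp only [vals, List.mem_map] at hv
    obtain ⟨e, he, rfl⟩ := hv
    exact hlt _ (List.mem_map_of_mem ((mem_tuples.1 hw).2 e he))
  · simp only [EdgeFree, not_exists, not_and]
    constructor
    · intro hh J hJ hsub
      -- A list of values of `A` is lifted to a list of expressions from `A`.
      have hex : ∀ l' : List ℕ, (∀ v ∈ l', ∃ e ∈ A, e.val s = v) →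
          ∃ w : List Expr, (w.length = l'.length ∧ ∀ e ∈ w, e ∈ A) ∧ vals s w = l' := by
        intro l' hmem
        induction l' with
        | nil => exact ⟨[], by simp, rfl⟩
        | cons v l' ih =>
          simp only [List.mem_cons, forall_eq_or_imp] at hmem
          obtain ⟨e, he, hv⟩ := hmem.1
          obtain ⟨w, ⟨hw1, hw2⟩, hw3⟩ := ih hmem.2
          refine ⟨e :: w, ⟨by simp [hw1], ?_⟩, ?_⟩
          · simp only [List.mem_cons, forall_eq_or_imp]
            exact ⟨he, hw2⟩
          · simp only [vals, List.map_cons, hv] at hw3 ⊢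
            rw [hw3]
      obtain ⟨w, hw, hwJ⟩ := hex (edgeList h rc J) (by
        intro v hv
        have : v ∈ (vals s A).toFinset := hsub (by
          rw [← edgeList_toFinset]; exact List.mem_toFinset.2 hv)
        simpa [vals] using this)
      have hlen : (edgeList h rc J).length = h := by simp [edgeList]
      rw [hlen] at hw
      exact hh w (mem_tuples.2 hw) J hJ hwJ.symm
    · intro hh w hw J hJ hJw
      refine hh J hJ fun v hv => ?_
      rw [← edgeList_toFinset, List.mem_toFinset, hJw] at hv
      simp only [vals, List.mem_map] at hv
      obtain ⟨e, he, rfl⟩ := hv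
      exact List.mem_toFinset.2 (List.mem_map_of_mem ((mem_tuples.1 hw).2 e he))

theorem Ev.cover (hL : HoldsChosen h s L) (hm : ∀ E ∈ L, E < m) (hlen : L.length ≤ k + 1) :
    FitsL W s (coverE h L.length) ∧ vals s (coverE h L.length) = coverList h rc L := by
  induction L with
  | nil => exact ⟨by simp [FitsL, coverE], rfl⟩
  | cons E L ih =>
    simp only [List.mem_cons, forall_eq_or_imp] at hm
    rw [List.length_cons] at hlen
    obtain ⟨hL1, hL2⟩ := hL
    have hx : Ev W s (WordRAM.cell (h + 1) (10 + (L.length + 1))) E :=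
      (Ev.cell hs (hW.cell_lt hlen)).congr hL1
    have ih := ih hL2 hm.2 (by omega)
    refine ⟨(Ev.edge hW hs hx hm.1.le).1.append ih.1, ?_⟩
    rw [List.length_cons, coverE, vals_append, vals_edge hW hs hI hx hm.1, ih.2, coverList]

theorem Ev.limit (hL : HoldsChosen h s L) (hlen : L.length ≤ k + 1) :
    Ev W s (limitE h L.length) (limit mc L) := by
  have := hW.k_lt
  cases L with
  | nil => exact (Ev.cell hs (by omega)).congr hI.mc_eq
  | cons E L => exact (Ev.cell hs (hW.cell_lt hlen)).congr hL.1

omit hW hs hI in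
theorem coverList_lt (hE : EdgeData n m h rc) (hm : ∀ E ∈ L, E < m) :
    ∀ v ∈ coverList h rc L, v < n := by
  induction L with
  | nil => simp [coverList]
  | cons E L ih =>
    simp only [List.mem_cons, forall_eq_or_imp] at hm
    intro v hv
    rcases List.mem_append.1 hv with hv | hv
    exacts [hE.lt E hm.1 v hv, ih hm.2 v hv]

omit hW hs hI in
theorem limit_le (hmc : mc ≤ m) (hm : ∀ E ∈ L, E < m) : limit mc L ≤ m := by
  cases L with
  | nil => exact hmc
  | cons E L => exact (hm E (by simp)).le

theorem EvP.pairOk (hE : EdgeData n m h rc) (hmc : mc ≤ m) (hL : HoldsChosen h s L)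
    (hm : ∀ E ∈ L, E < m) (hlen : L.length ≤ k + 1) {a b : Expr} {av bv : ℕ} (ha : Ev W s a av)
    (hb : Ev W s b bv) (han : av < n) (hbn : bv < n) :
    EvP W s (pairOkE h L.length a b) (PairOk h mc rc L av bv) := by
  have key : ∀ L : List ℕ, HoldsChosen h s L → (∀ E ∈ L, E < m) → L.length ≤ k + 1 →
      EvP W s (pairOkAtE h L.length a b) (PairOkAt h mc rc L av bv) := by
    intro L hL hm hlen
    have hc := Ev.cover hW hs hI hL hm hlen
    have hab : FitsL W s [a, b] := by
      simp only [FitsL, List.mem_cons, List.not_mem_nil, or_false, forall_eq_or_imp, forall_eq]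
      exact ⟨ha.1, hb.1⟩
    have hv : vals s (coverE h L.length ++ [a, b]) = coverList h rc L ++ [av, bv] := by
      rw [vals_append, hc.2]; simp [vals, ha.2, hb.2]
    refine (EvP.edgeFree hW hs hI hE (Ev.limit hW hs hI hL hlen) (limit_le hmc hm)
      (hc.1.append hab) ?_).congr ?_
    · rw [hv]
      intro v hv
      simp only [List.mem_append, List.mem_cons, List.not_mem_nil, or_false] at hv
      rcases hv with hv | rfl | rfl
      exacts [coverList_lt hE hm v hv, han, hbn]
    · rw [hv, List.toFinset_append]
      have : [av, bv].toFinset = ({av, bv} : Finset ℕ) := by simp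
      rw [this]
      rfl
  induction L with
  | nil => exact key [] hL hm hlen
  | cons E L ih =>
    have h1 := key _ hL hm hlen
    simp only [List.mem_cons, forall_eq_or_imp] at hm
    rw [List.length_cons] at hlen
    exact h1.and (ih hL.2 hm.2 (by omega))

theorem EvP.avoids (hL : HoldsChosen h s L) (hm : ∀ E ∈ L, E < m) (hlen : L.length ≤ k + 1)
    {G : List Expr} (hG : FitsL W s G) :
    EvP W s (avoidsE h L.length G) (∀ a ∈ vals s G, a ∉ cover h rc L) := by
  have h1 := hW.one_lt
  have hc := Ev.cover hW hs hI hL hm hlen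
  refine (EvP.all h1 fun g hg => EvP.not h1 (EvP.mem h1 (Ev.self (hG g hg)) hc.1)).congr ?_
  rw [hc.2]
  simp [vals, WordRAM.cover]

theorem EvP.good (hE : EdgeData n m h rc) (hmc : mc ≤ m) (hL : HoldsChosen h s L)
    (hm : ∀ E ∈ L, E < m) (hlen : L.length ≤ k + 1) {G : List Expr} (hG : FitsL W s G)
    (hGn : ∀ v ∈ vals s G, v < n) :
    EvP W s (goodE h L.length G) (Good h mc rc L (vals s G)) := by
  have h1 := hW.one_lt
  have hc := Ev.cover hW hs hI hL hm hlen
  have hA := hc.1.append hG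
  have hv : vals s (coverE h L.length ++ G) = coverList h rc L ++ vals s G := by
    rw [vals_append, hc.2]
  have hAn : ∀ e ∈ coverE h L.length ++ G, e.val s < n := by
    intro e he
    have : e.val s ∈ vals s (coverE h L.length ++ G) := List.mem_map_of_mem he
    rw [hv] at this
    rcases List.mem_append.1 this with h' | h'
    exacts [coverList_lt hE hm _ h', hGn _ h']
  refine ((EvP.increasing h1 hG).and ((EvP.avoids hW hs hI hL hm hlen hG).and
    (EvP.all h1 fun a ha => EvP.all h1 fun b hb => EvP.pairOk hW hs hI hE hmc hL hm hlen
      (Ev.self (hA a ha)) (Ev.self (hA b hb)) (hAn a ha) (hAn b hb)))).congr ?_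
  rw [Good]
  refine and_congr Iff.rfl (and_congr Iff.rfl ?_)
  have hset : WordRAM.cover h rc L ∪ (vals s G).toFinset =
      (vals s (coverE h L.length ++ G)).toFinset := by
    rw [hv, List.toFinset_append, WordRAM.cover]
  rw [hset]
  simp only [PairsOk, vals, List.mem_toFinset, List.mem_map, forall_exists_index, and_imp,
    forall_apply_eq_imp_iff₂]

theorem EvP.free (hE : EdgeData n m h rc) (hmc : mc ≤ m) (hL : HoldsChosen h s L)
    (hm : ∀ E ∈ L, E < m) (hlen : L.length ≤ k + 1) {G : List Expr} (hG : FitsL W s G)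
    (hGn : ∀ v ∈ vals s G, v < n) :
    EvP W s (freeE h L.length G) ((vals s G).Pairwise (· < ·) ∧
      (∀ a ∈ vals s G, a ∉ cover h rc L) ∧
        EdgeFree h rc (limit mc L) (cover h rc L ∪ (vals s G).toFinset)) := by
  have h1 := hW.one_lt
  have hc := Ev.cover hW hs hI hL hm hlen
  have hv : vals s (coverE h L.length ++ G) = coverList h rc L ++ vals s G := by
    rw [vals_append, hc.2]
  refine (EvP.increasing h1 hG).and ((EvP.avoids hW hs hI hL hm hlen hG).and
    ((EvP.edgeFree hW hs hI hE (Ev.limit hW hs hI hL hlen) (limit_le hmc hm)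
      (hc.1.append hG) ?_).congr ?_))
  · rw [hv]
    intro v hv
    rcases List.mem_append.1 hv with h' | h'
    exacts [coverList_lt hE hm _ h', hGn _ h']
  · rw [hv, List.toFinset_append, WordRAM.cover]

theorem EvP.entry (hE : EdgeData n m h rc) (hmc : mc ≤ m) (hL : HoldsChosen h s L)
    (hm : ∀ E ∈ L, E < m) (hlen : L.length ≤ k + 1) {x y : Expr} {xv yv g g' : ℕ}
    (hx : Ev W s x xv) (hy : Ev W s y yv) (hg : g ≤ k) (hg' : g' ≤ k) :
    Ev W s (entryE h L.length x y g g') (entry n h mc rc L g g' xv yv) := by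
  have h1 := hW.one_lt
  have hn := Ev.nE hW hs hI
  have hd := Ev.digits hn hx (g := g)
  have hd' := Ev.digits hn hy (g := g')
  have hv : vals s (digitsE (nE h) g x ++ digitsE (nE h) g' y) = digits n g xv ++ digits n g' yv := by
    rw [vals_append, hd.2, hd'.2]
  refine ((EvP.lt h1 hx (Ev.pow hn fun a ha => hW.pow a (by omega))).and
    (EvP.lt h1 hy (Ev.pow hn fun a ha => hW.pow a (by omega)))).and
    ((EvP.good hW hs hI hE hmc hL hm hlen (hd.1.append hd'.1) ?_).congr (by rw [hv]))
  rw [hv]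
  intro v hv
  rcases List.mem_append.1 hv with h' | h'
  exacts [digits_lt hE.pos _ _ v h', digits_lt hE.pos _ _ v h']

end

/-! ### Grids of cells, signed accumulation, and filling the matrices -/

/-- The stores agree except for the loop counters in cells `5` and `6`. -/
def SameOffCounters (h : ℕ) (s s' : Store) : Prop :=
  ∀ a i, ¬ (a = h + 1 ∧ (i = 5 ∨ i = 6)) → s' a i = s a i

theorem sameOffCounters_write (h : ℕ) (s : Store) {i : ℕ} (hi : i = 5 ∨ i = 6) (x : ℕ) :
    SameOffCounters h s (s.write (h + 1) i x) := by
  intro b j hbj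
  rw [write_apply, if_neg]
  rintro ⟨rfl, rfl⟩
  exact hbj ⟨rfl, hi⟩

/-- Two nested loops, with counters in cells `5` and `6`. -/
def grid (h : ℕ) (N : Expr) (body : Prog) : Prog :=
  forLoop (h + 1) 5 (.lit 0) N (forLoop (h + 1) 6 (.lit 0) N body)

/-- `I x y` describes the state when the rows before `x` and the first `y` cells of row `x` are
done; by `hI` it may not depend on the counters, and `row` identifies a finished row with the start
of the next. Since `1 ≤ N`, the overhead of the outer loop is absorbed into the factor `N ^ 2`. -/
theorem Run.grid {W : ℕ} {s : Store} (hs : AllLt W s) (hW : 6 < W) {h N : ℕ} {NE : Expr}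
    {body : Prog} {T : ℝ} (hN : 1 ≤ N) (I : ℕ → ℕ → Store → Prop)
    (hI : ∀ x y s s', SameOffCounters h s s' → I x y s → I x y s') (h0 : I 0 0 s)
    (hNE : ∀ x y s, AllLt W s → I x y s → Ev W s NE N)
    (row : ∀ x s, I x N s → I (x + 1) 0 s)
    (step : ∀ x y s, AllLt W s → x < N → y < N → s (h + 1) 5 = x → s (h + 1) 6 = y → I x y s →
      Run W body s T (fun s' => s' (h + 1) 5 = x ∧ s' (h + 1) 6 = y ∧ I x (y + 1) s')) :
    Run W (grid h NE body) s ((T + (4 * NE.cost + 34)) * (N : ℝ) ^ 2) (I N 0) := by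
  have hNW : N < W := (hNE 0 0 s hs h0).lt_word
  refine (Run.forLoop hs (fun x => I x 0) (Nat.zero_le N) hNW (by omega) (Ev.lit (by omega))
    (hI _ _ _ _ (sameOffCounters_write h s (.inl rfl) 0) h0)
    (fun i s hs _ _ _ hi => hNE _ _ s hs hi)
    (T := fun _ => N * (T + (NE.cost + 10)) + (NE.cost + 7)) ?_).mono ?_ (fun _ _ hh => hh.2)
  · intro x s hs _ hx hx5 hIx
    refine (Run.forLoop hs (fun y s => s (h + 1) 5 = x ∧ I x y s) (Nat.zero_le N) hNW (by omega)
      (Ev.lit (by omega)) ⟨?_, hI _ _ _ _ (sameOffCounters_write h s (.inr rfl) 0) hIx⟩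
      (fun i s hs _ _ _ hi => hNE _ _ s hs hi.2) (T := fun _ => T) ?_).mono ?_ ?_
    · rw [write_apply, if_neg (by omega), hx5]
    · intro y s hs _ hy hy6 hI'
      refine (step x y s hs hx hy hI'.1 hy6 hI'.2).mono le_rfl ?_
      rintro s' - ⟨h1, h2, h3⟩
      refine ⟨h2, ?_, hI _ _ _ _ (sameOffCounters_write h s' (.inr rfl) _) h3⟩
      rw [write_apply, if_neg (by omega), h1]
    · simp only [sum_const, Nat.card_Ico, Expr.cost, nsmul_eq_mul]
      push_cast
      simp only [Nat.sub_zero]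
      linarith
    · rintro s' - ⟨-, h1, h2⟩
      exact ⟨h1, hI _ _ _ _ (sameOffCounters_write h s' (.inl rfl) _) (row x s' h2)⟩
  · simp only [sum_const, Nat.card_Ico, Expr.cost, nsmul_eq_mul]
    have h1 : (1 : ℝ) ≤ N := by exact_mod_cast hN
    have h2 : (0 : ℝ) ≤ NE.cost := by positivity
    simp only [Nat.sub_zero]
    push_cast
    have h3 : (N : ℝ) ≤ (N : ℝ) ^ 2 := by nlinarith
    have h4 : (1 : ℝ) ≤ (N : ℝ) ^ 2 := by nlinarith
    have h5 := mul_le_mul_of_nonneg_left h3 (by positivity : 0 ≤ 2 * (NE.cost : ℝ) + 17)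
    have h6 := mul_le_mul_of_nonneg_left h4 (by positivity : 0 ≤ (NE.cost : ℝ) + 7)
    nlinarith

/-- `s'` agrees with `s` on the input, the edges, the table, the sizes and the first `t` chosen
edges. -/
def Frame (h t : ℕ) (s s' : Store) : Prop :=
  (∀ a < h + 4, a ≠ h + 1 → s' a = s a) ∧
    ∀ i, i < 3 ∨ (10 ≤ i ∧ i ≤ 10 + t) → s' (h + 1) i = s (h + 1) i

theorem Frame.trans {h t : ℕ} {s s' s'' : Store} (h₁ : Frame h t s s') (h₂ : Frame h t s' s'') :
    Frame h t s s'' :=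
  ⟨fun a ha ha' => (h₂.1 a ha ha').trans (h₁.1 a ha ha'),
    fun i hi => (h₂.2 i hi).trans (h₁.2 i hi)⟩

theorem Frame.mono {h t t' : ℕ} {s s' : Store} (h₁ : Frame h t s s') (ht : t' ≤ t) :
    Frame h t' s s' := ⟨h₁.1, fun i hi => h₁.2 i (by omega)⟩

theorem Frame.of_cells {h t : ℕ} {s s' : Store}
    (hh : ∀ a i, a < h + 4 → ¬ (a = h + 1 ∧ ((3 ≤ i ∧ i < 10) ∨ 10 + t < i)) → s' a i = s a i) :
    Frame h t s s' :=
  ⟨fun a ha ha' => funext fun i => hh a i ha fun h' => ha' h'.1,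
    fun i hi => hh _ i (by omega) (by omega)⟩

theorem Frame.holdsEdges {h n m mc t : ℕ} {rc : ℕ → ℕ → ℕ} {s s' : Store} (hf : Frame h t s s')
    (hI : HoldsEdges h n m mc rc s) : HoldsEdges h n m mc rc s' where
  n_eq := by rw [hf.2 0 (by omega), hI.n_eq]
  m_eq := by rw [hf.2 1 (by omega), hI.m_eq]
  mc_eq := by rw [hf.2 2 (by omega), hI.mc_eq]
  edges := by rw [hf.1 _ (by omega) (by omega)]; exact hI.edges
  table := by rw [hf.1 _ (by omega) (by omega)]; exact hI.table

theorem Frame.holdsChosen {h t : ℕ} {s s' : Store} (hf : Frame h t s s') {L : List ℕ}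
    (hL : HoldsChosen h s L) (ht : L.length ≤ t) : HoldsChosen h s' L := by
  induction L with
  | nil => trivial
  | cons E L ih =>
    rw [List.length_cons] at ht
    exact ⟨by rw [hf.2 _ (by omega), hL.1], ih hL.2 (by omega)⟩

/-- The difference of the two accumulators modulo `Q`. -/
def acc (Q h : ℕ) (s : Store) : ZMod Q := (s (h + 1) 3 : ZMod Q) - (s (h + 1) 4 : ZMod Q)

/-- The final count is at most `n ^ k`, so its residue modulo `n ^ k + 1` determines it, while
intermediate sums stay within a word. -/
def modulusE (h k : ℕ) : Expr := addE (powE (nE h) k) (.lit 1)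

/-- The new value of the accumulator of parity `t` after adding `e`. -/
def accumulateE (h k t : ℕ) (e : Expr) : Expr :=
  modE (addE (modE (cell (h + 1) (3 + t % 2)) (modulusE h k)) e) (modulusE h k)

/-- Add `e` to the accumulator of parity `t`. -/
def accumulate (h k t : ℕ) (e : Expr) : Prog :=
  .set (h + 1) (.lit (3 + t % 2)) (accumulateE h k t e)

/-- Words are not signed: terms of even depth go to cell `3` and terms of odd depth to cell `4`, and
only the difference matters. -/
theorem acc_write (Q h t : ℕ) (s : Store) {z v : ℕ}
    (hz : (z : ZMod Q) = s (h + 1) (3 + t % 2) + v) :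
    acc Q h (s.write (h + 1) (3 + t % 2) z) = acc Q h s + (-1) ^ t * v := by
  unfold acc
  rcases Nat.mod_two_eq_zero_or_one t with ht | ht
  · rw [ht] at hz ⊢
    rw [write_apply, write_apply, if_pos (by omega), if_neg (by omega), hz,
      (Nat.even_iff.2 ht).neg_one_pow]
    ring
  · rw [ht] at hz ⊢
    rw [write_apply, write_apply, if_neg (by omega), if_pos (by omega), hz,
      (Nat.odd_iff.2 ht).neg_one_pow]
    ring

/-- The assumptions on the numbers, the edges and the list of chosen edges. -/
structure Ctx (W n m mc h k : ℕ) (rc : ℕ → ℕ → ℕ) (L : List ℕ) : Prop where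
  words : Words W n m h k
  data : EdgeData n m h rc
  mc_le : mc ≤ m
  lt : ∀ E ∈ L, E < m
  len : L.length ≤ k + 1

/-- The store holds the edges and the list of chosen edges. -/
structure Holds (h n m mc : ℕ) (rc : ℕ → ℕ → ℕ) (L : List ℕ) (s : Store) : Prop where
  edges : HoldsEdges h n m mc rc s
  chosen : HoldsChosen h s L

theorem Frame.holds {h n m mc : ℕ} {rc : ℕ → ℕ → ℕ} {L : List ℕ} {s s' : Store}
    (hf : Frame h L.length s s') (hI : Holds h n m mc rc L s) : Holds h n m mc rc L s' :=
  ⟨hf.holdsEdges hI.edges, hf.holdsChosen hI.chosen le_rfl⟩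

/-- Fill array `A` with the matrix `entry`. -/
def fill (h t A q g g' : ℕ) : Prog :=
  grid h (powE (nE h) q) (.set A (addE (mulE (cell (h + 1) 5) (powE (nE h) q)) (cell (h + 1) 6))
    (entryE h t (cell (h + 1) 5) (cell (h + 1) 6) g g'))

theorem index_inj {N x y x' y' : ℕ} (hy : y < N) (hy' : y' < N) (he : x * N + y = x' * N + y') :
    x = x' ∧ y = y' := by
  have h1 := congrArg (· / N) he
  have hN : 0 < N := by omega
  simp only [mul_comm _ N, Nat.mul_add_div hN, Nat.div_eq_of_lt hy,
    Nat.div_eq_of_lt hy', add_zero] at h1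
  subst h1
  exact ⟨rfl, by omega⟩

theorem index_lt {N x y : ℕ} (hx : x < N) (hy : y < N) : x * N + y < N * N := by
  nlinarith

section

variable {W n m mc h k : ℕ} {rc : ℕ → ℕ → ℕ} {s : Store} {L : List ℕ}

theorem Ev.modulus (hW : Words W n m h k) (hs : AllLt W s) (hI : HoldsEdges h n m mc rc s) :
    Ev W s (modulusE h k) (n ^ k + 1) := by
  have := hW.modulus
  exact Ev.add (Ev.pow (Ev.nE hW hs hI) fun a ha => hW.pow a (by omega)) (Ev.lit hW.one_lt)
    (by omega)

theorem Run.accumulate (hW : Words W n m h k) (hs : AllLt W s) (hI : HoldsEdges h n m mc rc s)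
    {e : Expr} {v t : ℕ} (he : Ev W s e v) (hv : v ≤ n ^ k) :
    Run W (accumulate h k t e) s ((accumulateE h k t e).cost + 2) (fun s' =>
      (∀ a i, ¬ (a = h + 1 ∧ i = 3 + t % 2) → s' a i = s a i) ∧
      acc (n ^ k + 1) h s' = acc (n ^ k + 1) h s + (-1) ^ t * v) := by
  have hm := hW.modulus
  have hQ := Ev.modulus hW hs hI
  have hk := hW.k_lt
  -- Reducing the old value before the addition as well makes an invariant on the size of the
  -- accumulators unnecessary.
  have hlt : s (h + 1) (3 + t % 2) % (n ^ k + 1) < n ^ k + 1 := Nat.mod_lt _ (by omega)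
  refine Run.set hs (Ev.lit (by omega))
    (Ev.mod (Ev.add (Ev.mod (Ev.cell hs (by omega)) hQ) he (by omega)) hQ) ?_ ⟨?_, ?_⟩
  · rw [accumulateE]
    simp only [Expr.cost]
    push_cast
    linarith
  · intro a i hai
    rw [write_apply, if_neg hai]
  · apply acc_write
    rw [ZMod.natCast_mod, Nat.cast_add, ZMod.natCast_mod]

/-- The constant is a variable with an equation so that callers can keep their own abbreviation of
the long cost expression. -/
theorem Run.fill (hC : Ctx W n m mc h k rc L) (hs : AllLt W s) (hH : Holds h n m mc rc L s)
    {A q g g' : ℕ} (hA : h + 4 < A) (hq : q ≤ k) (hg : g ≤ k) (hg' : g' ≤ k) :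
    ∀ c : ℝ, c = (entryE h L.length (cell (h + 1) 5) (cell (h + 1) 6) g g').cost +
        5 * (powE (nE h) q).cost + 50 →
    Run W (fill h L.length A q g g') s (c * ((n ^ q : ℕ) : ℝ) ^ 2) (fun s' =>
      (∀ a i, a ≠ A → ¬ (a = h + 1 ∧ (i = 5 ∨ i = 6)) → s' a i = s a i) ∧
      ∀ x < n ^ q, ∀ y < n ^ q, s' A (x * n ^ q + y) = entry n h mc rc L g g' x y) := by
  intro c hc
  have hW := hC.words
  have hk := hW.k_lt
  have hpos := hC.data.pos
  have hframe : ∀ s' : Store,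
      (∀ a i, a ≠ A → ¬ (a = h + 1 ∧ (i = 5 ∨ i = 6)) → s' a i = s a i) →
      Frame h L.length s s' := fun s' hs' =>
    Frame.of_cells fun a i ha hai => hs' a i (by omega) (by omega)
  have hN : 1 ≤ n ^ q := Nat.one_le_pow _ _ hpos
  set N := n ^ q with hNdef
  have hev : ∀ s' : Store, AllLt W s' →
      (∀ a i, a ≠ A → ¬ (a = h + 1 ∧ (i = 5 ∨ i = 6)) → s' a i = s a i) →
      Ev W s' (powE (nE h) q) N := fun s' hl hs' =>
    Ev.pow (Ev.nE hW hl ((hframe s' hs').holds hH).edges) fun a ha => hW.pow a (by omega)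
  refine (Run.grid hs (by omega) hN (fun x y s' =>
      (∀ a i, a ≠ A → ¬ (a = h + 1 ∧ (i = 5 ∨ i = 6)) → s' a i = s a i) ∧
      ∀ x' < N, ∀ y' < N, x' < x ∨ (x' = x ∧ y' < y) →
        s' A (x' * N + y') = entry n h mc rc L g g' x' y')
      (T := (entryE h L.length (cell (h + 1) 5) (cell (h + 1) 6) g g').cost +
        (powE (nE h) q).cost + 10) ?_ ?_ ?_ ?_ ?_).mono ?_ ?_
  · rintro x y s₁ s₂ h12 ⟨h1, h2⟩
    refine ⟨fun a i ha hai => ?_, fun x' hx' y' hy' hlt => ?_⟩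
    · rw [h12 a i hai, h1 a i ha hai]
    · rw [h12 _ _ (by omega), h2 x' hx' y' hy' hlt]
  · exact ⟨fun _ _ _ _ => rfl, fun x' _ y' _ hlt => by omega⟩
  · exact fun x y s' hl hs' => hev s' hl hs'.1
  · rintro x s' ⟨h1, h2⟩
    exact ⟨h1, fun x' hx' y' hy' hlt => h2 x' hx' y' hy' (by omega)⟩
  · rintro x y s' hl hx hy h5 h6 ⟨h1, h2⟩
    have hE5 : Ev W s' (cell (h + 1) 5) x := (Ev.cell hl (by omega)).congr h5
    have hE6 : Ev W s' (cell (h + 1) 6) y := (Ev.cell hl (by omega)).congr h6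
    have hH' := (hframe s' h1).holds hH
    have hxy : x * N + y < N * N := index_lt hx hy
    -- The addresses reach up to `n ^ (2 * q)`, which is why `Words.pow` covers exponents up to `2 *
    -- k`.
    have hNN : N * N < W := by
      rw [hNdef, ← pow_add]; exact hW.pow _ (by omega)
    refine Run.set hl (Ev.add (Ev.mul hE5 (hev s' hl h1) (by omega)) hE6 (by omega))
      (EvP.entry hW hl hH'.edges hC.data hC.mc_le hH'.chosen hC.lt hC.len hE5 hE6 hg hg') ?_
      ⟨?_, ?_, ?_, ?_⟩
    · simp only [Expr.cost, addE, mulE]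
      push_cast
      linarith
    · rw [write_apply, if_neg (by omega), h5]
    · rw [write_apply, if_neg (by omega), h6]
    · intro a i ha hai
      rw [write_apply, if_neg (fun hh => ha hh.1), h1 a i ha hai]
    · intro x' hx' y' hy' hlt
      rw [write_apply]
      split_ifs with hh
      · obtain ⟨rfl, rfl⟩ := index_inj hy' hy hh.2
        rfl
      · refine h2 x' hx' y' hy' ?_
        by_contra hcon
        obtain ⟨rfl, rfl⟩ : x' = x ∧ y' = y := by omega
        exact hh ⟨rfl, rfl⟩
  · rw [hc]
    have : (0 : ℝ) ≤ (N : ℝ) ^ 2 := by positivity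
    nlinarith
  · rintro s' - ⟨h1, h2⟩
    exact ⟨h1, fun x hx y hy => h2 x hx y hy (.inl hx)⟩

/-- Sum up the product of the matrices `entry` and array `h + 7`. -/
def sumUp (h k t q g g' : ℕ) : Prog :=
  grid h (powE (nE h) q) (accumulate h k t
    (mulE (entryE h t (cell (h + 1) 5) (cell (h + 1) 6) g g')
      (.get (h + 7) (addE (mulE (cell (h + 1) 5) (powE (nE h) q)) (cell (h + 1) 6)))))

/-- Entries are at most `1` and `M` is at most `n ^ k`, so each term meets the size limit of
`Run.accumulate`. -/
theorem Run.sumUp (hC : Ctx W n m mc h k rc L) (hs : AllLt W s) (hH : Holds h n m mc rc L s)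
    {q g g' : ℕ} (hq : q ≤ k) (hg : g ≤ k) (hg' : g' ≤ k) {M : ℕ → ℕ → ℕ}
    (hM : ∀ x < n ^ q, ∀ y < n ^ q, s (h + 7) (x * n ^ q + y) = M x y)
    (hMle : ∀ x y, M x y ≤ n ^ k) :
    ∀ c : ℝ, c = (accumulateE h k L.length
      (mulE (entryE h L.length (cell (h + 1) 5) (cell (h + 1) 6) g g')
        (.get (h + 7) (addE (mulE (cell (h + 1) 5) (powE (nE h) q)) (cell (h + 1) 6))))).cost +
        4 * (powE (nE h) q).cost + 50 →
    Run W (sumUp h k L.length q g g') s (c * ((n ^ q : ℕ) : ℝ) ^ 2) (fun s' =>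
      Frame h L.length s s' ∧ acc (n ^ k + 1) h s' = acc (n ^ k + 1) h s +
        (-1) ^ L.length * ((∑ x ∈ range (n ^ q), ∑ y ∈ range (n ^ q),
          entry n h mc rc L g g' x y * M x y : ℕ) : ZMod (n ^ k + 1))) := by
  intro c hc
  have hW := hC.words
  have hk := hW.k_lt
  have hpos := hC.data.pos
  have hN : 1 ≤ n ^ q := Nat.one_le_pow _ _ hpos
  set N := n ^ q with hNdef
  set t := L.length with ht
  have hframe : ∀ s' : Store, (∀ a i, ¬ (a = h + 1 ∧ 3 ≤ i ∧ i ≤ 6) → s' a i = s a i) →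
      Frame h t s s' := fun s' hs' =>
    Frame.of_cells fun a i ha hai => hs' a i (by omega)
  have hev : ∀ s' : Store, AllLt W s' →
      (∀ a i, ¬ (a = h + 1 ∧ 3 ≤ i ∧ i ≤ 6) → s' a i = s a i) →
      Ev W s' (powE (nE h) q) N := fun s' hl hs' =>
    Ev.pow (Ev.nE hW hl ((hframe s' hs').holds hH).edges) fun a ha => hW.pow a (by omega)
  refine (Run.grid hs (by omega) hN (fun x y s' =>
      (∀ a i, ¬ (a = h + 1 ∧ 3 ≤ i ∧ i ≤ 6) → s' a i = s a i) ∧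
      acc (n ^ k + 1) h s' = acc (n ^ k + 1) h s + (-1) ^ t *
        ((∑ x' ∈ range x, ∑ y' ∈ range N, entry n h mc rc L g g' x' y' * M x' y' +
          ∑ y' ∈ range y, entry n h mc rc L g g' x y' * M x y' : ℕ) : ZMod (n ^ k + 1)))
      (T := (accumulateE h k t
      (mulE (entryE h t (cell (h + 1) 5) (cell (h + 1) 6) g g')
        (.get (h + 7) (addE (mulE (cell (h + 1) 5) (powE (nE h) q)) (cell (h + 1) 6))))).cost + 2)
      ?_ ?_ ?_ ?_ ?_).mono ?_ ?_
  · rintro x y s₁ s₂ h12 ⟨h1, h2⟩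
    refine ⟨fun a i hai => ?_, ?_⟩
    · rw [h12 a i (by omega), h1 a i hai]
    · rw [← h2, acc, acc, h12 _ _ (by omega), h12 _ _ (by omega)]
  · exact ⟨fun _ _ _ => rfl, by simp⟩
  · exact fun x y s' hl hs' => hev s' hl hs'.1
  · rintro x s' ⟨h1, h2⟩
    exact ⟨h1, by rw [h2, sum_range_succ, sum_range_zero, add_zero]⟩
  · rintro x y s' hl hx hy h5 h6 ⟨h1, h2⟩
    have hE5 : Ev W s' (cell (h + 1) 5) x := (Ev.cell hl (by omega)).congr h5
    have hE6 : Ev W s' (cell (h + 1) 6) y := (Ev.cell hl (by omega)).congr h6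
    have hH' := (hframe s' h1).holds hH
    have hxy : x * N + y < N * N := index_lt hx hy
    have hNN : N * N < W := by
      rw [hNdef, ← pow_add]; exact hW.pow _ (by omega)
    have he1 : entry n h mc rc L g g' x y ≤ 1 := ind_le_one _
    have hle : entry n h mc rc L g g' x y * M x y ≤ n ^ k := by nlinarith [hMle x y]
    have hget : Ev W s' (.get (h + 7) (addE (mulE (cell (h + 1) 5) (powE (nE h) q))
        (cell (h + 1) 6))) (M x y) := by
      refine (Ev.get hl (Ev.add (Ev.mul hE5 (hev s' hl h1) (by omega)) hE6 (by omega))).congr ?_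
      rw [h1 _ _ (by omega), hM x hx y hy]
    have hm := hW.modulus
    refine (Run.accumulate hW hl hH'.edges (Ev.mul (EvP.entry hW hl hH'.edges hC.data hC.mc_le
      hH'.chosen hC.lt hC.len hE5 hE6 hg hg') hget (by omega)) hle (t := t)).mono le_rfl ?_
    rintro s'' - ⟨h3, h4⟩
    refine ⟨by rw [h3 _ _ (by omega), h5], by rw [h3 _ _ (by omega), h6], fun a i hai => ?_, ?_⟩
    · rw [h3 a i (by omega), h1 a i hai]
    · rw [h4, h2, sum_range_succ]
      push_cast
      ring
  · rw [hc]
    have : (0 : ℝ) ≤ (N : ℝ) ^ 2 := by positivity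
    nlinarith
  · rintro s' - ⟨h1, h2⟩
    exact ⟨hframe s' h1, by rw [h2]; simp⟩

end

/-! ### The two counting routines: matrix multiplication and exhaustive search -/

/-- The program `p` multiplies matrices with entries `0` and `1` within `C * N ^ ω` steps. -/
def Multiplies (ω : ℝ) (p : Prog) (C : ℝ) (c : ℕ) : Prop :=
  ∀ (N : ℕ), 1 ≤ N → ∀ (W : ℕ), (N + 2) ^ c ≤ W →
    ∀ (A B : Matrix (Fin N) (Fin N) ℕ), (∀ i j, A i j ≤ N ^ 0) → (∀ i j, B i j ≤ N ^ 0) →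
    ∀ s : Store, (∀ a i, s a i < W) → s 0 0 = N → HoldsMatrix s 1 A → HoldsMatrix s 2 B →
      ∃ (s' : Store) (t : ℕ), Exec W p s s' t ∧ (t : ℝ) ≤ C * (N : ℝ) ^ ω ∧
        HoldsMatrix s' 3 (A * B)

/-- Count the sets above the first `t` chosen edges that satisfy the pair conditions and have `r`
further elements. -/
def countPairs (pM : Prog) (h k t r : ℕ) : Prog :=
  .seq (.set (h + 4) (.lit 0) (powE (nE h) ((r + 2) / 3)))
    (.seq (fill h t (h + 5) ((r + 2) / 3) (r / 3) ((r + 1) / 3))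
      (.seq (fill h t (h + 6) ((r + 2) / 3) ((r + 1) / 3) ((r + 2) / 3))
        (.seq (pM.shift (h + 4)) (sumUp h k t ((r + 2) / 3) (r / 3) ((r + 2) / 3)))))

/-- Count the sets above the first `t` chosen edges that contain no edge before the limit and have
`r` further elements, by exhaustive search. -/
def countFree (h k t r : ℕ) : Prog :=
  forLoop (h + 1) 5 (.lit 0) (powE (nE h) r)
    (accumulate h k t (freeE h t (digitsE (nE h) r (cell (h + 1) 5))))

/-- The program `f u`, where `u` is the value of `e`. -/
def dispatch (e : Expr) (f : ℕ → Prog) : ℕ → Prog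
  | 0 => .skip
  | j + 1 => .ite (eqE e (.lit j)) (f j) (dispatch e f j)

theorem Run.dispatch {W : ℕ} (hW : 1 < W) {s : Store} {e : Expr} {u j : ℕ} {f : ℕ → Prog} {T : ℝ}
    {Q : Store → Prop} (he : Ev W s e u) (hu : u < j) (hj : j < W) (hf : Run W (f u) s T Q) :
    Run W (dispatch e f j) s (T + j * (e.cost + 3)) Q := by
  induction j with
  | zero => omega
  | succ j ih =>
    refine (Run.ite (T := T + j * (e.cost + 3)) (EvP.eq hW he (Ev.lit (by omega : j < W)))
      ?_ ?_).mono ?_ fun _ _ hh => hh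
    · intro hc
      rw [ind_ne_zero] at hc
      rw [← hc]
      exact hf.mono (le_add_of_nonneg_right (by positivity)) fun _ _ hh => hh
    · intro hc
      rw [ind_eq_zero] at hc
      exact ih (by omega) (by omega)
    · simp only [eqE, Expr.cost]
      push_cast
      linarith

section

variable {W n m mc h k : ℕ} {rc : ℕ → ℕ → ℕ} {s : Store} {L : List ℕ}

theorem Ctx.cover_subset (hC : Ctx W n m mc h k rc L) : cover h rc L ⊆ range n := by
  intro v hv
  rw [cover, List.mem_toFinset] at hv
  exact mem_range.2 (coverList_lt hC.data hC.lt v hv)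

theorem rpow_pow_comm (n q : ℕ) (ω : ℝ) : ((n ^ q : ℕ) : ℝ) ^ ω = ((n : ℝ) ^ ω) ^ q := by
  rw [Nat.cast_pow, ← Real.rpow_natCast, ← Real.rpow_mul (Nat.cast_nonneg n), mul_comm,
    Real.rpow_mul (Nat.cast_nonneg n), Real.rpow_natCast]

/-- The `r` missing vertices are cut into parts of `r / 3`, `(r + 1) / 3` and `(r + 2) / 3`
vertices. The largest part has `q = ⌈r / 3⌉` of them, so matrices of size `n ^ q` suffice and the
product costs `(n ^ ω) ^ q`. The constant depends only on `h`, `k`, `t`, `r` and the multiplication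
program, as it is fixed before the input. -/
theorem Run.countPairs {ω : ℝ} (hω : 2 ≤ ω) {pM : Prog} {C : ℝ} {c₀ : ℕ}
    (hM : Multiplies ω pM C c₀) (h k t r : ℕ) (hr : r ≤ k) :
    ∃ c : ℝ, ∀ {W n m mc : ℕ} {rc : ℕ → ℕ → ℕ} {L : List ℕ} {s : Store}, L.length = t →
      Ctx W n m mc h k rc L → (∀ q ≤ k, (n ^ q + 2) ^ c₀ ≤ W) → AllLt W s →
      Holds h n m mc rc L s → r + (cover h rc L).card = k →
      Run W (countPairs pM h k t r) s (c * ((n : ℝ) ^ ω) ^ ((r + 2) / 3)) (fun s' =>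
        Frame h t s s' ∧ acc (n ^ k + 1) h s' = acc (n ^ k + 1) h s +
          (-1) ^ t * ((above n k (cover h rc L) (PairsOk h mc rc L)).card : ZMod (n ^ k + 1))) := by
  set q := (r + 2) / 3 with hq
  set c₁ : ℝ := (entryE h t (cell (h + 1) 5) (cell (h + 1) 6) (r / 3) ((r + 1) / 3)).cost +
        5 * (powE (nE h) q).cost + 50 with hc₁
  set c₂ : ℝ := (entryE h t (cell (h + 1) 5) (cell (h + 1) 6) ((r + 1) / 3) ((r + 2) / 3)).cost +
        5 * (powE (nE h) q).cost + 50 with hc₂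
  set c₃ : ℝ := (accumulateE h k t
      (mulE (entryE h t (cell (h + 1) 5) (cell (h + 1) 6) (r / 3) ((r + 2) / 3))
        (.get (h + 7) (addE (mulE (cell (h + 1) 5) (powE (nE h) q)) (cell (h + 1) 6))))).cost +
        4 * (powE (nE h) q).cost + 50 with hc₃
  refine ⟨(powE (nE h) q).cost + 2 + c₁ + c₂ + c₃ + C, ?_⟩
  rintro W n m mc rc L s rfl hC hMW hs hH hrk
  have hW := hC.words
  have hk := hW.k_lt
  have hpos := hC.data.pos
  have hqk : q ≤ k := by omega
  have hN : 1 ≤ n ^ q := Nat.one_le_pow _ _ hpos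
  have hle : ∀ g, g ≤ q → n ^ g ≤ n ^ q := fun g hg => Nat.pow_le_pow_right hpos hg
  have hcount : (above n k (cover h rc L) (PairsOk h mc rc L)).card =
      ∑ x ∈ range (n ^ q), ∑ z ∈ range (n ^ q), entry n h mc rc L (r / 3) ((r + 2) / 3) x z *
        ∑ y ∈ range (n ^ q), entry n h mc rc L (r / 3) ((r + 1) / 3) x y *
          entry n h mc rc L ((r + 1) / 3) ((r + 2) / 3) y z := by
    rw [card_above hC.cover_subset (by omega), show k - (cover h rc L).card = r by omega,
      ← sum_good hpos (hle _ (by omega)) (hle _ (by omega)) (hle _ (by omega)),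
      show r / 3 + (r + 1) / 3 + (r + 2) / 3 = r by omega]
    rfl
  set N := n ^ q with hNdef
  have hlast : ∀ s₃ : Store, AllLt W s₃ → Frame h L.length s s₃ →
      acc (n ^ k + 1) h s₃ = acc (n ^ k + 1) h s → s₃ (h + 4) 0 = N →
      (∀ x < N, ∀ y < N,
        s₃ (h + 5) (x * N + y) = entry n h mc rc L (r / 3) ((r + 1) / 3) x y) →
      (∀ x < N, ∀ y < N,
        s₃ (h + 6) (x * N + y) = entry n h mc rc L ((r + 1) / 3) ((r + 2) / 3) x y) →
      Run W (.seq (pM.shift (h + 4)) (WordRAM.sumUp h k L.length q (r / 3) ((r + 2) / 3))) s₃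
        (C * (N : ℝ) ^ ω + c₃ * (N : ℝ) ^ 2) (fun s' =>
        Frame h L.length s s' ∧ acc (n ^ k + 1) h s' = acc (n ^ k + 1) h s +
          (-1) ^ L.length *
            ((above n k (cover h rc L) (PairsOk h mc rc L)).card : ZMod (n ^ k + 1))) := by
    intro s₃ hl₃ hf₃ ha₃ hN₃ h5 h6
    -- After relocation by `h + 4`, the arrays `0, 1, 2, 3` of the multiplication program are `h +
    -- 4, …, h + 7`, clear of the input, the variables, the edges and the table.
    obtain ⟨u', t', he, ht', hmat⟩ := hM N hN W (hMW q hqk)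
      (fun i j => entry n h mc rc L (r / 3) ((r + 1) / 3) i j)
      (fun i j => entry n h mc rc L ((r + 1) / 3) ((r + 2) / 3) i j)
      (fun i j => by rw [pow_zero]; exact ind_le_one _)
      (fun i j => by rw [pow_zero]; exact ind_le_one _) (s₃.drop (h + 4))
      (fun a i => hl₃ _ _) (by rw [← hN₃, Store.drop, zero_add])
      (fun i j => by
        rw [Store.drop, show 1 + (h + 4) = h + 5 by omega]; exact h5 i i.2 j j.2)
      (fun i j => by
        rw [Store.drop, show 2 + (h + 4) = h + 6 by omega]; exact h6 i i.2 j j.2)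
    refine Run.seq (Q₁ := fun s₄ => (∀ a < h + 4, s₄ a = s₃ a) ∧ s₄.drop (h + 4) = u')
      (Run.shift hl₃ he rfl ht' fun s' h1 h2 => ⟨h1, h2⟩) ?_
    rintro s₄ hl₄ ⟨h7, h8⟩
    have hf₄ : Frame h L.length s s₄ := hf₃.trans
      ⟨fun a ha _ => h7 a ha, fun i _ => by rw [h7 (h + 1) (by omega)]⟩
    refine (Run.sumUp hC hl₄ (hf₄.holds hH) (M := fun x z => ∑ y ∈ range N,
      entry n h mc rc L (r / 3) ((r + 1) / 3) x y *
        entry n h mc rc L ((r + 1) / 3) ((r + 2) / 3) y z) hqk (by omega) (by omega) ?_ ?_ c₃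
        hc₃).mono le_rfl ?_
    · intro x hx z hz
      have h9 := (hmat ⟨x, hx⟩ ⟨z, hz⟩).trans Matrix.mul_apply
      rw [← h8, Store.drop, show 3 + (h + 4) = h + 7 by omega] at h9
      rw [h9, sum_range]
    -- An entry of the product is a sum of `N` terms that are at most `1`, and `N = n ^ q ≤ n ^ k`.
    · intro x z
      refine (sum_le_card_nsmul _ _ 1 fun y _ => ?_).trans ?_
      · exact Nat.mul_le_mul (ind_le_one _) (ind_le_one _)
      · simpa [hNdef] using Nat.pow_le_pow_right hpos hqk
    · rintro s' - ⟨h9, h10⟩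
      refine ⟨hf₄.trans h9, ?_⟩
      rw [h10, hcount, ← ha₃]
      congr 1
      rw [acc, acc, h7 (h + 1) (by omega)]
  refine (Run.seq (T₁ := (powE (nE h) q).cost + 2) (Q₁ := fun s₁ => s₁ = s.write (h + 4) 0 N)
    (Run.set hs (Ev.lit (by omega))
      (Ev.pow (Ev.nE hW hs hH.edges) fun a ha => hW.pow a (by omega)) ?_ rfl) ?_
    (T₂ := c₁ * (N : ℝ) ^ 2 + (c₂ * (N : ℝ) ^ 2 + (C * (N : ℝ) ^ ω + c₃ * (N : ℝ) ^ 2)))).mono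
      ?_ fun _ _ hh => hh
  · simp only [Expr.cost]; push_cast; linarith
  · rintro s₁ hl₁ rfl
    have hf₁ : Frame h L.length s (s.write (h + 4) 0 N) := Frame.of_cells fun a i ha _ => by
      rw [write_apply, if_neg (by omega)]
    refine Run.seq (Run.fill hC hl₁ (hf₁.holds hH) (A := h + 5) (by omega) hqk (by omega)
      (by omega) c₁ hc₁) ?_
    rintro s₂ hl₂ ⟨h1, h2⟩
    have hf₂ : Frame h L.length s s₂ := hf₁.trans
      (Frame.of_cells fun a i ha hai => h1 a i (by omega) (by omega))
    refine Run.seq (Run.fill hC hl₂ (hf₂.holds hH) (A := h + 6) (by omega) hqk (by omega)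
      (by omega) c₂ hc₂) ?_
    rintro s₃ hl₃ ⟨h3, h4⟩
    refine hlast s₃ hl₃ (hf₂.trans
      (Frame.of_cells fun a i ha hai => h3 a i (by omega) (by omega))) ?_ ?_ ?_ h4
    · rw [acc, acc, h3 _ _ (by omega) (by omega), h3 _ _ (by omega) (by omega),
        h1 _ _ (by omega) (by omega), h1 _ _ (by omega) (by omega), write_apply, write_apply,
        if_neg (by omega), if_neg (by omega)]
    · rw [h3 _ _ (by omega) (by omega), h1 _ _ (by omega) (by omega), write_same]
    · intro x hx y hy
      rw [h3 _ _ (by omega) (by omega), h2 x hx y hy]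
  · rw [← rpow_pow_comm]
    have h1 : (1 : ℝ) ≤ N := by exact_mod_cast hN
    -- Here `ω ≥ 2` lets the multiplication pay for filling and summing up.
    have h2 : (N : ℝ) ^ 2 ≤ (N : ℝ) ^ ω := by
      rw [← Real.rpow_two]; exact Real.rpow_le_rpow_of_exponent_le h1 hω
    have h3 : (1 : ℝ) ≤ (N : ℝ) ^ ω := Real.one_le_rpow h1 (by linarith)
    have h4 : 0 ≤ c₁ := by positivity
    have h5 : 0 ≤ c₂ := by positivity
    have h6 : 0 ≤ c₃ := by positivity
    have h7 : 0 ≤ (powE (nE h) q).cost + (2 : ℝ) := by positivity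
    have := mul_le_mul_of_nonneg_left h2 h4
    have := mul_le_mul_of_nonneg_left h2 h5
    have := mul_le_mul_of_nonneg_left h2 h6
    have := mul_le_mul_of_nonneg_left h3 h7
    linarith

theorem Run.countFree (hC : Ctx W n m mc h k rc L) (hs : AllLt W s)
    (hH : Holds h n m mc rc L s) {r : ℕ} (hr : r + (cover h rc L).card = k) :
    Run W (countFree h k L.length r) s (((accumulateE h k L.length
        (freeE h L.length (digitsE (nE h) r (cell (h + 1) 5)))).cost +
        2 * (powE (nE h) r).cost + 30) * (n : ℝ) ^ r) (fun s' =>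
      Frame h L.length s s' ∧ acc (n ^ k + 1) h s' = acc (n ^ k + 1) h s +
        (-1) ^ L.length * ((above n k (cover h rc L)
          (EdgeFree h rc (limit mc L))).card : ZMod (n ^ k + 1))) := by
  have hW := hC.words
  have hk := hW.k_lt
  have hpos := hC.data.pos
  set t := L.length with ht
  have hcount := card_above (P := EdgeFree h rc (limit mc L)) hC.cover_subset (k := k) (by omega)
  rw [show k - (cover h rc L).card = r by omega] at hcount
  rw [hcount]
  have hframe : ∀ s' : Store, (∀ a i, ¬ (a = h + 1 ∧ 3 ≤ i ∧ i ≤ 6) → s' a i = s a i) →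
      Frame h t s s' := fun s' hs' =>
    Frame.of_cells fun a i ha hai => hs' a i (by omega)
  refine (Run.forLoop hs (fun x s' => (∀ a i, ¬ (a = h + 1 ∧ 3 ≤ i ∧ i ≤ 6) → s' a i = s a i) ∧
      acc (n ^ k + 1) h s' = acc (n ^ k + 1) h s + (-1) ^ t * ((∑ x ∈ range x,
      ind ((digits n r x).Pairwise (· < ·) ∧ (∀ a ∈ digits n r x, a ∉ cover h rc L) ∧
        EdgeFree h rc (limit mc L) (cover h rc L ∪ (digits n r x).toFinset)) : ℕ) :
          ZMod (n ^ k + 1))) (Nat.zero_le _) (hW.pow r (by omega)) (by omega) (Ev.lit (by omega))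
      ?_ ?_ ?_ (T := fun _ => (accumulateE h k t
        (freeE h t (digitsE (nE h) r (cell (h + 1) 5)))).cost + 2)).mono ?_ ?_
  · refine ⟨fun a i hai => by rw [write_apply, if_neg (by omega)], ?_⟩
    rw [acc, write_apply, write_apply, if_neg (by omega), if_neg (by omega)]
    simp [acc]
  · rintro i s' hl - - - ⟨h1, -⟩
    exact Ev.pow (Ev.nE hW hl ((hframe s' h1).holds hH).edges) fun a ha => hW.pow a (by omega)
  · rintro x s' hl - hx h5 ⟨h1, h2⟩
    have hH' := (hframe s' h1).holds hH
    have hd := Ev.digits (Ev.nE hW hl hH'.edges) ((Ev.cell hl (by omega : 5 < W)).congr h5) (g := r)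
    have hfree := EvP.free hW hl hH'.edges hC.data hC.mc_le hH'.chosen hC.lt hC.len hd.1
      (by rw [hd.2]; exact digits_lt hpos _ _)
    rw [hd.2] at hfree
    refine (Run.accumulate hW hl hH'.edges hfree ((ind_le_one _).trans (Nat.one_le_pow _ _ hpos))
      (t := t)).mono le_rfl ?_
    rintro s'' - ⟨h3, h4⟩
    refine ⟨by rw [h3 _ _ (by omega), h5], fun a i hai => ?_, ?_⟩
    · rw [write_apply, if_neg (by omega), h3 a i (by omega), h1 a i hai]
    · rw [acc, write_apply, write_apply, if_neg (by omega), if_neg (by omega), ← acc, h4, h2,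
        sum_range_succ]
      push_cast
      ring
  · simp only [sum_const, Nat.card_Ico, Expr.cost, nsmul_eq_mul, Nat.sub_zero]
    have h1 : (1 : ℝ) ≤ (n : ℝ) ^ r := by exact_mod_cast Nat.one_le_pow _ _ hpos
    have h2 : (0 : ℝ) ≤ (powE (nE h) r).cost := by positivity
    push_cast
    nlinarith
  · rintro s' - ⟨-, h1, h2⟩
    exact ⟨hframe s' h1, h2⟩

end

/-! ### The recursion over chosen edges -/

def leE (x y : Expr) : Expr := notE (ltE y x)

def coverCardE (h t : ℕ) : Expr := distinctE (coverE h t)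

def extendsE (h k t : ℕ) : Expr :=
  andE (leE (addE (coverCardE h t) (.lit 3)) (coverCardE h (t + 1)))
    (leE (coverCardE h (t + 1)) (.lit k))

/-- Count the sets above the first `t` chosen edges that satisfy the pair conditions. -/
def countAllPairs (pM : Prog) (h k t : ℕ) : Prog :=
  dispatch (coverCardE h t) (fun u => countPairs pM h k t (k - u)) (k + 1)

/-- Count the sets above the first `t` chosen edges that satisfy the pair conditions and contain no
edge before the limit, with recursion depth `d`. -/
def countFreeSets (pM : Prog) (h k : ℕ) : ℕ → ℕ → Prog
  | 0, t => countAllPairs pM h k t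
  | d + 1, t => .seq (countAllPairs pM h k t)
      (.ite (leE (addE (coverCardE h t) (.lit 3)) (.lit k))
        (forLoop (h + 1) (10 + (t + 1)) (.lit 0) (limitE h t)
          (.ite (extendsE h k t) (countFreeSets pM h k d (t + 1)) .skip))
        .skip)

open Classical in
/-- A bound for the running time of `countFreeSets`. -/
noncomputable def treeCost (h k mc : ℕ) (rc : ℕ → ℕ → ℕ) (X c : ℝ) : ℕ → List ℕ → ℝ
  | 0, L => c * X ^ ((k - (cover h rc L).card + 2) / 3)
  | d + 1, L => c * X ^ ((k - (cover h rc L).card + 2) / 3) +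
      if (cover h rc L).card + 3 ≤ k then
        ∑ E ∈ range (limit mc L),
          (c + if Extends h k rc L E then treeCost h k mc rc X c d (E :: L) else 0)
      else 0

theorem treeCost_mono {h k mc : ℕ} {rc : ℕ → ℕ → ℕ} {X c c' : ℝ} (hX : 0 ≤ X) (hc : c ≤ c')
    (d : ℕ) (L : List ℕ) : treeCost h k mc rc X c d L ≤ treeCost h k mc rc X c' d L := by
  induction d generalizing L with
  | zero => exact mul_le_mul_of_nonneg_right hc (by positivity)
  | succ d ih =>
    refine add_le_add (mul_le_mul_of_nonneg_right hc (by positivity)) ?_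
    split_ifs
    · refine sum_le_sum fun E _ => add_le_add hc ?_
      split_ifs
      exacts [ih _, le_rfl]
    · exact le_rfl

section

variable {W n m mc h k : ℕ} {rc : ℕ → ℕ → ℕ} {s : Store} {L : List ℕ}

theorem EvP.le (hW : 1 < W) {x y : Expr} {a b : ℕ} (hx : Ev W s x a) (hy : Ev W s y b) :
    EvP W s (leE x y) (a ≤ b) :=
  (EvP.not hW (EvP.lt hW hy hx)).congr not_lt

theorem length_coverE (h t : ℕ) : (coverE h t).length = t * h := by
  induction t with
  | zero => simp [coverE]
  | succ t ih => simp [coverE, edgeE, ih]; ring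

theorem Ev.coverCard (hC : Ctx W n m mc h k rc L) (hs : AllLt W s) (hH : Holds h n m mc rc L s) :
    Ev W s (coverCardE h L.length) (WordRAM.cover h rc L).card := by
  have hc := Ev.cover hC.words hs hH.edges hH.chosen hC.lt hC.len
  refine (Ev.distinct hC.words.one_lt hc.1 ?_).congr (by rw [hc.2, WordRAM.cover])
  rw [length_coverE]
  have := hC.words.const
  have := Nat.mul_le_mul hC.len (show h ≤ h + 2 by omega)
  nlinarith

/-- The number of missing vertices is known only at run time, while the lengths of the parts are
built into the program; hence the dispatch among `k + 1` programs. -/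
theorem Run.countAllPairs {ω : ℝ} (hω : 2 ≤ ω) {pM : Prog} {C : ℝ} {c₀ : ℕ}
    (hM : Multiplies ω pM C c₀) (h k t : ℕ) :
    ∃ c : ℝ, 0 ≤ c ∧ ∀ {W n m mc : ℕ} {rc : ℕ → ℕ → ℕ} {L : List ℕ} {s : Store}, L.length = t →
      Ctx W n m mc h k rc L → (∀ q ≤ k, (n ^ q + 2) ^ c₀ ≤ W) → AllLt W s →
      Holds h n m mc rc L s → (WordRAM.cover h rc L).card ≤ k →
      Run W (countAllPairs pM h k t) s
        (c * ((n : ℝ) ^ ω) ^ ((k - (WordRAM.cover h rc L).card + 2) / 3)) (fun s' =>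
        Frame h t s s' ∧ acc (n ^ k + 1) h s' = acc (n ^ k + 1) h s +
          (-1) ^ t * ((above n k (cover h rc L) (PairsOk h mc rc L)).card : ZMod (n ^ k + 1))) := by
  have hex := fun r : ℕ => fun hr : r ≤ k => Run.countPairs hω hM h k t r hr
  choose! cr hcr using hex
  -- One constant above all `cr r`; absolute values, because the signs of the `cr r` are not known.
  set c₁ : ℝ := ∑ r ∈ range (k + 1), |cr r|
  set c₂ : ℝ := (k + 1 : ℕ) * ((coverCardE h t).cost + 3)
  have hc₁ : 0 ≤ c₁ := by positivity
  refine ⟨c₁ + c₂, by positivity, ?_⟩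
  rintro W n m mc rc L s rfl hC hMW hs hH hk
  set u := (WordRAM.cover h rc L).card with hu
  have hX : (1 : ℝ) ≤ (n : ℝ) ^ ω :=
    Real.one_le_rpow (by exact_mod_cast hC.data.pos) (by linarith)
  have hXq : 1 ≤ ((n : ℝ) ^ ω) ^ ((k - u + 2) / 3) := one_le_pow₀ hX
  refine (Run.dispatch hC.words.one_lt (Ev.coverCard hC hs hH) (by omega : u < k + 1)
    (by have := hC.words.k_lt; omega)
    (hcr (k - u) (by omega) rfl hC hMW hs hH (by omega))).mono ?_ fun _ _ hh => hh
  have h1 : cr (k - u) ≤ c₁ := (le_abs_self _).trans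
    (single_le_sum (f := fun r => |cr r|) (fun _ _ => abs_nonneg _) (mem_range.2 (by omega)))
  have h2 : 0 ≤ c₂ := by positivity
  rw [add_mul]
  exact add_le_add (mul_le_mul_of_nonneg_right h1 (by positivity)) (le_mul_of_one_le_right h2 hXq)

theorem Frame.write_counter {t x : ℕ} : Frame h t s (s.write (h + 1) (10 + (t + 1)) x) :=
  Frame.of_cells fun a i _ hai => by rw [write_apply, if_neg (by omega)]

theorem acc_write_counter {Q t x : ℕ} :
    acc Q h (s.write (h + 1) (10 + (t + 1)) x) = acc Q h s := by
  rw [acc, write_apply, write_apply, if_neg (by omega), if_neg (by omega), acc]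

/-- `card_pairsOk` solved for the free sets: `free(L) = pairs(L) - Σ_E free(E :: L)`, where the
change of sign is the step from `t` to `t + 1`. A chosen edge brings at least three new vertices, so
the hypothesis `k < u + 3 * (d + 1)` passes to the children, and `3 * L.length ≤ u ≤ k` bounds the
number of chosen edges. -/
theorem Run.countFreeSets {ω : ℝ} (hω : 2 ≤ ω) {pM : Prog} {C : ℝ} {c₀ : ℕ}
    (hM : Multiplies ω pM C c₀) (h k d t : ℕ) :
    ∃ c : ℝ, 0 ≤ c ∧ ∀ {W n m mc : ℕ} {rc : ℕ → ℕ → ℕ} {L : List ℕ} {s : Store}, L.length = t →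
      Ctx W n m mc h k rc L → (∀ q ≤ k, (n ^ q + 2) ^ c₀ ≤ W) → AllLt W s →
      Holds h n m mc rc L s → (WordRAM.cover h rc L).card ≤ k →
      3 * L.length ≤ (WordRAM.cover h rc L).card → k < (WordRAM.cover h rc L).card + 3 * (d + 1) →
      (∀ J < m, (WordRAM.edge h rc J).Nonempty) →
      Run W (countFreeSets pM h k d t) s (treeCost h k mc rc ((n : ℝ) ^ ω) c d L) (fun s' =>
        Frame h t s s' ∧ acc (n ^ k + 1) h s' = acc (n ^ k + 1) h s +
          (-1) ^ t * ((freeSets n k h mc rc L).card : ZMod (n ^ k + 1))) := by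
  classical
  induction d generalizing t with
  | zero =>
    obtain ⟨c, hc, hr⟩ := Run.countAllPairs hω hM h k t
    refine ⟨c, hc, ?_⟩
    rintro W n m mc rc L s rfl hC hMW hs hH hk - hd hne
    refine (hr rfl hC hMW hs hH hk).mono le_rfl ?_
    rintro s' - ⟨h1, h2⟩
    refine ⟨h1, ?_⟩
    rw [h2, card_pairsOk fun J hJ => hne J (hJ.trans_le (limit_le hC.mc_le hC.lt)),
      filter_false_of_mem, sum_empty, add_zero]
    -- At depth `0` fewer than three vertices are missing, so no edge extends `L`.
    intro E _ hE
    have := hE.1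
    have := hE.2
    omega
  | succ d ih =>
    obtain ⟨c₁, hc₁, hr⟩ := Run.countAllPairs hω hM h k t
    obtain ⟨c₂, hc₂, hrec⟩ := ih (t + 1)
    set c₃ : ℝ := (leE (addE (coverCardE h t) (.lit 3)) (.lit k)).cost + (limitE h t).cost + 20
    set c₄ : ℝ := (extendsE h k t).cost + (limitE h t).cost + 20
    have hc₃ : 0 ≤ c₃ := by positivity
    have hc₄ : 0 ≤ c₄ := by positivity
    refine ⟨c₁ + c₂ + c₃ + c₄, by positivity, ?_⟩
    rintro W n m mc rc L s rfl hC hMW hs hH hk h3 hd hne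
    have hW := hC.words
    have h1W := hW.one_lt
    have hkW := hW.k_lt
    set X := (n : ℝ) ^ ω
    set u := (WordRAM.cover h rc L).card with hu
    set c := c₁ + c₂ + c₃ + c₄ with hc
    have hX : (1 : ℝ) ≤ X := Real.one_le_rpow (by exact_mod_cast hC.data.pos) (by linarith)
    have hXq : 1 ≤ X ^ ((k - u + 2) / 3) := one_le_pow₀ hX
    have hlim : limit mc L ≤ m := limit_le hC.mc_le hC.lt
    have hmain := card_pairsOk (n := n) (k := k)
      fun J hJ => hne J (Nat.lt_of_lt_of_le hJ hlim)
    have hle3 : ∀ s', AllLt W s' → Holds h n m mc rc L s' →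
        EvP W s' (leE (addE (coverCardE h L.length) (.lit 3)) (.lit k)) (u + 3 ≤ k) := by
      intro s' hl' hH'
      exact EvP.le h1W (Ev.add (Ev.coverCard hC hl' hH') (Ev.lit (by omega)) (by omega))
        (Ev.lit (by omega))
    have hterm : ∀ E, (if Extends h k rc L E then treeCost h k mc rc X c₂ d (E :: L) else 0) ≤
        if Extends h k rc L E then treeCost h k mc rc X c d (E :: L) else 0 := by
      intro E
      split_ifs
      · exact treeCost_mono (by positivity) (by linarith) d _
      · exact le_rfl
    refine (Run.seq (hr rfl hC hMW hs hH hk) (T₂ := c₃ + if u + 3 ≤ k then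
      ∑ E ∈ range (limit mc L),
          (c + if Extends h k rc L E then treeCost h k mc rc X c d (E :: L) else 0) else 0)
      ?_).mono ?_ fun _ _ hh => hh
    · rintro s₁ hl₁ ⟨hf₁, ha₁⟩
      have hH₁ := hf₁.holds hH
      refine (Run.ite (hle3 s₁ hl₁ hH₁) (T := (limitE h L.length).cost + 7 +
        if u + 3 ≤ k then ∑ E ∈ range (limit mc L),
          (c + if Extends h k rc L E then treeCost h k mc rc X c d (E :: L) else 0) else 0)
        ?_ ?_).mono ?_ fun _ _ hh => hh
      · intro hcond
        rw [ind_ne_zero] at hcond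
        rw [if_pos hcond]
        refine (Run.forLoop hl₁ (fun i s' => Frame h L.length s s' ∧
          acc (n ^ k + 1) h s' = acc (n ^ k + 1) h s₁ + (-1) ^ (L.length + 1) *
            ((∑ E ∈ range i with Extends h k rc L E,
              (freeSets n k h mc rc (E :: L)).card : ℕ) : ZMod (n ^ k + 1)))
          (Nat.zero_le _) (by have := hW.m_lt; omega) (hW.cell_lt (by omega)) (Ev.lit (by omega))
          ⟨hf₁.trans Frame.write_counter, by rw [acc_write_counter]; simp⟩
          (fun i s' hl' _ _ _ hI' => Ev.limit hW hl' (hI'.1.holds hH).edges (hI'.1.holds hH).chosen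
            hC.len) (T := fun E => (extendsE h k L.length).cost + 1 + (1 +
              if Extends h k rc L E then treeCost h k mc rc X c₂ d (E :: L) else 0)) ?_).mono ?_ ?_
        · rintro E s' hl' - hE hcell ⟨hf', ha'⟩
          have hH' := hf'.holds hH
          have hCE : Ctx W n m mc h k rc (E :: L) :=
            ⟨hW, hC.data, hC.mc_le, by
              simp only [List.mem_cons, forall_eq_or_imp]
              exact ⟨hE.trans_le hlim, hC.lt⟩, by rw [List.length_cons]; omega⟩
          -- The loop counter is the cell of the next chosen edge, so running the loop already puts
          -- `E` at the head of the list.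
          have hHE : Holds h n m mc rc (E :: L) s' := ⟨hH'.edges, hcell, hH'.chosen⟩
          have hcE := Ev.coverCard hCE hl' hHE
          have hext : EvP W s' (extendsE h k L.length) (Extends h k rc L E) :=
            (EvP.le h1W (Ev.add (Ev.coverCard hC hl' hH') (Ev.lit (by omega)) (by omega)) hcE).and
              (EvP.le h1W hcE (Ev.lit (by omega)))
          refine Run.ite hext ?_ ?_
          · intro hx
            rw [ind_ne_zero] at hx
            rw [if_pos hx]
            refine (hrec (List.length_cons ..) hCE hMW hl' hHE hx.2 ?_ ?_ hne).mono
              (by linarith) ?_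
            · have := hx.1
              rw [List.length_cons]
              omega
            · have := hx.1
              omega
            · rintro s'' - ⟨h5, h6⟩
              refine ⟨by rw [h5.2 _ (by omega), hcell],
                hf'.trans ((h5.mono (by omega)).trans Frame.write_counter), ?_⟩
              rw [acc_write_counter, h6, ha', range_add_one, filter_insert, if_pos hx,
                sum_insert (by simp)]
              push_cast
              ring
          · intro hx
            rw [ind_eq_zero] at hx
            rw [if_neg hx]
            refine Run.skip hl' (by linarith) ⟨hcell, hf'.trans Frame.write_counter, ?_⟩
            rw [acc_write_counter, ha', range_add_one, filter_insert, if_neg hx]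
        · have hsum : ∑ i ∈ Ico 0 (limit mc L), ((extendsE h k L.length).cost + 1 + (1 +
              if Extends h k rc L i then treeCost h k mc rc X c₂ d (i :: L) else 0) +
              (((limitE h L.length).cost : ℝ) + 10)) ≤ ∑ E ∈ range (limit mc L),
              (c + if Extends h k rc L E then treeCost h k mc rc X c d (E :: L) else 0) := by
            rw [← range_eq_Ico]
            refine sum_le_sum fun E _ => ?_
            have := hterm E
            linarith
          simp only [Expr.cost]
          push_cast
          linarith
        · rintro s' - ⟨-, hf', ha'⟩
          refine ⟨hf', ?_⟩
          rw [ha', ha₁, hmain]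
          push_cast
          ring
      -- With fewer than three missing vertices the loop would find nothing, and its length need not
      -- be covered by the bound for this node; so it is skipped.
      · intro hcond
        rw [ind_eq_zero] at hcond
        rw [if_neg hcond]
        refine Run.skip hl₁ ?_ ⟨hf₁, ?_⟩
        · have : (0 : ℝ) ≤ (limitE h L.length).cost := by positivity
          linarith
        · rw [ha₁, hmain, filter_false_of_mem, sum_empty, add_zero]
          intro E _ hE
          have := hE.1
          have := hE.2
          omega
      · linarith
    · rw [treeCost]
      have h5 := mul_le_mul_of_nonneg_left hXq hc₃
      have h6 : 0 ≤ (c₂ + c₄) * X ^ ((k - u + 2) / 3) := by positivity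
      rw [hc] at *
      linarith

end

/-! ### Copying the edges and building the table -/

/-- The edges of arity `i` in the input, padded by their first vertex. -/
def inputEdges (s : Store) (i : ℕ) : List (ℕ → ℕ) :=
  (List.range (s 1 i)).map fun j r => s i (j * i + if r < i then r else 0)

/-- The store contains the input and a list of copied edges. -/
structure Copied (h n mc : ℕ) (s₀ : Store) (R : List (ℕ → ℕ)) (s : Store) : Prop where
  input : ∀ a ≤ h, s a = s₀ a
  n_eq : s (h + 1) 0 = n
  m_eq : s (h + 1) 1 = R.length
  mc_eq : s (h + 1) 2 = mc
  pos_eq : s (h + 1) 3 = 0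
  neg_eq : s (h + 1) 4 = 0
  edges : ∀ J < R.length, ∀ r < h, s (h + 2) (J * h + r) = R.getD J 0 r

theorem Copied.congr {h n mc : ℕ} {s₀ s s' : Store} {R : List (ℕ → ℕ)}
    (hc : Copied h n mc s₀ R s) (hs : SameOffCounters h s s') : Copied h n mc s₀ R s' where
  input a ha := by rw [← hc.input a ha]; exact funext fun i => hs a i (by omega)
  n_eq := by rw [hs _ _ (by omega), hc.n_eq]
  m_eq := by rw [hs _ _ (by omega), hc.m_eq]
  mc_eq := by rw [hs _ _ (by omega), hc.mc_eq]
  pos_eq := by rw [hs _ _ (by omega), hc.pos_eq]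
  neg_eq := by rw [hs _ _ (by omega), hc.neg_eq]
  edges J hJ r hr := by rw [hs _ _ (by omega), hc.edges J hJ r hr]

/-- Copy one edge of arity `i`. -/
def copyEdge (h i : ℕ) : Prog :=
  .seq (forLoop (h + 1) 6 (.lit 0) (.lit h)
      (.set (h + 2) (addE (mulE (cell (h + 1) 1) (.lit h)) (cell (h + 1) 6))
        (.get i (addE (mulE (cell (h + 1) 5) (.lit i))
          (mulE (ltE (cell (h + 1) 6) (.lit i)) (cell (h + 1) 6))))))
    (.set (h + 1) (.lit 1) (addE (cell (h + 1) 1) (.lit 1)))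

/-- Copy all edges of arity `i`. -/
def copyEdges (h i : ℕ) : Prog :=
  forLoop (h + 1) 5 (.lit 0) (cell 1 i) (copyEdge h i)

/-- Copy the edges of those arities in a list that satisfy a condition. -/
def copyAll (h : ℕ) (cond : ℕ → Expr) : List ℕ → Prog
  | [] => .skip
  | i :: l => .seq (.ite (cond i) (copyEdges h i) .skip) (copyAll h cond l)

/-- Enter all edges into the table. -/
def buildTable (h : ℕ) : Prog :=
  forLoop (h + 1) 5 (.lit 0) (cell (h + 1) 1)
    (.set (h + 3) (keyE (nE h) (edgeE h (cell (h + 1) 5))) (cell (h + 1) 5))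

section

variable {W n m mc h k : ℕ} {s₀ s : Store} {R : List (ℕ → ℕ)}

theorem Run.copyEdge (hW : Words W n m h k) (hs : AllLt W s) (hc : Copied h n mc s₀ R s) {i j : ℕ}
    (hi : i ≤ h) (hj : s (h + 1) 5 = j) (hji : j * i + i < W) (hR : R.length < m) :
    Run W (copyEdge h i) s (h * 60 + 60) (fun s' => s' (h + 1) 5 = j ∧
      Copied h n mc s₀ (R ++ [fun r => s₀ i (j * i + if r < i then r else 0)]) s') := by
  have hk := hW.k_lt
  have hm := hW.m_lt
  have hhW : h + 2 < W := by
    have := hW.const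
    have : h + 2 ≤ (k + 2) * (h + 2) := Nat.le_mul_of_pos_left _ (by omega)
    omega
  -- Cells of the new edge differ from the cells of all edges copied before.
  have hoff : ∀ J < R.length, ∀ r < h, ∀ r' < h, J * h + r ≠ R.length * h + r' := by
    intro J hJ r hr r' hr' he
    exact hJ.ne (index_inj hr hr' he).1
  refine (Run.seq (Run.forLoop hs (fun x s' => s' (h + 1) 5 = j ∧ Copied h n mc s₀ R s' ∧
      ∀ r < x, s' (h + 2) (R.length * h + r) = s₀ i (j * i + if r < i then r else 0))
      (Nat.zero_le h) (by omega) (by omega) (Ev.lit (by omega)) ?_ ?_ (T := fun _ => 21) ?_)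
      (T₂ := 10) ?_).mono ?_ fun _ _ hh => hh
  · exact ⟨by rw [write_apply, if_neg (by omega), hj],
      hc.congr (sameOffCounters_write _ _ (.inr rfl) _), by simp⟩
  · intro x s' hl _ _ _ _
    exact Ev.lit (by omega)
  · rintro x s' hl - hx h6 ⟨h5, hc', hx'⟩
    have hidx := hW.index_lt hR.le hx
    have e6 : Ev W s' (cell (h + 1) 6) x := (Ev.cell hl (by omega)).congr h6
    have e5 : Ev W s' (cell (h + 1) 5) j := (Ev.cell hl (by omega)).congr h5
    have e1 : Ev W s' (cell (h + 1) 1) R.length := (Ev.cell hl (by omega)).congr hc'.m_eq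
    -- Multiplying the position by the truth value of `x < i` pads the edge with its vertex at
    -- position `0`, without a branch.
    have hval : ind (x < i) * x = if x < i then x else 0 := by
      unfold ind; split_ifs <;> simp
    have hlt : (if x < i then x else 0) ≤ i := by split_ifs <;> omega
    refine Run.set hl (Ev.add (Ev.mul e1 (Ev.lit (by omega)) (by omega)) e6 hidx)
      (Ev.get hl (Ev.add (Ev.mul e5 (Ev.lit (by omega)) (by omega)) (Ev.mul
        (EvP.lt (by omega) e6 (Ev.lit (by omega))) e6 ?_) ?_)) ?_ ?_
    · rw [hval]; omega
    · rw [hval]; omega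
    · simp only [addE, mulE, ltE, Expr.cost]
      norm_num
    · rw [hval, hc'.input i hi]
      refine ⟨by rw [write_apply, if_neg (by omega), h6],
        by rw [write_apply, if_neg (by omega), write_apply, if_neg (by omega), h5],
        Copied.congr ?_ (sameOffCounters_write _ _ (.inr rfl) _), ?_⟩
      · exact
          { input := fun a ha => by
              rw [← hc'.input a ha]; exact funext fun b => by rw [write_apply, if_neg (by omega)]
            n_eq := by rw [write_apply, if_neg (by omega), hc'.n_eq]
            m_eq := by rw [write_apply, if_neg (by omega), hc'.m_eq]
            mc_eq := by rw [write_apply, if_neg (by omega), hc'.mc_eq]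
            pos_eq := by rw [write_apply, if_neg (by omega), hc'.pos_eq]
            neg_eq := by rw [write_apply, if_neg (by omega), hc'.neg_eq]
            edges := fun J hJ r hr => by
              rw [write_apply, if_neg (fun hh => hoff J hJ r hr x hx hh.2), hc'.edges J hJ r hr] }
      · intro r hr
        rw [write_apply, if_neg (by omega), write_apply]
        by_cases hrx : r = x
        · rw [if_pos ⟨rfl, by rw [hrx]⟩, hrx]
        · rw [if_neg (by omega), hx' r (by omega)]
  · rintro s' hl ⟨-, h5, hc', hx'⟩
    refine Run.set hl (Ev.lit (by omega)) (Ev.add ((Ev.cell hl (by omega)).congr hc'.m_eq)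
      (Ev.lit (by omega)) (by omega)) (by simp only [addE, Expr.cost]; norm_num) ?_
    refine ⟨by rw [write_apply, if_neg (by omega), h5], ?_⟩
    exact
      { input := fun a ha => by
          rw [← hc'.input a ha]; exact funext fun b => by rw [write_apply, if_neg (by omega)]
        n_eq := by rw [write_apply, if_neg (by omega), hc'.n_eq]
        m_eq := by rw [write_same, List.length_append, List.length_singleton]
        mc_eq := by rw [write_apply, if_neg (by omega), hc'.mc_eq]
        pos_eq := by rw [write_apply, if_neg (by omega), hc'.pos_eq]
        neg_eq := by rw [write_apply, if_neg (by omega), hc'.neg_eq]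
        edges := fun J hJ r hr => by
          rw [write_apply, if_neg (by omega)]
          rw [List.length_append, List.length_singleton] at hJ
          rcases Nat.lt_succ_iff_lt_or_eq.1 hJ with hJ' | rfl
          · rw [hc'.edges J hJ' r hr, List.getD_append _ _ _ _ hJ']
          · rw [hx' r hr, List.getD_append_right _ _ _ _ le_rfl]
            simp }
  · simp only [sum_const, Nat.card_Ico, Expr.cost, nsmul_eq_mul, Nat.sub_zero]
    push_cast
    have : (0 : ℝ) ≤ h := by positivity
    linarith

theorem Run.copyEdges (hW : Words W n m h k) (hs : AllLt W s) (hc : Copied h n mc s₀ R s) {i : ℕ}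
    (hi : i ≤ h) (hR : R.length + s₀ 1 i ≤ m) (h1 : 1 ≤ h) :
    Run W (copyEdges h i) s ((h * 60 + 80) * (s₀ 1 i + 1))
      (Copied h n mc s₀ (R ++ inputEdges s₀ i)) := by
  have hk := hW.k_lt
  have hm := hW.m_lt
  have hsz := hW.size
  have hhW : h + 2 < W := by
    have := hW.const
    have : h + 2 ≤ (k + 2) * (h + 2) := Nat.le_mul_of_pos_left _ (by omega)
    omega
  refine (Run.forLoop hs (fun x s' => Copied h n mc s₀ (R ++ (List.range x).map
      fun j r => s₀ i (j * i + if r < i then r else 0)) s') (Nat.zero_le (s₀ 1 i)) (by omega)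
      (by omega) (Ev.lit (by omega)) ?_ ?_ (T := fun _ => h * 60 + 60) ?_).mono ?_ ?_
  · simpa using hc.congr (sameOffCounters_write _ _ (.inl rfl) _)
  · intro x s' hl _ _ _ hc'
    exact (Ev.cell hl (by omega)).congr (by rw [hc'.input 1 h1])
  · intro j s' hl _ hj h5 hc'
    have hji : j * i + i < W := by
      have : (j + 1) * i ≤ m * h := Nat.mul_le_mul (by omega) hi
      nlinarith
    refine (Run.copyEdge hW hl hc' hi h5 hji (by simp; omega)).mono le_rfl ?_
    rintro s'' - ⟨h6, h7⟩
    refine ⟨h6, ?_⟩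
    rw [List.range_succ, List.map_append, ← List.append_assoc]
    exact h7.congr (sameOffCounters_write _ _ (.inl rfl) _)
  · simp only [sum_const, Nat.card_Ico, Expr.cost, nsmul_eq_mul, Nat.sub_zero]
    push_cast
    have h2 : (0 : ℝ) ≤ h := by positivity
    have h3 : (0 : ℝ) ≤ s₀ 1 i := by positivity
    nlinarith
  · rintro s' - ⟨-, h2⟩
    exact h2

open Classical in
theorem Run.copyAll (hW : Words W n m h k) (hs : AllLt W s) (hc : Copied h n mc s₀ R s)
    (cond : ℕ → Expr) (P : ℕ → Prop) (l : List ℕ) (hl : ∀ i ∈ l, i ≤ h ∧ 1 ≤ h)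
    (hP : ∀ i ∈ l, ∀ R s, AllLt W s → Copied h n mc s₀ R s → EvP W s (cond i) (P i))
    (hR : (R ++ (l.filter (P ·)).flatMap (inputEdges s₀)).length ≤ m) :
    Run W (copyAll h cond l) s (1 + (l.map fun i => ((cond i).cost + 1 : ℝ) +
        (h * 60 + 80) * (if P i then (s₀ 1 i : ℝ) + 1 else 1)).sum)
      (Copied h n mc s₀ (R ++ (l.filter (P ·)).flatMap (inputEdges s₀))) := by
  induction l generalizing s R with
  | nil => exact Run.skip hs (by simp) (by simpa using hc)
  | cons i l ih =>
    simp only [List.mem_cons, forall_eq_or_imp] at hl hP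
    have h0 : (0 : ℝ) ≤ h := by positivity
    by_cases hi : P i
    · rw [List.filter_cons_of_pos (by simpa using hi), List.flatMap_cons,
        ← List.append_assoc] at hR ⊢
      refine (Run.seq (Run.ite (hP.1 R s hs hc) (fun _ => Run.copyEdges hW hs hc hl.1.1 ?_ hl.1.2)
        fun hh => absurd hi (ind_eq_zero.1 hh))
        (fun s' hl' hc' => ih hl' hc' hl.2 hP.2 hR)).mono ?_ fun _ _ hh => hh
      · simp only [List.length_append, inputEdges, List.length_map, List.length_range] at hR
        omega
      · rw [List.map_cons, List.sum_cons, if_pos hi]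
        linarith
    · rw [List.filter_cons_of_neg (by simpa using hi)] at hR ⊢
      refine (Run.seq (Run.ite (hP.1 R s hs hc) (fun hh => absurd (ind_ne_zero.1 hh) hi)
        (fun _ => Run.skip hs le_rfl hc))
        (fun s' hl' hc' => ih hl' hc' hl.2 hP.2 hR)).mono ?_ fun _ _ hh => hh
      rw [List.map_cons, List.sum_cons, if_neg hi]
      linarith

theorem Run.buildTable (hW : Words W n m h k) (hs : AllLt W s) (hc : Copied h n mc s₀ R s)
    (hR : R.length = m) (hE : EdgeData n m h (R.getD · 0)) :
    Run W (buildTable h) s (((keyE (nE h) (edgeE h (cell (h + 1) 5))).cost + 30) * (m + 1))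
      (fun s' => HoldsEdges h n m mc (R.getD · 0) s' ∧ s' (h + 1) 3 = 0 ∧ s' (h + 1) 4 = 0) := by
  have hk := hW.k_lt
  have hm := hW.m_lt
  refine (Run.forLoop hs (fun x s' =>
      (∀ a i, a ≠ h + 3 → ¬ (a = h + 1 ∧ i = 5) → s' a i = s a i) ∧ ∀ J < x,
        s' (h + 3) (Nat.ofDigits n (edgeList h (R.getD · 0) J)) = J) (Nat.zero_le m) (by omega)
      (by omega) (Ev.lit (by omega)) ?_ ?_ (T := fun _ =>
        (keyE (nE h) (edgeE h (cell (h + 1) 5))).cost + 3) ?_).mono ?_ ?_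
  · exact ⟨fun a i ha hai => by rw [write_apply, if_neg hai], by simp⟩
  · rintro x s' hl - - - ⟨h1, -⟩
    exact (Ev.cell hl (by omega)).congr (by rw [h1 _ _ (by omega) (by omega), hc.m_eq, hR])
  · rintro J s' hl - hJ h5 ⟨h1, h2⟩
    have e5 : Ev W s' (cell (h + 1) 5) J := (Ev.cell hl (by omega)).congr h5
    have en : Ev W s' (nE h) n :=
      (Ev.cell hl (by omega)).congr (by rw [h1 _ _ (by omega) (by omega), hc.n_eq])
    obtain ⟨hf, hv⟩ := Ev.edge hW hl e5 hJ.le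
    have hv' : vals s' (edgeE h (cell (h + 1) 5)) = edgeList h (R.getD · 0) J := by
      rw [hv, edgeList]
      refine List.map_congr_left fun r hr => ?_
      rw [h1 _ _ (by omega) (by omega), hc.edges J (by omega) r (List.mem_range.1 hr)]
    have hlen : (edgeE h (cell (h + 1) 5)).length = h := by simp [edgeE]
    refine Run.set hl (Ev.key en hf (by rw [hv']; exact hE.lt J hJ) hE.pos
      (by rw [hlen]; exact hW.key)) e5 ?_ ?_
    · simp only [Expr.cost]; push_cast; linarith
    · rw [hv']
      refine ⟨by rw [write_apply, if_neg (by omega), h5], fun a i ha hai => ?_, fun J' hJ' => ?_⟩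
      · rw [write_apply, if_neg hai, write_apply, if_neg (fun hh => ha hh.1), h1 a i ha hai]
      · rw [write_apply, if_neg (by omega), write_apply]
        have hJ'm : J' < m := by omega
        -- Equal keys mean equal lists, hence equal edges; so no later entry overwrites an earlier
        -- one.
        split_ifs with hh
        · exact hE.inj J hJ J' hJ'm (ofDigits_inj (by simp [edgeList]) (hE.lt J hJ)
            (hE.lt J' hJ'm) hh.2.symm)
        · refine h2 J' ?_
          rcases Nat.lt_succ_iff_lt_or_eq.1 hJ' with h3 | rfl
          · exact h3
          · exact absurd ⟨rfl, rfl⟩ hh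
  · simp only [sum_const, Nat.card_Ico, Expr.cost, nsmul_eq_mul, Nat.sub_zero]
    push_cast
    have h2 : (0 : ℝ) ≤ (keyE (nE h) (edgeE h (cell (h + 1) 5))).cost := by positivity
    have h3 : (0 : ℝ) ≤ m := by positivity
    nlinarith
  · rintro s' - ⟨-, h1, h2⟩
    refine ⟨⟨?_, ?_, ?_, ?_, h2⟩, ?_, ?_⟩
    · rw [h1 _ _ (by omega) (by omega), hc.n_eq]
    · rw [h1 _ _ (by omega) (by omega), hc.m_eq, hR]
    · rw [h1 _ _ (by omega) (by omega), hc.mc_eq]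
    · intro J hJ r hr
      rw [h1 _ _ (by omega) (by omega), hc.edges J (by omega) r hr]
    · rw [h1 _ _ (by omega) (by omega), hc.pos_eq]
    · rw [h1 _ _ (by omega) (by omega), hc.neg_eq]

end

/-! ### Enumeration above the large edges, and the output -/

/-- Subtract the number of sets whose first edge is one of the edges after the first `mc`. -/
def countLarge (h k : ℕ) : Prog :=
  forLoop (h + 1) 11 (cell (h + 1) 2) (cell (h + 1) 1)
    (dispatch (coverCardE h 1) (fun u => countFree h k 1 (k - u)) (k + 1))

/-- Whether the accumulators differ. -/
def outputE (h k : ℕ) : Expr :=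
  notE (eqE (modE (cell (h + 1) 3) (modulusE h k)) (modE (cell (h + 1) 4) (modulusE h k)))

section

variable {W n m mc h k : ℕ} {rc : ℕ → ℕ → ℕ} {s : Store}

theorem cover_singleton (E : ℕ) : cover h rc [E] = edge h rc E := by
  rw [cover_cons, cover, coverList, List.toFinset_nil, union_empty]

/-- For the one-element list `[E]` the limit is `E`, so `countFree` counts the sets whose first edge
is `E`, and `t = 1` gives the minus sign. Cell `11` is both the loop counter and the place of the
first chosen edge. -/
theorem Run.countLarge (h k : ℕ) : ∃ c : ℝ, 0 ≤ c ∧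
    ∀ {W n m mc : ℕ} {rc : ℕ → ℕ → ℕ} {s : Store}, Ctx W n m mc h k rc [] → AllLt W s →
      Holds h n m mc rc [] s → (∀ J < m, (edge h rc J).card ≤ k) →
      Run W (countLarge h k) s (c * (∑ E ∈ Ico mc m, (n : ℝ) ^ (k - (edge h rc E).card) + 1))
        (fun s' => Frame h 0 s s' ∧ acc (n ^ k + 1) h s' = acc (n ^ k + 1) h s -
          ((∑ E ∈ Ico mc m, (above n k (edge h rc E) (EdgeFree h rc E)).card : ℕ) :
            ZMod (n ^ k + 1))) := by
  set f : ℕ → ℝ := fun r => (accumulateE h k 1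
        (freeE h 1 (digitsE (nE h) r (cell (h + 1) 5)))).cost +
        2 * (powE (nE h) r).cost + 30
  set c₁ : ℝ := ∑ r ∈ range (k + 1), f r
  have hf : ∀ r, 0 ≤ f r := fun r => by positivity
  have hc₁ : 0 ≤ c₁ := sum_nonneg fun r _ => hf r
  set c₂ : ℝ := (k + 1 : ℕ) * ((coverCardE h 1).cost + 3)
  have hc₂ : 0 ≤ c₂ := by positivity
  refine ⟨c₁ + c₂ + 20, by positivity, ?_⟩
  intro W n m mc rc s hC hs hH hcard
  have hW := hC.words
  have hkW := hW.k_lt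
  have hmW := hW.m_lt
  refine (Run.forLoop hs (fun i s' => Frame h 0 s s' ∧
      acc (n ^ k + 1) h s' = acc (n ^ k + 1) h s - ((∑ E ∈ Ico mc i,
        (above n k (edge h rc E) (EdgeFree h rc E)).card : ℕ) : ZMod (n ^ k + 1)))
      hC.mc_le (by omega) (by omega) ((Ev.cell hs (by omega)).congr hH.edges.mc_eq) ?_ ?_
      (T := fun E => c₁ * (n : ℝ) ^ (k - (edge h rc E).card) + c₂) ?_).mono ?_ ?_
  · exact ⟨Frame.write_counter (t := 0), by rw [acc_write_counter (t := 0)]; simp⟩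
  · rintro i s' hl - - - ⟨h1, -⟩
    exact (Ev.cell hl (by omega)).congr (by rw [h1.2 _ (by omega), hH.edges.m_eq])
  · rintro E s' hl hE hEm hcell ⟨hf', ha'⟩
    have hCE : Ctx W n m mc h k rc [E] := ⟨hW, hC.data, hC.mc_le, by simpa using hEm, by simp⟩
    have hHE : Holds h n m mc rc [E] s' := ⟨(Frame.holds (L := []) hf' hH).edges, hcell, trivial⟩
    have hu := Ev.coverCard hCE hl hHE
    rw [cover_singleton] at hu
    have hk := hcard E hEm
    have hrun := Run.countFree (r := k - (edge h rc E).card) hCE hl hHE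
      (by rw [cover_singleton]; omega)
    refine (Run.dispatch hW.one_lt hu (by omega) (by omega) (hrun.mono (?_ : _ ≤
      c₁ * (n : ℝ) ^ (k - (edge h rc E).card)) ?_)).mono le_rfl fun _ _ hh => hh
    · exact mul_le_mul_of_nonneg_right
        (single_le_sum (f := f) (fun r _ => hf r) (mem_range.2 (by omega))) (by positivity)
    · rintro s'' - ⟨h1, h2⟩
      refine ⟨by rw [h1.2 _ (by simp), hcell],
        hf'.trans ((h1.mono (Nat.zero_le _)).trans (Frame.write_counter (t := 0))), ?_⟩
      rw [acc_write_counter (t := 0), h2, ha', sum_Ico_succ_top hE, cover_singleton]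
      simp only [limit, List.length_singleton]
      push_cast
      ring
  · have hpos : ∀ E, (1 : ℝ) ≤ (n : ℝ) ^ (k - (edge h rc E).card) := fun E =>
      one_le_pow₀ (by exact_mod_cast hC.data.pos)
    have hle : ∑ i ∈ Ico mc m, (c₁ * (n : ℝ) ^ (k - (edge h rc i).card) + c₂ +
        (((cell (h + 1) 1).cost : ℝ) + 10)) ≤
        ∑ i ∈ Ico mc m, (c₁ + c₂ + 20) * (n : ℝ) ^ (k - (edge h rc i).card) := by
      refine sum_le_sum fun E _ => ?_
      simp only [Expr.cost]
      push_cast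
      nlinarith [hpos E]
    rw [← mul_sum] at hle
    simp only [Expr.cost] at hle ⊢
    push_cast at hle ⊢
    linarith
  · rintro s' - ⟨-, h1, h2⟩
    exact ⟨h1, h2⟩

/-- With no chosen edge the pair conditions are no restriction: `{a, b} ⊆ S`, and `S` contains no
edge before `mc`. -/
theorem freeSets_nil : freeSets n k h mc rc [] = above n k ∅ (EdgeFree h rc mc) := by
  ext S
  rw [freeSets, mem_above, mem_above]
  refine and_congr Iff.rfl (and_congr Iff.rfl (and_congr Iff.rfl ?_))
  refine ⟨And.left, fun hS => ⟨hS, fun a ha b hb J hJ hJS => hS J hJ (hJS.trans ?_)⟩⟩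
  simp [cover, coverList, insert_subset_iff, ha, hb]

theorem card_above_le (U : Finset ℕ) (P : Finset ℕ → Prop) : (above n k U P).card ≤ n ^ k := by
  classical
  refine (card_le_card (filter_subset _ _)).trans ?_
  rw [card_powersetCard, card_range]
  exact Nat.choose_le_pow n k

/-- The accumulators agree modulo `n ^ k + 1` iff the modulus divides `N`, and for `N ≤ n ^ k` this
means `N = 0`. -/
theorem Run.output (hC : Ctx W n m mc h k rc []) (hs : AllLt W s) (hH : Holds h n m mc rc [] s)
    {N : ℕ} (hN : N ≤ n ^ k) (hacc : acc (n ^ k + 1) h s = N) :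
    Run W (.set 0 (.lit 0) (outputE h k)) s ((outputE h k).cost + 2) (fun s' => s' 0 0 = 1 ↔ 0 < N) := by
  have hW := hC.words
  have hk := hW.k_lt
  have hQ := Ev.modulus hW hs hH.edges
  refine Run.set hs (Ev.lit (by omega)) (EvP.not hW.one_lt (EvP.eq hW.one_lt
    (Ev.mod (Ev.cell hs (by omega)) hQ) (Ev.mod (Ev.cell hs (by omega)) hQ))) ?_ ?_
  · simp only [Expr.cost]; push_cast; linarith
  · rw [write_same]
    have h1 : s (h + 1) 3 % (n ^ k + 1) = s (h + 1) 4 % (n ^ k + 1) ↔ N = 0 := by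
      rw [← ZMod.natCast_eq_natCast_iff', ← sub_eq_zero, ← acc, hacc,
        ZMod.natCast_eq_zero_iff]
      exact ⟨fun hd => Nat.eq_zero_of_dvd_of_lt hd (by omega), fun h0 => h0 ▸ dvd_zero _⟩
    rw [h1, ind]
    by_cases h2 : N = 0
    · simp [h2]
    · simp [h2, Nat.pos_of_ne_zero h2]

end

/-! ### The listed edges as edges of the hypergraph -/

/-- The vertices of a listed edge. -/
def verts (h : ℕ) (f : ℕ → ℕ) : Finset ℕ := (range h).image f

section

variable {n h : ℕ} {H : Hypergraph ℕ} {s : Store}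

theorem verts_coe {i j : ℕ} (hi : 1 ≤ i) (hih : i ≤ h) :
    (verts h (fun r => s i (j * i + if r < i then r else 0)) : Set ℕ) =
      {v | ∃ r < i, v = s i (j * i + r)} := by
  ext v
  simp only [verts, coe_image, coe_range, Set.mem_image, Set.mem_Iio, Set.mem_ofPred_eq]
  constructor
  · rintro ⟨r, -, rfl⟩
    exact ⟨if r < i then r else 0, by split_ifs <;> omega, rfl⟩
  · rintro ⟨r, hr, rfl⟩
    exact ⟨r, by omega, by rw [if_pos hr]⟩

theorem finite_edgesOfArity (hV : H.vertexSet = Set.Iio n) (i : ℕ) : (H.edgesOfArity i).Finite := by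
  refine (Set.finite_Iio n).finite_subsets.subset fun e he => ?_
  rw [← hV]
  exact H.subset_vertexSet_of_mem_edgeSet' he.1

variable (hI : H.IsInput n h s)
include hI

theorem mem_inputEdges {i : ℕ} (hi : 2 ≤ i) (hih : i ≤ h) {f : ℕ → ℕ}
    (hf : f ∈ inputEdges s i) : (verts h f : Set ℕ) ∈ H.edgesOfArity i := by
  simp only [inputEdges, List.mem_map, List.mem_range] at hf
  obtain ⟨j, hj, rfl⟩ := hf
  obtain ⟨h1, h2⟩ := hI.2 i (Finset.mem_Icc.2 ⟨hi, hih⟩)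
  rw [verts_coe (by omega) hih]
  exact h2.mapsTo (by rw [Set.mem_Iio, ← h1]; exact hj)

theorem card_verts {i : ℕ} (hi : 2 ≤ i) (hih : i ≤ h) {f : ℕ → ℕ}
    (hf : f ∈ inputEdges s i) : (verts h f).card = i := by
  have := (mem_inputEdges hI hi hih hf).2
  rwa [Set.ncard_coe_finset] at this

theorem exists_inputEdge {i : ℕ} (hi : 2 ≤ i) (hih : i ≤ h) {e : Set ℕ}
    (he : e ∈ H.edgesOfArity i) : ∃ f ∈ inputEdges s i, (verts h f : Set ℕ) = e := by
  obtain ⟨h1, h2⟩ := hI.2 i (Finset.mem_Icc.2 ⟨hi, hih⟩)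
  obtain ⟨j, hj, rfl⟩ := h2.surjOn he
  rw [Set.mem_Iio, ← h1] at hj
  refine ⟨_, List.mem_map.2 ⟨j, List.mem_range.2 hj, rfl⟩, ?_⟩
  rw [verts_coe (by omega) hih]

/-- Within one arity the input lists each edge once; edges of different arities differ in size. -/
theorem nodup_verts {l : List ℕ} (hl : l.Nodup) (hlh : ∀ i ∈ l, 2 ≤ i ∧ i ≤ h) :
    ((l.flatMap (inputEdges s)).map (verts h)).Nodup := by
  rw [List.map_flatMap, List.nodup_flatMap]
  constructor
  · intro i hi
    obtain ⟨h1, h2⟩ := hI.2 i (Finset.mem_Icc.2 (hlh i hi))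
    rw [inputEdges, List.map_map]
    refine List.nodup_range.map_on fun j hj j' hj' he => h2.injOn ?_ ?_ ?_
    · rw [Set.mem_Iio, ← h1]; exact List.mem_range.1 hj
    · rw [Set.mem_Iio, ← h1]; exact List.mem_range.1 hj'
    · have := congrArg (fun F : Finset ℕ => (F : Set ℕ)) he
      simp only [Function.comp] at this
      rwa [verts_coe (by have := hlh i hi; omega) (hlh i hi).2,
        verts_coe (by have := hlh i hi; omega) (hlh i hi).2] at this
  · refine List.Pairwise.imp_of_mem ?_ hl
    intro i i' hi hi' hne
    rw [Function.onFun, List.disjoint_left]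
    intro e he he'
    obtain ⟨f, hf, rfl⟩ := List.mem_map.1 he
    obtain ⟨f', hf', hff⟩ := List.mem_map.1 he'
    have h1 := card_verts hI (hlh i hi).1 (hlh i hi).2 hf
    have h2 := card_verts hI (hlh i' hi').1 (hlh i' hi').2 hf'
    rw [hff] at h2
    exact hne (h1.symm.trans h2)

/-- The order by arity is what later bounds the number of edges before a given one. -/
theorem sorted_verts {l : List ℕ} (hl : l.Pairwise (· ≤ ·)) (hlh : ∀ i ∈ l, 2 ≤ i ∧ i ≤ h) :
    (l.flatMap (inputEdges s)).Pairwise fun f f' => (verts h f).card ≤ (verts h f').card := by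
  rw [List.pairwise_flatMap]
  constructor
  · intro i hi
    refine List.pairwise_of_forall_mem_list fun f hf f' hf' => ?_
    rw [card_verts hI (hlh i hi).1 (hlh i hi).2 hf, card_verts hI (hlh i hi).1 (hlh i hi).2 hf']
  · refine List.Pairwise.imp_of_mem ?_ hl
    intro i i' hi hi' hle f hf f' hf'
    rwa [card_verts hI (hlh i hi).1 (hlh i hi).2 hf, card_verts hI (hlh i' hi').1 (hlh i' hi').2 hf']

omit hI in
theorem getD_mem {R : List (ℕ → ℕ)} {J : ℕ} (hJ : J < R.length) : R.getD J 0 ∈ R := by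
  rw [List.getD_eq_getElem _ _ hJ]
  exact List.getElem_mem hJ

theorem getD_flatMap {l : List ℕ} (hlh : ∀ i ∈ l, 2 ≤ i ∧ i ≤ h) {J : ℕ}
    (hJ : J < (l.flatMap (inputEdges s)).length) :
    (edge h ((l.flatMap (inputEdges s)).getD · 0) J).card ∈ l ∧
      (edge h ((l.flatMap (inputEdges s)).getD · 0) J : Set ℕ) ∈
        H.edgesOfArity (edge h ((l.flatMap (inputEdges s)).getD · 0) J).card := by
  obtain ⟨i, hi, hf⟩ := List.mem_flatMap.1 (getD_mem hJ)
  have hc := card_verts hI (hlh i hi).1 (hlh i hi).2 hf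
  have hm := mem_inputEdges hI (hlh i hi).1 (hlh i hi).2 hf
  have he : edge h ((l.flatMap (inputEdges s)).getD · 0) J =
      verts h ((l.flatMap (inputEdges s)).getD J 0) := rfl
  rw [he, hc]
  exact ⟨hi, hm⟩

theorem edge_injective {l : List ℕ} (hl : l.Nodup) (hlh : ∀ i ∈ l, 2 ≤ i ∧ i ≤ h) {J J' : ℕ}
    (hJ : J < (l.flatMap (inputEdges s)).length) (hJ' : J' < (l.flatMap (inputEdges s)).length)
    (he : edge h ((l.flatMap (inputEdges s)).getD · 0) J =
      edge h ((l.flatMap (inputEdges s)).getD · 0) J') : J = J' := by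
  have hn := nodup_verts hI hl hlh
  refine (hn.getElem_inj_iff (hi := by simpa using hJ) (hj := by simpa using hJ')).1 ?_
  rw [List.getElem_map, List.getElem_map, ← List.getD_eq_getElem _ 0 hJ,
    ← List.getD_eq_getElem _ 0 hJ']
  exact he

theorem edgeData_input (hn : 1 ≤ n) (hV : H.vertexSet = Set.Iio n) {l : List ℕ} (hl : l.Nodup)
    (hlh : ∀ i ∈ l, 2 ≤ i ∧ i ≤ h) : EdgeData n (l.flatMap (inputEdges s)).length h
      ((l.flatMap (inputEdges s)).getD · 0) where
  pos := hn
  lt J hJ v hv := by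
    have h1 := H.subset_vertexSet_of_mem_edgeSet' (getD_flatMap hI hlh hJ).2.1
    rw [hV] at h1
    refine h1 ?_
    rw [mem_coe, ← edgeList_toFinset]
    exact List.mem_toFinset.2 hv
  inj J hJ J' hJ' he := by
    refine edge_injective hI hl hlh hJ hJ' ?_
    rw [← edgeList_toFinset, ← edgeList_toFinset, he]

theorem card_le_ncard (hV : H.vertexSet = Set.Iio n) {l : List ℕ} (hl : l.Nodup)
    (hlh : ∀ i ∈ l, 2 ≤ i ∧ i ≤ h) {F : Finset ℕ} {i : ℕ}
    (hF : ∀ J ∈ F, J < (l.flatMap (inputEdges s)).length ∧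
      (edge h ((l.flatMap (inputEdges s)).getD · 0) J).card = i) :
    F.card ≤ (H.edgesOfArity i).ncard := by
  rw [← Set.ncard_coe_finset]
  refine Set.ncard_le_ncard_of_injOn
    (fun J => (edge h ((l.flatMap (inputEdges s)).getD · 0) J : Set ℕ)) ?_ ?_
    (finite_edgesOfArity hV i)
  · intro J hJ
    have := (getD_flatMap hI hlh (hF J hJ).1).2
    rwa [(hF J hJ).2] at this
  · intro J hJ J' hJ' he
    exact edge_injective hI hl hlh (hF J hJ).1 (hF J' hJ').1 (coe_injective he)

/-- An edge inside a `k`-set has at most `k` vertices, so the arities up to `k` are enough. -/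
theorem edgeFree_iff {k : ℕ} (hA : H.IsArityAtMost h) {l : List ℕ}
    (hlh : ∀ i ∈ l, 2 ≤ i ∧ i ≤ h) (hlk : ∀ i, 2 ≤ i → i ≤ h → i ≤ k → i ∈ l) {S : Finset ℕ}
    (hS : S.card = k) :
    EdgeFree h ((l.flatMap (inputEdges s)).getD · 0) (l.flatMap (inputEdges s)).length S ↔
      ∀ e ∈ H.edgeSet, ¬ e ⊆ (S : Set ℕ) := by
  constructor
  · intro hE e he heS
    obtain ⟨hfin, h2, hh⟩ := hA e he
    have hk : e.ncard ≤ k := by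
      rw [← hS, ← Set.ncard_coe_finset]
      exact Set.ncard_le_ncard heS S.finite_toSet
    obtain ⟨f, hf, rfl⟩ := exists_inputEdge hI h2 hh (e := e) ⟨he, rfl⟩
    obtain ⟨J, hJ, hJf⟩ := List.mem_iff_getElem.1
      (List.mem_flatMap.2 ⟨_, hlk _ h2 hh hk, hf⟩ : f ∈ l.flatMap (inputEdges s))
    refine hE J hJ ?_
    rw [← List.getD_eq_getElem _ 0 hJ] at hJf
    rw [edge, hJf]
    exact_mod_cast heS
  · intro hE J hJ hJS
    exact hE _ (getD_flatMap hI hlh hJ).2.1 (by exact_mod_cast hJS)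

end

/-! ### Bounding the running time of the recursion -/

section

variable {h k mc m : ℕ} {rc : ℕ → ℕ → ℕ} {X Y B c : ℝ}

/-- The number of edges of arity `i` among the first `mc`. -/
def count (h mc : ℕ) (rc : ℕ → ℕ → ℕ) (i : ℕ) : ℕ := #{J ∈ range mc | (edge h rc J).card = i}

/-- `Y` dominates both the base `X` and the number of candidate edges. A child has at least three
fewer missing vertices, so its exponent is smaller by at least one, and at most `Y` children make up
for that. Each level adds at most `2 * c` to the coefficient: once for the product, once for the
overhead of the loop. The limits decrease along the recursion, so `hL` is inherited. -/
theorem treeCost_le (hc : 0 ≤ c) (hX : 1 ≤ X) (hXY : X ≤ Y) (d : ℕ) (L : List ℕ)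
    (hL : (limit mc L : ℝ) ≤ Y) : treeCost h k mc rc X c d L ≤
      c * (2 * d + 1) * Y ^ ((k - (cover h rc L).card + 2) / 3) := by
  classical
  have hY : 1 ≤ Y := hX.trans hXY
  have hpow : ∀ a : ℕ, X ^ a ≤ Y ^ a := fun a => pow_le_pow_left₀ (by linarith) hXY a
  induction d generalizing L with
  | zero =>
    rw [treeCost]
    simpa using mul_le_mul_of_nonneg_left (hpow _) hc
  | succ d ih =>
    rw [treeCost]
    set u := (cover h rc L).card with hu
    have h1 := mul_le_mul_of_nonneg_left (hpow ((k - u + 2) / 3)) hc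
    have h0 : 0 ≤ c * (2 * d + 1) := by positivity
    have hYa : 0 ≤ Y ^ ((k - u + 2) / 3) := by positivity
    have h2 : (if u + 3 ≤ k then ∑ E ∈ range (limit mc L),
        (c + if Extends h k rc L E then treeCost h k mc rc X c d (E :: L) else 0) else 0) ≤
        c * (2 * d + 2) * Y ^ ((k - u + 2) / 3) := by
      split_ifs with hk
      -- As three vertices are missing, the exponent is positive; one factor `Y` is reserved for the
      -- number of children.
      · obtain ⟨a, ha⟩ : ∃ a, (k - u + 2) / 3 = a + 1 := ⟨(k - u + 2) / 3 - 1, by omega⟩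
        have hYa1 : 1 ≤ Y ^ a := one_le_pow₀ hY
        refine (sum_le_card_nsmul _ _ (c * (2 * d + 2) * Y ^ a) fun E hE => ?_).trans ?_
        · rw [mem_range] at hE
          have hc1 : c ≤ c * Y ^ a := le_mul_of_one_le_right hc hYa1
          split_ifs with hx
          · refine (add_le_add hc1 (ih (E :: L) ?_)).trans ?_
            · have : (E : ℝ) ≤ limit mc L := by exact_mod_cast hE.le
              exact this.trans hL
            · have hle : Y ^ ((k - (cover h rc (E :: L)).card + 2) / 3) ≤ Y ^ a := by
                refine pow_le_pow_right₀ hY ?_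
                have := hx.1
                omega
              have := mul_le_mul_of_nonneg_left hle h0
              linarith
          · have : 0 ≤ c * (2 * d + 1) * Y ^ a := by positivity
            linarith
        · rw [card_range, nsmul_eq_mul, ha, pow_succ]
          have h3 : 0 ≤ c * (2 * d + 2) * Y ^ a := by positivity
          have := mul_le_mul_of_nonneg_right hL h3
          linarith
      · positivity
    push_cast
    linarith

/-- All edges before `E` have at most the arity of `E`, so that there are not too many of them. -/
theorem add_index_pow_le (hX : 1 ≤ X) (hk : 3 ∣ k)
    (hsort : ∀ J J', J ≤ J' → J' < mc → (edge h rc J).card ≤ (edge h rc J').card)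
    (h2 : ∀ J < mc, 2 ≤ (edge h rc J).card) (hXB : X ^ (k / 3) ≤ B)
    (hcount2 : (count h mc rc 2 : ℝ) ≤ X)
    (hcount : ∀ i, 3 ≤ i → i ≤ k → (count h mc rc i : ℝ) ^ ((k - i + 2) / 3 + 1) ≤ B)
    {E i : ℕ} (hE : E < mc) (hi : (edge h rc E).card = i) (hi3 : 3 ≤ i) (hik : i ≤ k) :
    (X + (E + 1)) ^ ((k - i + 2) / 3 + 1) ≤ (k : ℝ) ^ k * B := by
  set a := (k - i + 2) / 3 with ha
  have hB : 0 ≤ B := le_trans (by positivity) hXB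
  -- No edge has a single vertex, so the index `1` is free to carry the summand `X`. The sum is then
  -- at most `i` times its largest term.
  set w : ℕ → ℝ := fun j => if j = 1 then X else count h mc rc j with hw
  have hw0 : ∀ j, 0 ≤ w j := fun j => by
    simp only [hw]; split_ifs
    · linarith
    · positivity
  have hsum : X + (E + 1) ≤ ∑ j ∈ Icc 1 i, w j := by
    rw [show Icc 1 i = insert 1 (Icc 2 i) by ext j; simp only [mem_Icc, mem_insert]; omega,
      sum_insert (by simp)]
    refine add_le_add (by simp [hw]) ?_
    have h1 : (range (E + 1)).card = ∑ j ∈ Icc 2 i, #{J ∈ range (E + 1) | (edge h rc J).card = j} := by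
      refine card_eq_sum_card_fiberwise fun J hJ => ?_
      rw [mem_coe, mem_range] at hJ
      rw [mem_coe, mem_Icc]
      exact ⟨h2 J (by omega), hi ▸ hsort J E (by omega) hE⟩
    rw [card_range] at h1
    have h3 : E + 1 ≤ ∑ j ∈ Icc 2 i, count h mc rc j := by
      rw [h1]
      exact sum_le_sum fun j _ => card_le_card (filter_subset_filter _ (range_mono (by omega)))
    calc (E + 1 : ℝ) ≤ ∑ j ∈ Icc 2 i, (count h mc rc j : ℝ) := by exact_mod_cast h3
      _ = ∑ j ∈ Icc 2 i, w j := sum_congr rfl fun j hj => by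
          rw [mem_Icc] at hj
          simp only [hw]
          rw [if_neg (by omega)]
  obtain ⟨j, hj, hmax⟩ := exists_max_image (Icc 1 i) w ⟨1, by rw [mem_Icc]; omega⟩
  have hle : X + (E + 1) ≤ i * w j := by
    refine hsum.trans ((sum_le_card_nsmul _ _ _ hmax).trans ?_)
    simp
  have hak : a + 1 ≤ k := by omega
  have hwB : w j ^ (a + 1) ≤ B := by
    rw [mem_Icc] at hj
    -- For `3 ≤ i` and `3 ∣ k`, the exponent `a + 1` is at most `k / 3`.
    have hXa : X ^ (a + 1) ≤ B := (pow_le_pow_right₀ hX (by omega)).trans hXB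
    obtain rfl | rfl | hj3 : j = 1 ∨ j = 2 ∨ 3 ≤ j := by omega
    · simpa [hw] using hXa
    · refine le_trans (pow_le_pow_left₀ (hw0 2) ?_ _) hXa
      simpa [hw] using hcount2
    · have hwj : w j = count h mc rc j := by simp only [hw]; rw [if_neg (by omega)]
      rw [hwj]
      -- Because `j ≤ i`, the exponent that belongs to arity `j` is at least `a + 1`; a zero count
      -- has to be treated apart, since powers of `0` are not increasing in this sense by the
      -- general lemma.
      refine le_trans ?_ (hcount j hj3 (by omega))
      rcases Nat.eq_zero_or_pos (count h mc rc j) with h0 | h0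
      · rw [h0]; simp
      · exact pow_le_pow_right₀ (by exact_mod_cast h0) (by omega)
  calc (X + (E + 1)) ^ (a + 1) ≤ (i * w j) ^ (a + 1) := pow_le_pow_left₀ (by positivity) hle _
    _ = (i : ℝ) ^ (a + 1) * w j ^ (a + 1) := mul_pow _ _ _
    _ ≤ (k : ℝ) ^ k * B := by
        refine mul_le_mul ?_ hwB (by have := hw0 j; positivity) (by positivity)
        calc (i : ℝ) ^ (a + 1) ≤ (k : ℝ) ^ (a + 1) :=
              pow_le_pow_left₀ (by positivity) (by exact_mod_cast hik) _
          _ ≤ (k : ℝ) ^ k := pow_le_pow_right₀ (by exact_mod_cast (by omega : 1 ≤ k)) hak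

/-- Even the plain number of small edges, which bounds the loop overhead and the copying, is `O(B)`:
arity `2` contributes at most `X`, and every other arity has an exponent of at least `1`. -/
theorem index_le (hk : ∀ J < mc, 2 ≤ (edge h rc J).card ∧ (edge h rc J).card ≤ k)
    (hX : 1 ≤ X) (hXB : X ^ (k / 3) ≤ B) (hk3 : 3 ∣ k) (hcount2 : (count h mc rc 2 : ℝ) ≤ X)
    (hcount : ∀ i, 3 ≤ i → i ≤ k → (count h mc rc i : ℝ) ^ ((k - i + 2) / 3 + 1) ≤ B) :
    (mc : ℝ) ≤ (k + 1) * B := by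
  have hB : 0 ≤ B := le_trans (by positivity) hXB
  have h1 : (range mc).card = ∑ j ∈ range (k + 1), count h mc rc j :=
    card_eq_sum_card_fiberwise fun J hJ => by
      rw [mem_coe, mem_range] at hJ ⊢
      have := (hk J hJ).2
      omega
  rw [card_range] at h1
  have h2 : (mc : ℝ) = ∑ j ∈ range (k + 1), (count h mc rc j : ℝ) := by exact_mod_cast h1
  rw [h2]
  refine (sum_le_card_nsmul _ _ B fun j hj => ?_).trans (by simp)
  rw [mem_range] at hj
  obtain hj2 | rfl | hj3 : j < 2 ∨ j = 2 ∨ 3 ≤ j := by omega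
  · have : count h mc rc j = 0 := by
      rw [count, card_eq_zero]
      refine filter_false_of_mem fun J hJ => ?_
      have := (hk J (mem_range.1 hJ)).1
      omega
    rw [this]
    simpa using hB
  · exact hcount2.trans ((le_self_pow₀ hX (by omega)).trans hXB)
  · refine le_trans ?_ (hcount j hj3 (by omega))
    exact_mod_cast Nat.le_self_pow (by omega) _

/-- The first level is grouped by arity rather than bounded by `mc` times the worst child: a child
of small arity is expensive, but few edges precede it. Arities below `3` do not extend the empty
list. -/
theorem treeCost_nil_le (hc : 0 ≤ c) (hX : 1 ≤ X) (hk : 3 ∣ k)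
    (hsort : ∀ J J', J ≤ J' → J' < mc → (edge h rc J).card ≤ (edge h rc J').card)
    (hcard : ∀ J < mc, 2 ≤ (edge h rc J).card ∧ (edge h rc J).card ≤ k) (hXB : X ^ (k / 3) ≤ B)
    (hcount2 : (count h mc rc 2 : ℝ) ≤ X)
    (hcount : ∀ i, 3 ≤ i → i ≤ k → (count h mc rc i : ℝ) ^ ((k - i + 2) / 3 + 1) ≤ B) (d : ℕ) :
    treeCost h k mc rc X c (d + 1) [] ≤
      (c + c * (k + 1) + (k + 1) * (c * (2 * d + 1) * (k : ℝ) ^ k)) * B := by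
  classical
  have hB : 0 ≤ B := le_trans (by positivity) hXB
  have hcov : (cover h rc []).card = 0 := by simp [cover, coverList]
  rw [treeCost, hcov, show (k - 0 + 2) / 3 = k / 3 by omega]
  have hc' : 0 ≤ c * (2 * d + 1) := by positivity
  have h1 := mul_le_mul_of_nonneg_left hXB hc
  have h2 : (if 0 + 3 ≤ k then ∑ E ∈ range (limit mc []),
        (c + if Extends h k rc [] E then treeCost h k mc rc X c d [E] else 0) else 0) ≤
      c * ((k + 1) * B) + (k + 1) * (c * (2 * d + 1) * (k : ℝ) ^ k) * B := by
    split_ifs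
    · rw [sum_add_distrib]
      refine add_le_add ?_ ?_
      · rw [sum_const, card_range, nsmul_eq_mul, mul_comm]
        exact mul_le_mul_of_nonneg_left (index_le hcard hX hXB hk hcount2 hcount) hc
      · rw [← sum_fiberwise_of_maps_to (t := range (k + 1)) (g := fun E => (edge h rc E).card)
          fun E hE => mem_range.2 (by have := (hcard E (mem_range.1 hE)).2; omega)]
        refine (sum_le_card_nsmul _ _ (c * (2 * d + 1) * ((k : ℝ) ^ k * B)) fun i hi => ?_).trans ?_
        · rw [mem_range] at hi
          have hRHS : 0 ≤ c * (2 * d + 1) * ((k : ℝ) ^ k * B) := by positivity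
          by_cases hi3 : 3 ≤ i
          · set F := {E ∈ range (limit mc []) | (edge h rc E).card = i} with hF
            rcases F.eq_empty_or_nonempty with hem | hne
            · rw [hem, sum_empty]; exact hRHS
            · obtain ⟨E₀, hE₀, hmax⟩ := exists_max_image F id hne
              rw [hF, mem_filter, mem_range] at hE₀
              set Y := X + (E₀ + 1) with hY
              set a := (k - i + 2) / 3 with ha
              have hY1 : 1 ≤ Y := by have : (0 : ℝ) ≤ E₀ := by positivity
                                     linarith
              have hterm : ∀ E ∈ F, (if Extends h k rc [] E then treeCost h k mc rc X c d [E]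
                  else 0) ≤ c * (2 * d + 1) * Y ^ a := by
                intro E hEF
                have hEle : E ≤ E₀ := hmax E hEF
                rw [hF, mem_filter] at hEF
                split_ifs
                · refine (treeCost_le hc hX (by rw [hY]; linarith [(Nat.cast_nonneg E₀ : (0 : ℝ) ≤ E₀)])
                    d [E] (Y := Y) ?_).trans ?_
                  · simp only [limit]
                    have : (E : ℝ) ≤ E₀ := by exact_mod_cast hEle
                    linarith
                  · rw [cover_singleton, hEF.2]
                · positivity
              have hFcard : (F.card : ℝ) ≤ Y := by
                have : F.card ≤ E₀ + 1 := by
                  rw [← card_range (E₀ + 1)]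
                  exact card_le_card fun E hE => mem_range.2 (Nat.lt_succ_iff.2 (hmax E hE))
                have h5 : (F.card : ℝ) ≤ E₀ + 1 := by exact_mod_cast this
                linarith
              refine (sum_le_card_nsmul _ _ _ hterm).trans ?_
              rw [nsmul_eq_mul]
              have h6 := add_index_pow_le hX hk hsort (fun J hJ => (hcard J hJ).1) hXB hcount2
                hcount hE₀.1 hE₀.2 hi3 (by omega)
              rw [← hY, ← ha, pow_succ] at h6
              have h7 := mul_le_mul_of_nonneg_right hFcard
                (by positivity : 0 ≤ c * (2 * d + 1) * Y ^ a)
              have h8 := mul_le_mul_of_nonneg_left h6 hc'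
              linarith
          · refine (sum_nonpos fun E hE => ?_).trans hRHS
            rw [mem_filter] at hE
            rw [if_neg]
            intro hx
            have := hx.1
            rw [cover_singleton, hcov] at this
            omega
        · rw [card_range, nsmul_eq_mul]
          push_cast
          linarith
    · positivity
  linarith

theorem sum_large_le {n : ℕ} (hcard : ∀ J ∈ Ico mc m, (edge h rc J).card ≤ k)
    (hcount : ∀ i ≤ k, (#{J ∈ Ico mc m | (edge h rc J).card = i} : ℝ) * (n : ℝ) ^ (k - i) ≤ B) :
    ∑ E ∈ Ico mc m, (n : ℝ) ^ (k - (edge h rc E).card) ≤ (k + 1) * B := by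
  rw [← sum_fiberwise_of_maps_to (t := range (k + 1)) (g := fun E => (edge h rc E).card)
    fun E hE => mem_range.2 (by have := hcard E hE; omega)]
  refine (sum_le_card_nsmul _ _ B fun i hi => ?_).trans (by simp)
  rw [mem_range] at hi
  refine le_trans (le_of_eq ?_) (hcount i (by omega))
  rw [← nsmul_eq_mul, ← sum_const]
  refine sum_congr rfl fun E hE => ?_
  rw [(mem_filter.1 hE).2]

end

/-! ### The complete program and its word size -/

/-- The arities of the edges that can be contained in a `k`-set. -/
def arities (h k : ℕ) : List ℕ := (List.range (min h k + 1)).filter (2 ≤ ·)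

/-- Arity `i` is treated by matrix multiplication. -/
def smallE (h k i : ℕ) : Expr :=
  if i = 2 then .lit 1
  else leE (powE (cell 1 i) ((k - i + 2) / 3)) (powE (nE h) (k - i))

/-- Arity `i` is treated by matrix multiplication. -/
def Small (n k : ℕ) (s : Store) (i : ℕ) : Prop :=
  i = 2 ∨ s 1 i ^ ((k - i + 2) / 3) ≤ n ^ (k - i)

/-- Arity `i` is treated by direct enumeration. -/
def Large (n k : ℕ) (s : Store) (i : ℕ) : Prop := ¬ Small n k s i

def setup (h : ℕ) : Prog :=
  .seq (.set (h + 1) (.lit 0) (cell 0 0)) (.seq (.set (h + 1) (.lit 1) (.lit 0))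
    (.seq (.set (h + 1) (.lit 2) (.lit 0)) (.seq (.set (h + 1) (.lit 3) (.lit 0))
      (.set (h + 1) (.lit 4) (.lit 0)))))

/-- The program that decides whether there is a `k`-independent set. -/
def decideProg (pM : Prog) (h k : ℕ) : Prog :=
  .seq (setup h) (.seq (copyAll h (smallE h k) (arities h k))
    (.seq (.set (h + 1) (.lit 2) (cell (h + 1) 1))
      (.seq (copyAll h (fun i => notE (smallE h k i)) (arities h k))
        (.seq (buildTable h) (.seq (countFreeSets pM h k (k + 1) 0)
          (.seq (countLarge h k) (.set 0 (.lit 0) (outputE h k))))))))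

/-- The exponent in the bound for the word size. -/
def wordExp (h k c₀ : ℕ) : ℕ := (k + 2) * (h + 2) + 20 + 2 * h + 2 * k + h * k + (k + 1) * c₀ + 5

section

variable {W n m h k c₀ : ℕ} {rc : ℕ → ℕ → ℕ} {s : Store}

/-- Different edges have different keys below `n ^ h`. So the number of edges is polynomial in `n`
and fits in a word. -/
theorem EdgeData.le_pow (hE : EdgeData n m h rc) : m ≤ n ^ h := by
  have := card_le_card_of_injOn (s := range m) (t := range (n ^ h))
    (fun J => Nat.ofDigits n (edgeList h rc J)) ?_ ?_
  · simpa using this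
  · intro J hJ
    have := ofDigits_lt (hE.lt J (by simpa using hJ))
    simpa [edgeList] using this
  · intro J hJ J' hJ' he
    have hJ : J < m := by simpa using hJ
    have hJ' : J' < m := by simpa using hJ'
    exact hE.inj J hJ J' hJ' (ofDigits_inj (by simp [edgeList]) (hE.lt J hJ) (hE.lt J' hJ') he)

/-- All numbers that occur are bounded by powers of `n + 2` with exponents fixed by `h`, `k` and
`c₀`. The base is at least `2`, so constants are covered by `e < (n + 2) ^ e`, even for `n = 1`. -/
theorem words_of_le (hn : 1 ≤ n) (hW : (n + 2) ^ wordExp h k c₀ ≤ W) :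
    (∀ m ≤ n ^ h, Words W n m h k) ∧ (∀ q ≤ k, (n ^ q + 2) ^ c₀ ≤ W) ∧
      ∀ x ≤ n ^ h, ∀ a ≤ k, x ^ a < W := by
  have hlt : ∀ e, e < wordExp h k c₀ → (n + 2) ^ e < W := fun e he =>
    (Nat.pow_lt_pow_right (by omega) he).trans_le hW
  have hle : ∀ e, n ^ e ≤ (n + 2) ^ e := fun e => Nat.pow_le_pow_left (by omega) e
  have h2 : ∀ e, e < (n + 2) ^ e := fun e => e.lt_pow_self (by omega)
  have hexp : wordExp h k c₀ =
    (k + 2) * (h + 2) + 20 + 2 * h + 2 * k + h * k + (k + 1) * c₀ + 5 := rfl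
  have hbase : ∀ e, 1 ≤ (n + 2) ^ e := fun e => Nat.one_le_pow _ _ (by omega)
  refine ⟨fun m hm => ⟨?_, ?_, ?_, ?_, ?_⟩, ?_, ?_⟩
  · exact (h2 _).trans (hlt ((k + 2) * (h + 2) + 20) (by omega))
  · exact (hle h).trans_lt (hlt h (by omega))
  · refine lt_of_le_of_lt ?_ (hlt (2 * h + 2) (by omega))
    rw [show 2 * h + 2 = (h + 1) + (h + 1) by ring, pow_add]
    refine Nat.mul_le_mul ?_ (h2 _).le
    rw [pow_succ]
    have := hm.trans (hle h)
    have := hbase h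
    nlinarith
  · intro a ha
    exact (hle a).trans_lt (hlt a (by omega))
  · refine lt_of_le_of_lt ?_ (hlt (k + 3) (by omega))
    rw [show k + 3 = k + 1 + 1 + 1 by ring, pow_succ, pow_succ, pow_succ]
    have := hle k
    have := hbase k
    have : (n + 2) ^ k * 3 ≤ (n + 2) ^ k * (n + 2) := Nat.mul_le_mul_left _ (by omega)
    have : (n + 2) ^ k * (n + 2) * 3 ≤ (n + 2) ^ k * (n + 2) * (n + 2) :=
      Nat.mul_le_mul_left _ (by omega)
    have : (n + 2) ^ k * (n + 2) * (n + 2) * 3 ≤ (n + 2) ^ k * (n + 2) * (n + 2) * (n + 2) :=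
      Nat.mul_le_mul_left _ (by omega)
    omega
  · intro q hq
    have h3 : n ^ q + 2 ≤ (n + 2) ^ (k + 1) := by
      refine le_trans ?_ (Nat.pow_le_pow_right (by omega) (by omega : q + 1 ≤ k + 1))
      rw [pow_succ]
      have := hle q
      have := hbase q
      nlinarith
    refine (Nat.pow_le_pow_left h3 c₀).trans ?_
    rw [← pow_mul]
    exact (hlt _ (by omega)).le
  · intro x hx a ha
    refine (Nat.pow_le_pow_left hx a).trans_lt ?_
    rw [← pow_mul]
    refine (hle _).trans_lt (hlt _ ?_)
    have := Nat.mul_le_mul_left h ha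
    omega

theorem mem_arities {i : ℕ} : i ∈ arities h k ↔ 2 ≤ i ∧ i ≤ h ∧ i ≤ k := by
  simp only [arities, List.mem_filter, List.mem_range, decide_eq_true_eq]
  omega

theorem nodup_arities : (arities h k).Nodup := List.nodup_range.filter _

theorem sorted_arities : (arities h k).Pairwise (· ≤ ·) := List.pairwise_le_range.filter _

theorem Run.setup (hW : 20 < W) (hs : AllLt W s) (hn : s 0 0 = n) :
    Run W (setup h) s 20 (Copied h n 0 s []) := by
  refine Run.mono (T := 5 + (4 + (4 + (4 + 3)))) (Q := Copied h n 0 s [])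
    (Run.seq (Q₁ := fun s' => s' = s.write (h + 1) 0 n)
      (Run.set hs (Ev.lit (by omega)) ((Ev.cell hs (by omega)).congr hn) ?_ rfl)
      fun s₁ hl₁ h1 => Run.seq (Q₁ := fun s' => s' = s₁.write (h + 1) 1 0)
        (Run.set hl₁ (Ev.lit (by omega)) (Ev.lit (by omega)) ?_ rfl)
      fun s₂ hl₂ h2 => Run.seq (Q₁ := fun s' => s' = s₂.write (h + 1) 2 0)
        (Run.set hl₂ (Ev.lit (by omega)) (Ev.lit (by omega)) ?_ rfl)
      fun s₃ hl₃ h3 => Run.seq (Q₁ := fun s' => s' = s₃.write (h + 1) 3 0)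
        (Run.set hl₃ (Ev.lit (by omega)) (Ev.lit (by omega)) ?_ rfl)
      fun s₄ hl₄ h4 => Run.set (xv := 0) (iv := 4) hl₄ (Ev.lit (by omega)) (Ev.lit (by omega)) ?_ ?_)
    (by norm_num) fun _ _ h => h
  iterate 5 simp only [Expr.cost]; norm_num
  subst h4 h3 h2 h1
  exact
    { input := fun a ha => funext fun i => by simp [write_apply, show a ≠ h + 1 by omega]
      n_eq := by simp [write_apply]
      m_eq := by simp [write_apply]
      mc_eq := by simp [write_apply]
      pos_eq := by simp [write_apply]
      neg_eq := by simp [write_apply]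
      edges := by simp }

theorem EvP.small {mc : ℕ} {s₀ : Store} {R : List (ℕ → ℕ)} (hW : Words W n m h k) (hs : AllLt W s)
    (hc : Copied h n mc s₀ R s) {i : ℕ} (hi : i ∈ arities h k)
    (hpow : ∀ a ≤ k, s₀ 1 i ^ a < W) : EvP W s (smallE h k i) (Small n k s₀ i) := by
  have hk := hW.k_lt
  rw [mem_arities] at hi
  unfold smallE Small
  split_ifs with h2
  · exact EvP.true hW.one_lt (.inl h2)
  · refine (EvP.le hW.one_lt (Ev.pow ((Ev.cell hs (by omega)).congr
      (congrFun (hc.input 1 (by omega)) i)) fun a ha => hpow a (by omega))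
      (Ev.pow ((Ev.cell hs (by omega)).congr hc.n_eq) fun a ha => hW.pow a (by omega))).congr ?_
    simp [h2]

theorem length_inputEdges_le {l : List ℕ} {i : ℕ} (hi : i ∈ l) :
    s 1 i ≤ (l.flatMap (inputEdges s)).length := by
  induction l with
  | nil => simp at hi
  | cons a l ih =>
    rw [List.flatMap_cons, List.length_append]
    rcases List.mem_cons.1 hi with rfl | hi
    · simp [inputEdges]
    · have := ih hi
      omega

theorem sum_map_le {l : List ℕ} {f g : ℕ → ℝ} {M : ℝ} (hfg : ∀ i ∈ l, f i ≤ g i * M) :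
    (l.map f).sum ≤ (l.map g).sum * M := by
  induction l with
  | nil => simp
  | cons a l ih =>
    simp only [List.mem_cons, forall_eq_or_imp] at hfg
    simp only [List.map_cons, List.sum_cons, add_mul]
    exact add_le_add hfg.1 (ih hfg.2)

end

/-! ### Small arities before large ones, and correctness of the program -/

open Classical in
/-- The arities that are treated by matrix multiplication. -/
noncomputable def smallArities (n h k : ℕ) (s : Store) : List ℕ := (arities h k).filter (Small n k s ·)

open Classical in
/-- The arities that are treated by direct enumeration. -/
noncomputable def largeArities (n h k : ℕ) (s : Store) : List ℕ :=
  (arities h k).filter (Large n k s ·)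

/-- All edges that can be contained in a `k`-set. -/
noncomputable def allEdges (n h k : ℕ) (s : Store) : List (ℕ → ℕ) :=
  (smallArities n h k s ++ largeArities n h k s).flatMap (inputEdges s)

/-- The number of edges that are treated by matrix multiplication. -/
noncomputable def numSmall (n h k : ℕ) (s : Store) : ℕ :=
  ((smallArities n h k s).flatMap (inputEdges s)).length

section

variable {W n h k c₀ : ℕ} {s : Store} {H : Hypergraph ℕ}

theorem mem_smallArities {i : ℕ} :
    i ∈ smallArities n h k s ↔ i ∈ arities h k ∧ Small n k s i := by
  simp [smallArities]

theorem mem_largeArities {i : ℕ} :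
    i ∈ largeArities n h k s ↔ i ∈ arities h k ∧ ¬ Small n k s i := by
  classical
  simp [largeArities, show Large n k s i ↔ ¬ Small n k s i from Iff.rfl]

theorem mem_append_arities {i : ℕ} :
    i ∈ smallArities n h k s ++ largeArities n h k s ↔ i ∈ arities h k := by
  rw [List.mem_append, mem_smallArities, mem_largeArities]
  tauto

theorem nodup_append_arities : (smallArities n h k s ++ largeArities n h k s).Nodup :=
  (nodup_arities.filter _).append (nodup_arities.filter _) fun _ h1 h2 =>
    (mem_largeArities.1 h2).2 (mem_smallArities.1 h1).2

theorem append_arities_le {i : ℕ} (hi : i ∈ smallArities n h k s ++ largeArities n h k s) :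
    2 ≤ i ∧ i ≤ h := by
  rw [mem_append_arities, mem_arities] at hi
  omega

theorem allEdges_eq : allEdges n h k s = (smallArities n h k s).flatMap (inputEdges s) ++
    (largeArities n h k s).flatMap (inputEdges s) := List.flatMap_append

theorem numSmall_le : numSmall n h k s ≤ (allEdges n h k s).length := by
  rw [allEdges_eq, List.length_append, numSmall]
  omega

variable (hI : H.IsInput n h s)
include hI

theorem allEdges_edgeData (hn : 1 ≤ n) (hV : H.vertexSet = Set.Iio n) :
    EdgeData n (allEdges n h k s).length h ((allEdges n h k s).getD · 0) :=
  edgeData_input hI hn hV nodup_append_arities fun _ => append_arities_le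

theorem card_mem_arities {J : ℕ} (hJ : J < (allEdges n h k s).length) :
    (edge h ((allEdges n h k s).getD · 0) J).card ∈ arities h k :=
  mem_append_arities.1 (getD_flatMap hI (fun _ => append_arities_le) hJ).1

theorem card_mem_small {J : ℕ} (hJ : J < numSmall n h k s) :
    (edge h ((allEdges n h k s).getD · 0) J).card ∈ smallArities n h k s := by
  have h1 := (getD_flatMap hI (fun i hi => append_arities_le (List.mem_append_left _ hi)) hJ).1
  rw [edge] at h1 ⊢
  rwa [allEdges_eq, List.getD_append _ _ _ _ hJ]

theorem card_mem_large {J : ℕ} (hJ : numSmall n h k s ≤ J) (hJ' : J < (allEdges n h k s).length) :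
    (edge h ((allEdges n h k s).getD · 0) J).card ∈ largeArities n h k s := by
  rw [allEdges_eq, List.length_append] at hJ'
  unfold numSmall at hJ
  have h1 := (getD_flatMap hI (l := largeArities n h k s)
    (J := J - ((smallArities n h k s).flatMap (inputEdges s)).length)
    (fun i hi => append_arities_le (List.mem_append_right _ hi)) (by omega)).1
  rw [edge] at h1 ⊢
  rwa [allEdges_eq, List.getD_append_right _ _ _ _ hJ]

theorem sorted_small {J J' : ℕ} (hJ : J ≤ J') (hJ' : J' < numSmall n h k s) :
    (edge h ((allEdges n h k s).getD · 0) J).card ≤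
      (edge h ((allEdges n h k s).getD · 0) J').card := by
  rcases hJ.eq_or_lt with rfl | hlt
  · rfl
  have h1 := List.pairwise_iff_getElem.1 (sorted_verts hI (l := smallArities n h k s)
    (sorted_arities.filter _) fun i hi => append_arities_le (List.mem_append_left _ hi)) J J'
      (hlt.trans hJ') hJ' hlt
  rw [edge, edge, allEdges_eq, List.getD_append _ _ _ _ hJ', List.getD_append _ _ _ _
    (hlt.trans hJ'), List.getD_eq_getElem _ _ hJ', List.getD_eq_getElem _ _ (hlt.trans hJ')]
  exact h1

end

theorem Run.decideProg {ω : ℝ} (hω : 2 ≤ ω) {pM : Prog} {C : ℝ} {c₀ : ℕ}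
    (hM : Multiplies ω pM C c₀) (h k : ℕ) :
    ∃ c₁ c₂ c₃ : ℝ, 0 ≤ c₁ ∧ 0 ≤ c₂ ∧ 0 ≤ c₃ ∧ ∀ {W n : ℕ} {H : Hypergraph ℕ} {s : Store}, 1 ≤ n →
      (n + 2) ^ wordExp h k c₀ ≤ W → H.vertexSet = Set.Iio n → H.IsArityAtMost h → AllLt W s →
      H.IsInput n h s → Run W (decideProg pM h k) s
        (c₁ * ((allEdges n h k s).length + 1) +
          (treeCost h k (numSmall n h k s) ((allEdges n h k s).getD · 0) ((n : ℝ) ^ ω) c₂ (k + 1) [] +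
          c₃ * (∑ E ∈ Ico (numSmall n h k s) (allEdges n h k s).length,
            (n : ℝ) ^ (k - (edge h ((allEdges n h k s).getD · 0) E).card) + 1)))
        (fun s' => s' 0 0 = 1 ↔ H.HasIndependentSet k) := by
  classical
  obtain ⟨c₂, hc₂, h₂⟩ := Run.countFreeSets hω hM h k (k + 1) 0
  obtain ⟨c₃, hc₃, h₃⟩ := Run.countLarge h k
  set g₁ : ℕ → ℝ := fun i => ((smallE h k i).cost + 1 : ℝ) + (h * 60 + 80)
  set g₂ : ℕ → ℝ := fun i => ((notE (smallE h k i)).cost + 1 : ℝ) + (h * 60 + 80)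
  set t₁ : ℝ := ((arities h k).map g₁).sum
  set t₂ : ℝ := ((arities h k).map g₂).sum
  set t₃ : ℝ := ((keyE (nE h) (edgeE h (cell (h + 1) 5))).cost + 30 : ℝ)
  set t₄ : ℝ := ((outputE h k).cost + 2 : ℝ)
  have ht₁0 : 0 ≤ t₁ := List.sum_nonneg (by simp only [List.mem_map]; rintro _ ⟨i, -, rfl⟩; positivity)
  have ht₂0 : 0 ≤ t₂ := List.sum_nonneg (by simp only [List.mem_map]; rintro _ ⟨i, -, rfl⟩; positivity)
  have ht₃0 : 0 ≤ t₃ := by positivity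
  have ht₄0 : 0 ≤ t₄ := by positivity
  refine ⟨30 + t₁ + t₂ + t₃ + t₄, c₂, c₃, by positivity, hc₂, hc₃, ?_⟩
  intro W n H s hn hW hV hA hs hI
  obtain ⟨hwords, hMW, hpow⟩ := words_of_le hn hW
  set R := allEdges n h k s with hR
  set m := R.length with hm
  set mc := numSmall n h k s with hmc
  set rc : ℕ → ℕ → ℕ := (R.getD · 0) with hrc
  have hdata : EdgeData n m h rc := allEdges_edgeData hI hn hV
  have hWm := hwords m hdata.le_pow
  have hk := hWm.k_lt
  have hlen : ∀ i ∈ arities h k, s 1 i ≤ m := fun i hi =>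
    length_inputEdges_le (mem_append_arities.2 hi)
  have hpow' : ∀ i ∈ arities h k, ∀ a ≤ k, s 1 i ^ a < W := fun i hi =>
    hpow _ ((hlen i hi).trans hdata.le_pow)
  have har : ∀ i ∈ arities h k, i ≤ h ∧ 1 ≤ h := fun i hi => by rw [mem_arities] at hi; omega
  -- Each arity has at most `m` edges, so copying is linear in `m` with a constant that depends only
  -- on `h` and `k`.
  have hcopy : ∀ (P : ℕ → Prop) [DecidablePred P] (f : ℕ → ℕ),
      (1 + ((arities h k).map fun i => (f i + 1 : ℝ) + (h * 60 + 80) *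
        (if P i then (s 1 i : ℝ) + 1 else 1)).sum) ≤
      1 + ((arities h k).map fun i => (f i + 1 : ℝ) + (h * 60 + 80)).sum * (m + 1) := by
    intro P _ f
    refine add_le_add le_rfl (sum_map_le fun i hi => ?_)
    have h1 : (s 1 i : ℝ) ≤ m := by exact_mod_cast hlen i hi
    have h2 : (if P i then (s 1 i : ℝ) + 1 else 1) ≤ m + 1 := by split_ifs <;> [linarith; simp]
    have h3 : ((h : ℝ) * 60 + 80) * (if P i then (s 1 i : ℝ) + 1 else 1) ≤ (h * 60 + 80) * (m + 1) :=
      mul_le_mul_of_nonneg_left h2 (by positivity)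
    have h4 : (0 : ℝ) ≤ (f i + 1) * m := by positivity
    linarith
  have hR₁ : ([] ++ ((arities h k).filter (Small n k s ·)).flatMap (inputEdges s)).length = mc := by
    rw [List.nil_append]
    rfl
  have hmcm : mc ≤ m := numSmall_le
  have hRR : [] ++ ((arities h k).filter (Small n k s ·)).flatMap (inputEdges s) ++
      ((arities h k).filter (Large n k s ·)).flatMap (inputEdges s) = R := by
    rw [hR, allEdges_eq, List.nil_append, smallArities, largeArities]
  have hcardk : ∀ J < m, (edge h rc J).card ∈ arities h k := fun J hJ => card_mem_arities hI hJ
  refine (Run.seq (Run.setup (by omega) hs hI.1) fun s₁ hs₁ h₁ =>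
    Run.seq (Run.copyAll hWm hs₁ h₁ (smallE h k) (Small n k s) _ har
      (fun i hi R' s' hs' hc' => EvP.small hWm hs' hc' hi (hpow' i hi)) (hR₁.trans_le hmcm))
    fun s₂ hs₂ h₂' =>
    Run.seq (Q₁ := Copied h n mc s ([] ++ ((arities h k).filter (Small n k s ·)).flatMap
      (inputEdges s))) (Run.set hs₂ (Ev.lit (by omega)) (Ev.cell hs₂ (by omega)) le_rfl
      { input := fun a ha => by
          rw [← h₂'.input a ha]
          exact funext fun i => by rw [write_apply, if_neg (by omega)]
        n_eq := by rw [write_apply, if_neg (by omega), h₂'.n_eq]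
        m_eq := by rw [write_apply, if_neg (by omega), h₂'.m_eq]
        mc_eq := by rw [write_same, h₂'.m_eq, hR₁]
        pos_eq := by rw [write_apply, if_neg (by omega), h₂'.pos_eq]
        neg_eq := by rw [write_apply, if_neg (by omega), h₂'.neg_eq]
        edges := fun J hJ r hr => by rw [write_apply, if_neg (by omega), h₂'.edges J hJ r hr] })
    fun s₃ hs₃ h₃' =>
    Run.seq (Run.copyAll hWm hs₃ h₃' (fun i => notE (smallE h k i)) (Large n k s ·) _ har
      (fun i hi R' s' hs' hc' => EvP.not hWm.one_lt (EvP.small hWm hs' hc' hi (hpow' i hi)))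
      (by rw [hRR]))
    fun s₄ hs₄ h₄ => Run.seq (Run.buildTable (s₀ := s) hWm hs₄ (by rwa [hRR] at h₄) rfl hdata)
    fun s₅ hs₅ h₅ => Run.seq (h₂ (L := []) rfl ⟨hWm, hdata, hmcm, by simp, by simp⟩ hMW hs₅ ⟨h₅.1, trivial⟩
      (by simp [cover, coverList]) (by simp) (by simp [cover, coverList]; omega) fun J hJ => ?_)
    fun s₆ hs₆ h₆ => Run.seq (h₃ ⟨hWm, hdata, hmcm, by simp, by simp⟩ hs₆
      (Frame.holds (L := []) h₆.1 ⟨h₅.1, trivial⟩) fun J hJ => ?_)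
    fun s₇ hs₇ h₇ => Run.output (N := (above n k ∅ (EdgeFree h rc m)).card)
      ⟨hWm, hdata, hmcm, by simp, by simp⟩ hs₇
      (Frame.holds (L := []) h₇.1 (Frame.holds (L := []) h₆.1 ⟨h₅.1, trivial⟩))
      (card_above_le _ _) ?_).mono ?_ ?_
  · rw [← card_pos]
    have := hcardk J hJ
    rw [mem_arities] at this
    omega
  · have := hcardk J hJ
    rw [mem_arities] at this
    omega
  -- The recursion has added the sets free of the first `mc` edges, the enumeration has subtracted
  -- those whose first edge comes later; by `card_edgeFree` the independent sets remain.
  · have h0 : acc (n ^ k + 1) h s₅ = 0 := by simp [acc, h₅.2.1, h₅.2.2]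
    have hall : (Ico mc m).filter (fun E => (edge h rc E).card ≤ k) = Ico mc m :=
      filter_true_of_mem fun E hE => by
        have := hcardk E (mem_Ico.1 hE).2
        rw [mem_arities] at this
        omega
    rw [h₇.2, h₆.2, h0, freeSets_nil, card_edgeFree hmcm, hall]
    push_cast
    ring
  · have e₁ := hcopy (Small n k s) fun i => (smallE h k i).cost
    have e₂ := hcopy (Large n k s ·) fun i => (notE (smallE h k i)).cost
    have hm0 : (0 : ℝ) ≤ m := by positivity
    have e₄ : 0 ≤ t₄ * m := by positivity
    have hcost : (((Expr.lit 2).cost + (cell (h + 1) 1).cost + 1 : ℕ) : ℝ) = 4 := by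
      simp [Expr.cost]
    rw [hcost]
    refine le_trans (add_le_add le_rfl (add_le_add e₁ (add_le_add le_rfl (add_le_add e₂ le_rfl)))) ?_
    linarith
  · intro s' _ hs'
    rw [hs', card_pos]
    unfold Hypergraph.HasIndependentSet
    refine exists_congr fun S => ?_
    rw [mem_above, hV, ← coe_range, coe_subset]
    refine and_congr_right fun _ => and_congr_right fun hS => ?_
    rw [and_iff_right (empty_subset S)]
    exact edgeFree_iff hI hA (fun _ => append_arities_le)
      (fun i h2 hh hk => mem_append_arities.2 (mem_arities.2 ⟨h2, hh, hk⟩)) hS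

/-! ### Comparison with the minima in the bound -/

section

variable {n h k : ℕ} {s : Store} {H : Hypergraph ℕ} {B : ℝ}

theorem count_two_le (hI : H.IsInput n h s) (hn : 1 ≤ n) (hV : H.vertexSet = Set.Iio n) :
    count h (numSmall n h k s) ((allEdges n h k s).getD · 0) 2 ≤ n ^ 2 := by
  have hd := allEdges_edgeData (k := k) hI hn hV
  have hlt : ∀ J < numSmall n h k s, J < (allEdges n h k s).length := fun J hJ =>
    hJ.trans_le numSmall_le
  have := card_le_card_of_injOn (s := {J ∈ range (numSmall n h k s) |
      (edge h ((allEdges n h k s).getD · 0) J).card = 2}) (t := powersetCard 2 (range n))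
    (edge h ((allEdges n h k s).getD · 0)) ?_ ?_
  · rw [card_powersetCard, card_range] at this
    exact this.trans (Nat.choose_le_pow n 2)
  · intro J hJ
    simp only [coe_filter, mem_range, Set.mem_ofPred_eq] at hJ
    rw [mem_coe, mem_powersetCard]
    refine ⟨fun v hv => mem_range.2 (hd.lt J (hlt J hJ.1) v ?_), hJ.2⟩
    rwa [← edgeList_toFinset, List.mem_toFinset] at hv
  · intro J hJ J' hJ' he
    simp only [coe_filter, mem_range, Set.mem_ofPred_eq] at hJ hJ'
    exact edge_injective hI nodup_append_arities (fun _ => append_arities_le) (hlt J hJ.1)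
      (hlt J' hJ'.1) he

/-- If arity `i` occurs among the small ones, multiplying the inequality in `Small` by `m_i` shows
that the minimum is the power of `m_i`. -/
theorem count_pow_le (hI : H.IsInput n h s) (hV : H.vertexSet = Set.Iio n) (hB0 : 0 ≤ B)
    (hB : ∀ i, 3 ≤ i → i ≤ h → i ≤ k → min (((H.edgesOfArity i).ncard : ℝ) ^ ((k - i + 2) / 3 + 1))
      ((H.edgesOfArity i).ncard * (n : ℝ) ^ (k - i)) ≤ B) {i : ℕ} (hi : 3 ≤ i) :
    (count h (numSmall n h k s) ((allEdges n h k s).getD · 0) i : ℝ) ^ ((k - i + 2) / 3 + 1) ≤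
      B := by
  rcases (count h (numSmall n h k s) ((allEdges n h k s).getD · 0) i).eq_zero_or_pos with h0 | h0
  · rwa [h0, Nat.cast_zero, zero_pow (by omega)]
  obtain ⟨J, hJ⟩ := card_pos.1 h0
  rw [mem_filter, mem_range] at hJ
  have hmem := card_mem_small (k := k) hI hJ.1
  rw [hJ.2, mem_smallArities, mem_arities] at hmem
  obtain ⟨⟨h2, hih, hik⟩, hs⟩ := hmem
  have hs := hs.resolve_left (by omega)
  rw [(hI.2 i (mem_Icc.2 ⟨h2, hih⟩)).1] at hs
  have hle : count h (numSmall n h k s) ((allEdges n h k s).getD · 0) i ≤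
      (H.edgesOfArity i).ncard :=
    card_le_ncard hI hV nodup_append_arities (fun _ => append_arities_le) fun J hJ => by
      rw [mem_filter, mem_range] at hJ
      exact ⟨hJ.1.trans_le numSmall_le, hJ.2⟩
  have hmin := hB i hi hih hik
  rw [min_eq_left] at hmin
  · exact (pow_le_pow_left₀ (by positivity) (by exact_mod_cast hle) _).trans hmin
  · rw [pow_succ']
    exact mul_le_mul_of_nonneg_left (by exact_mod_cast hs) (by positivity)

/-- If arity `i` occurs among the large ones, the reverse inequality, again multiplied by `m_i`,
makes `m_i * n ^ (k - i)` the minimum. -/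
theorem card_large_mul_le (hI : H.IsInput n h s) (hV : H.vertexSet = Set.Iio n) (hB0 : 0 ≤ B)
    (hB : ∀ i, 3 ≤ i → i ≤ h → i ≤ k → min (((H.edgesOfArity i).ncard : ℝ) ^ ((k - i + 2) / 3 + 1))
      ((H.edgesOfArity i).ncard * (n : ℝ) ^ (k - i)) ≤ B) (i : ℕ) :
    (#{J ∈ Ico (numSmall n h k s) (allEdges n h k s).length |
      (edge h ((allEdges n h k s).getD · 0) J).card = i} : ℝ) * (n : ℝ) ^ (k - i) ≤ B := by
  rcases (#{J ∈ Ico (numSmall n h k s) (allEdges n h k s).length |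
      (edge h ((allEdges n h k s).getD · 0) J).card = i}).eq_zero_or_pos with h0 | h0
  · rwa [h0, Nat.cast_zero, zero_mul]
  obtain ⟨J, hJ⟩ := card_pos.1 h0
  rw [mem_filter, mem_Ico] at hJ
  have hmem := card_mem_large (k := k) hI hJ.1.1 hJ.1.2
  rw [hJ.2, mem_largeArities, mem_arities, Small, not_or, not_le] at hmem
  obtain ⟨⟨h2, hih, hik⟩, h2', hs⟩ := hmem
  rw [(hI.2 i (mem_Icc.2 ⟨h2, hih⟩)).1] at hs
  have hle : #{J ∈ Ico (numSmall n h k s) (allEdges n h k s).length |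
      (edge h ((allEdges n h k s).getD · 0) J).card = i} ≤ (H.edgesOfArity i).ncard :=
    card_le_ncard hI hV nodup_append_arities (fun _ => append_arities_le) fun J hJ => by
      rw [mem_filter, mem_Ico] at hJ
      exact ⟨hJ.1.2, hJ.2⟩
  have hmin := hB i (by omega) hih hik
  rw [min_eq_right] at hmin
  · exact (mul_le_mul_of_nonneg_right (by exact_mod_cast hle) (by positivity)).trans hmin
  · rw [pow_succ']
    exact mul_le_mul_of_nonneg_left (by exact_mod_cast hs.le) (by positivity)

end

theorem Run.decideProg_le {ω : ℝ} (hω : 2 ≤ ω) {pM : Prog} {C : ℝ} {c₀ : ℕ}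
    (hM : Multiplies ω pM C c₀) (h k : ℕ) (hk : 3 ∣ k) :
    ∃ K : ℝ, ∀ {W n : ℕ} {H : Hypergraph ℕ} {s : Store} {B : ℝ}, 1 ≤ n →
      (n + 2) ^ wordExp h k c₀ ≤ W → H.vertexSet = Set.Iio n → H.IsArityAtMost h → AllLt W s →
      H.IsInput n h s → ((n : ℝ) ^ ω) ^ (k / 3) ≤ B →
      (∀ i, 3 ≤ i → i ≤ h → i ≤ k → min (((H.edgesOfArity i).ncard : ℝ) ^ ((k - i + 2) / 3 + 1))
        ((H.edgesOfArity i).ncard * (n : ℝ) ^ (k - i)) ≤ B) →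
      Run W (WordRAM.decideProg pM h k) s (K * B) (fun s' => s' 0 0 = 1 ↔ H.HasIndependentSet k) := by
  obtain ⟨c₁, c₂, c₃, hc₁, hc₂, hc₃, hrun⟩ := Run.decideProg hω hM h k
  refine ⟨c₁ * (2 * (k + 1) + 1) + ((c₂ + c₂ * (k + 1) +
    (k + 1) * (c₂ * (2 * k + 1) * (k : ℝ) ^ k)) + c₃ * ((k + 1) + 1)), ?_⟩
  intro W n H s B hn hW hV hA hs hI hXB hB
  have hn1 : (1 : ℝ) ≤ n := by exact_mod_cast hn
  have hX : 1 ≤ (n : ℝ) ^ ω := Real.one_le_rpow hn1 (by linarith)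
  have hB1 : 1 ≤ B := (one_le_pow₀ hX).trans hXB
  have hB0 : 0 ≤ B := by linarith
  have hcard : ∀ J < numSmall n h k s, 2 ≤ (edge h ((allEdges n h k s).getD · 0) J).card ∧
      (edge h ((allEdges n h k s).getD · 0) J).card ≤ k := fun J hJ => by
    have := card_mem_arities (k := k) hI (hJ.trans_le numSmall_le)
    rw [mem_arities] at this
    omega
  have hcount2 : (count h (numSmall n h k s) ((allEdges n h k s).getD · 0) 2 : ℝ) ≤
      (n : ℝ) ^ ω := by
    refine le_trans ?_ (Real.rpow_le_rpow_of_exponent_le hn1 hω)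
    rw [Real.rpow_ofNat]
    exact_mod_cast count_two_le hI hn hV
  have hcount := fun i (hi : 3 ≤ i) (_ : i ≤ k) => count_pow_le (k := k) hI hV hB0 hB hi
  have htree := treeCost_nil_le hc₂ hX hk (fun J J' => sorted_small (k := k) hI) hcard hXB hcount2
    hcount k
  have hmc := index_le hcard hX hXB hk hcount2 hcount
  have hlarge := sum_large_le (k := k) (B := B) (n := n) (rc := ((allEdges n h k s).getD · 0))
    (mc := numSmall n h k s) (m := (allEdges n h k s).length) (h := h) (fun J hJ => by
      have := card_mem_arities (k := k) hI (mem_Ico.1 hJ).2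
      rw [mem_arities] at this
      omega) fun i _ => card_large_mul_le hI hV hB0 hB i
  -- Small edges are bounded by `index_le`; each large edge contributes at least `1` to the sum
  -- bounded in `hlarge`. So the time for reading the edges is within the bound.
  have hm : ((allEdges n h k s).length : ℝ) ≤ 2 * (k + 1) * B := by
    have h1 : ((allEdges n h k s).length : ℝ) - numSmall n h k s ≤
        ∑ E ∈ Ico (numSmall n h k s) (allEdges n h k s).length,
          (n : ℝ) ^ (k - (edge h ((allEdges n h k s).getD · 0) E).card) := by
      refine le_trans (le_of_eq ?_) (card_nsmul_le_sum _ _ 1 fun E _ => one_le_pow₀ hn1)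
      rw [Nat.card_Ico, nsmul_one, Nat.cast_sub numSmall_le]
    linarith
  refine (hrun hn hW hV hA hs hI).mono ?_ fun _ _ h => h
  rw [add_mul, add_mul, mul_assoc c₁, mul_assoc c₃]
  exact add_le_add (mul_le_mul_of_nonneg_left (by linarith) hc₁)
    (add_le_add htree (mul_le_mul_of_nonneg_left (by linarith) hc₃))

end WordRAM

theorem mainTheorem2 (h k : ℕ) (hk : 3 ∣ k) (ω : ℝ) (hω : WordRAM.MatMulInTime ω) :
    ∃ (p : WordRAM.Prog) (C : ℝ) (c : ℕ), ∀ (n : ℕ), 1 ≤ n → ∀ (W : ℕ), (n + 2) ^ c ≤ W →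
      ∀ (H : Hypergraph ℕ), H.vertexSet = Set.Iio n → H.IsArityAtMost h →
      ∀ s : WordRAM.Store, (∀ a i, s a i < W) → H.IsInput n h s →
        ∃ (s' : WordRAM.Store) (t : ℕ), WordRAM.Exec W p s s' t ∧
          (s' 0 0 = 1 ↔ H.HasIndependentSet k) ∧
          (t : ℝ) ≤ C * ((n : ℝ) ^ ((k : ℝ) * ω / 3) +
            ∑ i ∈ Finset.Icc 3 h,
              min (((H.edgesOfArity i).ncard : ℝ) ^ ⌈((k : ℝ) - (i : ℝ) + 3) / 3⌉)
                (((H.edgesOfArity i).ncard : ℝ) * (n : ℝ) ^ ((k : ℤ) - (i : ℤ)))) := by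
  -- All factors are 0-1 matrices, so entries bounded by `N ^ 0` suffice.
  obtain ⟨pM, C, c₀, hM⟩ := hω 0
  obtain ⟨K, hK⟩ := WordRAM.Run.decideProg_le hω.two_le hM h k hk
  refine ⟨WordRAM.decideProg pM h k, K, WordRAM.wordExp h k c₀, ?_⟩
  intro n hn W hW H hV hA s hs hI
  have hn0 : (0 : ℝ) ≤ n := by positivity
  -- Terms with `i > k`, whose exponents may be negative, are only needed to be nonnegative.
  have hnonneg : ∀ i ∈ Finset.Icc 3 h,
      0 ≤ min (((H.edgesOfArity i).ncard : ℝ) ^ ⌈((k : ℝ) - (i : ℝ) + 3) / 3⌉)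
        (((H.edgesOfArity i).ncard : ℝ) * (n : ℝ) ^ ((k : ℤ) - (i : ℤ))) := fun i _ =>
    le_min (by positivity) (by positivity)
  have hrun := hK hn hW hV hA hs hI
    (B := (n : ℝ) ^ ((k : ℝ) * ω / 3) + ∑ i ∈ Finset.Icc 3 h,
      min (((H.edgesOfArity i).ncard : ℝ) ^ ⌈((k : ℝ) - (i : ℝ) + 3) / 3⌉)
        (((H.edgesOfArity i).ncard : ℝ) * (n : ℝ) ^ ((k : ℤ) - (i : ℤ)))) ?_ ?_
  · obtain ⟨s', t, he, ht, -, hQ⟩ := hrun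
    exact ⟨s', t, he, hQ, ht⟩
  · refine le_trans (le_of_eq ?_) (le_add_of_nonneg_right (Finset.sum_nonneg hnonneg))
    rw [← Real.rpow_natCast, ← Real.rpow_mul hn0, Nat.cast_div hk (by norm_num)]
    push_cast
    ring_nf
  · intro i hi hih hik
    have h1 := Finset.single_le_sum hnonneg (Finset.mem_Icc.2 ⟨hi, hih⟩)
    have h2 : (0 : ℝ) ≤ (n : ℝ) ^ ((k : ℝ) * ω / 3) := by positivity
    -- With `d = k - i`, the natural quotient `(d + 2) / 3` is `⌈d / 3⌉`; the extra `1` is the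
    -- factor for the choice of the first edge.
    have hceil : ⌈((k : ℝ) - (i : ℝ) + 3) / 3⌉ = (((k - i + 2) / 3 + 1 : ℕ) : ℤ) := by
      have h3 : ((k : ℝ) - i) = ((k - i : ℕ) : ℝ) := by rw [Nat.cast_sub hik]
      rw [h3, Int.ceil_eq_iff]
      generalize k - i = d
      have h4 : d ≤ 3 * ((d + 2) / 3) := by omega
      have h5 : 3 * ((d + 2) / 3) ≤ d + 2 := by omega
      have h4 : (d : ℝ) ≤ 3 * ((d + 2) / 3 : ℕ) := by exact_mod_cast h4
      have h5 : 3 * (((d + 2) / 3 : ℕ) : ℝ) ≤ d + 2 := by exact_mod_cast h5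
      rw [Int.cast_natCast, Nat.cast_add, Nat.cast_one]
      constructor <;> linarith
    have hpow : (k : ℤ) - (i : ℤ) = ((k - i : ℕ) : ℤ) := by omega
    simp only [hceil, hpow, zpow_natCast] at h1
    linarith
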